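/- **Setting.** Let $\mathcal H$ be a complex Hilbert space with an orthogonal decomposition $\mathcal H=\mathcal H_+\oplus\mathcal H_-$ into infinite-dimensional closed subspaces, and let $P_+$ be the orthogonal projector onto $\mathcal H_+$. Let $p$ be a real number with $1<p<\infty$, or $p=0$. Write $L^p(E,F)$ for the Schatten class of operators between Hilbert spaces $E$ and $F$ with its norm $\|\cdot\|_p$ if $1<p<\infty$, and for the space of compact operators with the operator norm if $p=0$. Identify closed subspaces $W\subset\mathcal H$ with the orthogonal projectors $P_W$ onto them. * The *$p$-restricted Grassmannian* $\mathrm{Gr}^p_{\rm res}$ is the set of closed subspaces $W$ such that the orthogonal projection $W\to\mathcal H_+$ is Fredholm and the orthogonal projection $W\to\mathcal H_-$ belongs to $L^p$. For $W\in\mathrm{Gr}^p_{\rm res}$ put $\phi_W(V)=P_{W^\perp}(P_W|_V)^{-1}$ for all $V\in\mathrm{Gr}^p_{\rm res}$ with $V\oplus W^\perp=\mathcal H$ (so $V$ is the graph of $\phi_W(V):W\to W^\perp$). * $\mathfrak U^p_{\rm res}$ is the set of partial isometries $u$ on $\mathcal H$ with $s(u):=u^*u\in\mathrm{Gr}^p_{\rm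 res}$ and $t(u):=uu^*\in\mathrm{Gr}^p_{\rm res}$. It is a groupoid over $\mathrm{Gr}^p_{\rm res}$ with source $s$, target $t$, multiplication $m(u,v)=uv$ (for $u^*u=vv^*$), identity section $\varepsilon(P)=P$ and inversion $\iota(u)=u^*$. * $U^p_{\rm res}=\{u\text{ unitary on }\mathcal H : [u,P_+]\in L^p\}$, with the smooth structure given by $u\mapsto(u,[u,P_+])\in L^\infty(\mathcal H)\times L^p(\mathcal H)$. A *smooth local cross section* is a smooth map $\sigma:\Omega\to U^p_{\rm res}$ on an open set $\Omega\subset\mathrm{Gr}^p_{\rm res}$ with $\sigma(V)\mathcal H_+=V$ for all $V\in\Omega$. * $\mathfrak u_+$ is the real Banach space of skew-adjoint bounded operators on $\mathcal H_+$, and $U_+$ is the unitary group of $\mathcal H_+$, with the charts $\psi_g(v)=(g^{-1}v-1)(g^{-1}v+1)^{-1}\in\mathfrak u_+$, $g\in U_+$, defined where $g^{-1}v+1$ is invertible. A *Banach Lie groupoid* is a groupoid whose total space and base are Hausdorff smooth Banach manifolds, whose source and target are surjective submersions (the tangent maps are surjective with split kernel), whose multiplication is smooth on the set of composable pairs, whose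 identity section is a topological embedding, and whose inversion is a diffeomorphism. **Proposition.** The sets $\mathrm{Gr}^p_{\rm res}$ and $\mathfrak U^p_{\rm res}$ carry structures of real smooth Banach manifolds such that: 1. for every $W\in\mathrm{Gr}^p_{\rm res}$, the space $L^p(W,W^\perp)$ is complete and $\phi_W$ is a smooth chart of $\mathrm{Gr}^p_{\rm res}$ with image all of $L^p(W,W^\perp)$; 2. every $W\in\mathrm{Gr}^p_{\rm res}$ lies in the domain of a smooth local cross section; 3. for all $W,W'\in\mathrm{Gr}^p_{\rm res}$, all smooth local cross sections $\sigma:\Omega\to U^p_{\rm res}$ and $\sigma':\Omega'\to U^p_{\rm res}$ with $\Omega$, $\Omega'$ contained in the domains of $\phi_W$, $\phi_{W'}$, and all $g\in U_+$, the map $$u\mapsto\bigl(\phi_W(uu^*),\ \phi_{W'}(u^*u),\ \psi_g(\sigma(uu^*)^{-1}\,u\,\sigma'(u^*u)|_{\mathcal H_+})\bigr)\in L^p(W,W^\perp)\times L^p(W',W'^\perp)\times\mathfrak u_+ ,$$ defined where $uu^*\in\Omega$, $u^*u\in\Omega'$ and the third component makes sense, is a smooth chart of $\mathfrak U^p_{\rm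 res}$; thus $\mathfrak U^p_{\rm res}$ is modelled on the Banach spaces $L^p(W,W^\perp)\times L^p(W',W'^\perp)\times\mathfrak u_+$; 4. with these structures $\mathfrak U^p_{\rm res}\rightrightarrows\mathrm{Gr}^p_{\rm res}$, with the maps $s,t,m,\varepsilon,\iota$ above, is a Banach Lie groupoid. -/

import Mathlib

open scoped Manifold ContDiff ENNReal

noncomputable section

/-! ### Schatten classes of operators between Hilbert spaces -/

section Schatten

variable {p : ℝ} {E F : Type*} [NormedAddCommGroup E] [InnerProductSpace ℂ E]
  [NormedAddCommGroup F] [InnerProductSpace ℂ F]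

/-- The norm of the operator ideal `L^p`, with values in `[0, ∞]`.  For `p = 0` (the ideal of compact
operators) it is the operator norm.  Otherwise it is the von Neumann-Schatten norm: the supremum of
`(∑ i, |⟨f i, T (e i)⟩| ^ p) ^ (1 / p)` over all finite orthonormal families `e` and `f` of the same
length.  (For `1 < p < ∞` this number is finite exactly when `T` is compact with `p`-summable
singular values, and it is then the `ℓ^p` norm of the sequence of singular values.) -/
def schattenENorm (p : ℝ) (T : E →L[ℂ] F) : ℝ≥0∞ :=
  if p = 0 then ‖T‖ₑ
  else ⨆ (n : ℕ) (e : {e : Fin n → E // Orthonormal ℂ e}) (f : {f : Fin n → F // Orthonormal ℂ f}),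
    (∑ i, ‖inner ℂ (f.1 i) (T (e.1 i))‖ₑ ^ p) ^ (1 / p)

/-- `T ∈ L^p`: for `p = 0` the operator is compact, otherwise its `p`-Schatten norm is finite. -/
def IsSchatten (p : ℝ) (T : E →L[ℂ] F) : Prop :=
  if p = 0 then IsCompactOperator T else schattenENorm p T ≠ ⊤

lemma schattenENorm_of_eq (hp : p = 0) (T : E →L[ℂ] F) : schattenENorm p T = ‖T‖ₑ := if_pos hp

lemma schattenENorm_add_le [hp : Fact (p = 0 ∨ 1 < p)] (S T : E →L[ℂ] F) :
    schattenENorm p (S + T) ≤ schattenENorm p S + schattenENorm p T := by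
  rcases hp.out with h | h
  · simp only [schattenENorm_of_eq h]
    exact enorm_add_le S T
  · have h0 : p ≠ 0 := by linarith
    simp only [schattenENorm, if_neg h0]
    refine iSup_le fun n => iSup_le fun e => iSup_le fun f => ?_
    refine le_trans ?_ (add_le_add (le_iSup_of_le n (le_iSup_of_le e (le_iSup_of_le f le_rfl)))
      (le_iSup_of_le n (le_iSup_of_le e (le_iSup_of_le f le_rfl))))
    refine le_trans ?_ (ENNReal.Lp_add_le Finset.univ _ _ h.le)
    refine ENNReal.rpow_le_rpow (Finset.sum_le_sum fun i _ => ?_) (by positivity)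
    refine ENNReal.rpow_le_rpow ?_ (by linarith)
    rw [add_apply, inner_add_right]
    exact enorm_add_le _ _

lemma schattenENorm_smul [hp : Fact (p = 0 ∨ 1 < p)] (c : ℂ) (T : E →L[ℂ] F) :
    schattenENorm p (c • T) = ‖c‖ₑ * schattenENorm p T := by
  rcases hp.out with h | h
  · simp only [schattenENorm_of_eq h]
    exact enorm_smul c T
  · have h0 : p ≠ 0 := by linarith
    have h1 : 0 ≤ p := by linarith
    simp only [schattenENorm, if_neg h0, ENNReal.mul_iSup]
    refine iSup_congr fun n => iSup_congr fun e => iSup_congr fun f => ?_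
    simp only [smul_apply, inner_smul_right, enorm_mul,
      ENNReal.mul_rpow_of_nonneg _ _ h1, ← Finset.mul_sum]
    rw [ENNReal.mul_rpow_of_nonneg _ _ (by positivity), ← ENNReal.rpow_mul,
      mul_one_div_cancel h0, ENNReal.rpow_one]

lemma eq_zero_of_schattenENorm [hp : Fact (p = 0 ∨ 1 < p)] {T : E →L[ℂ] F}
    (hT : schattenENorm p T = 0) : T = 0 := by
  rcases hp.out with h | h
  · rw [schattenENorm_of_eq h] at hT
    have h1 := congrArg ENNReal.toReal hT
    rw [toReal_enorm, ENNReal.toReal_zero] at h1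
    exact norm_eq_zero.1 h1
  · have h0 : p ≠ 0 := by linarith
    by_contra hne
    obtain ⟨x, hx⟩ : ∃ x, T x ≠ 0 := by
      by_contra! hall
      exact hne (ContinuousLinearMap.ext hall)
    have hx0 : x ≠ 0 := fun h => hx (by simp [h])
    have hxn : ‖x‖ ≠ 0 := norm_ne_zero_iff.2 hx0
    have hTn : ‖T x‖ ≠ 0 := norm_ne_zero_iff.2 hx
    let e : {e : Fin 1 → E // Orthonormal ℂ e} := ⟨fun _ => ((‖x‖⁻¹ : ℝ) : ℂ) • x, by
      refine ⟨fun i => ?_, fun i j hij => absurd (Subsingleton.elim i j) hij⟩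
      simp [norm_smul, hxn]⟩
    let f : {f : Fin 1 → F // Orthonormal ℂ f} := ⟨fun _ => ((‖T x‖⁻¹ : ℝ) : ℂ) • T x, by
      refine ⟨fun i => ?_, fun i j hij => absurd (Subsingleton.elim i j) hij⟩
      simp [norm_smul, hTn]⟩
    simp only [schattenENorm, if_neg h0, ENNReal.iSup_eq_zero] at hT
    have h1 := hT 1 e f
    rw [ENNReal.rpow_eq_zero_iff_of_pos (by positivity), Fin.sum_univ_one,
      ENNReal.rpow_eq_zero_iff_of_pos (by linarith)] at h1
    have h2 : inner ℂ (f.1 0) (T (e.1 0)) = 0 := by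
      have h3 := congrArg ENNReal.toReal h1
      rw [toReal_enorm, ENNReal.toReal_zero] at h3
      exact norm_eq_zero.1 h3
    simp [e, f, hx, hx0] at h2

lemma schattenENorm_ne_top [Fact (p = 0 ∨ 1 < p)] {T : E →L[ℂ] F} (hT : IsSchatten p T) :
    schattenENorm p T ≠ ⊤ := by
  by_cases h : p = 0
  · rw [schattenENorm_of_eq h]
    exact enorm_ne_top
  · simpa [IsSchatten, h] using hT

variable (p E F)

/-- `L^p(E, F)` as a subspace of the bounded operators. -/
def schattenSubmodule [hp : Fact (p = 0 ∨ 1 < p)] : Submodule ℂ (E →L[ℂ] F) where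
  carrier := {T | IsSchatten p T}
  add_mem' {S T} hS hT := by
    by_cases h : p = 0
    · simp only [IsSchatten, h, if_true, Set.mem_ofPred_eq] at hS hT ⊢
      exact hS.add hT
    · have h1 := schattenENorm_ne_top hS
      have h2 := schattenENorm_ne_top hT
      simp only [IsSchatten, h, if_false, Set.mem_ofPred_eq]
      exact ne_top_of_le_ne_top (ENNReal.add_ne_top.2 ⟨h1, h2⟩) (schattenENorm_add_le S T)
  zero_mem' := by
    by_cases h : p = 0
    · simp only [IsSchatten, h, if_true, Set.mem_ofPred_eq]
      exact isCompactOperator_zero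
    · simp only [IsSchatten, h, if_false, Set.mem_ofPred_eq]
      have := schattenENorm_smul (p := p) 0 (0 : E →L[ℂ] F)
      rw [zero_smul] at this
      rw [this]
      simp
  smul_mem' c T hT := by
    by_cases h : p = 0
    · simp only [IsSchatten, h, if_true, Set.mem_ofPred_eq] at hT ⊢
      exact hT.smul c
    · have h1 := schattenENorm_ne_top hT
      simp only [IsSchatten, h, if_false, Set.mem_ofPred_eq]
      rw [schattenENorm_smul]
      exact ENNReal.mul_ne_top enorm_ne_top h1

/-- The space `L^p(E, F)`, carrying its own norm (not the norm induced from the bounded operators,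
unless `p = 0`). -/
def SchattenClass [Fact (p = 0 ∨ 1 < p)] : Type _ := schattenSubmodule p E F

namespace SchattenClass

variable [Fact (p = 0 ∨ 1 < p)]

instance : AddCommGroup (SchattenClass p E F) := inferInstanceAs (AddCommGroup (schattenSubmodule p E F))

instance : Module ℂ (SchattenClass p E F) := inferInstanceAs (Module ℂ (schattenSubmodule p E F))

variable {p E F}

/-- The bounded operator underlying an element of `L^p(E, F)`. -/
def toCLM (T : SchattenClass p E F) : E →L[ℂ] F := T.1

instance : Norm (SchattenClass p E F) := ⟨fun T => (schattenENorm p T.toCLM).toReal⟩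

lemma norm_core : NormedSpace.Core ℂ (SchattenClass p E F) where
  norm_nonneg _ := ENNReal.toReal_nonneg
  norm_smul c T := by
    change (schattenENorm p (c • T.toCLM)).toReal = ‖c‖ * (schattenENorm p T.toCLM).toReal
    rw [schattenENorm_smul, ENNReal.toReal_mul, toReal_enorm]
  norm_triangle S T := by
    change (schattenENorm p (S.toCLM + T.toCLM)).toReal ≤
      (schattenENorm p S.toCLM).toReal + (schattenENorm p T.toCLM).toReal
    refine le_trans ?_
      (ENNReal.toReal_add (schattenENorm_ne_top S.2) (schattenENorm_ne_top T.2)).le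
    exact ENNReal.toReal_mono
      (ENNReal.add_ne_top.2 ⟨schattenENorm_ne_top S.2, schattenENorm_ne_top T.2⟩)
      (schattenENorm_add_le _ _)
  norm_eq_zero_iff T := by
    change (schattenENorm p T.toCLM).toReal = 0 ↔ T = 0
    constructor
    · intro h
      rcases (ENNReal.toReal_eq_zero_iff _).1 h with h | h
      · exact Subtype.ext (eq_zero_of_schattenENorm h)
      · exact absurd h (schattenENorm_ne_top T.2)
    · rintro rfl
      have := schattenENorm_smul (p := p) 0 (0 : E →L[ℂ] F)
      rw [zero_smul, enorm_zero, zero_mul] at this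
      change (schattenENorm p (0 : E →L[ℂ] F)).toReal = 0
      rw [this, ENNReal.toReal_zero]

instance : NormedAddCommGroup (SchattenClass p E F) := NormedAddCommGroup.ofCore norm_core

instance : NormedSpace ℂ (SchattenClass p E F) := NormedSpace.ofCore norm_core

end SchattenClass

end Schatten

/-! ### Banach Lie groupoids -/

section Groupoid

variable {EG EM : Type*} [NormedAddCommGroup EG] [NormedSpace ℝ EG]
  [NormedAddCommGroup EM] [NormedSpace ℝ EM]
  {G M : Type*} [TopologicalSpace G] [ChartedSpace EG G] [TopologicalSpace M] [ChartedSpace EM M]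

/-- A smooth map of Banach manifolds all of whose tangent maps are surjective with split kernel. -/
structure IsBanachSubmersion (f : G → M) : Prop where
  contMDiff : ContMDiff 𝓘(ℝ, EG) 𝓘(ℝ, EM) ∞ f
  surjective_mfderiv : ∀ x, Function.Surjective (mfderiv 𝓘(ℝ, EG) 𝓘(ℝ, EM) f x)
  split_ker : ∀ x, (mfderiv 𝓘(ℝ, EG) 𝓘(ℝ, EM) f x).ker.ClosedComplemented

variable (G M) in
open Classical in
/-- The maps `s`, `t`, `m`, `ε`, `ι` make the pair `(G, M)` a (Hausdorff, real, smooth) Banach Lie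
groupoid, where `m` is defined on the set of composable pairs.  Smoothness of `m` on this subset of
`G × G` is meant in the sense of `ContMDiffOn`, for which the values off the subset are irrelevant;
as the subset is a split submanifold (`s` and `t` are submersions), this is smoothness of `m` as a
map on that submanifold. -/
structure IsBanachLieGroupoid (s t : G → M) (m : {gh : G × G // s gh.1 = t gh.2} → G)
    (ε : M → G) (ι : G → G) : Prop where
  complete_total : CompleteSpace EG
  complete_base : CompleteSpace EM
  hausdorff_total : T2Space G
  hausdorff_base : T2Space M
  manifold_total : IsManifold 𝓘(ℝ, EG) ∞ G
  manifold_base : IsManifold 𝓘(ℝ, EM) ∞ M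
  source_surjective : Function.Surjective s
  source_submersion : IsBanachSubmersion (EG := EG) (EM := EM) s
  target_surjective : Function.Surjective t
  target_submersion : IsBanachSubmersion (EG := EG) (EM := EM) t
  smooth_mul : ContMDiffOn (𝓘(ℝ, EG).prod 𝓘(ℝ, EG)) 𝓘(ℝ, EG) ∞
    (fun gh : G × G => if h : s gh.1 = t gh.2 then m ⟨gh, h⟩ else gh.1)
    {gh : G × G | s gh.1 = t gh.2}
  source_mul : ∀ gh, s (m gh) = s gh.1.2
  target_mul : ∀ gh, t (m gh) = t gh.1.1
  assoc_defined : ∀ g h k : G,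
    (∃ h₁ : s g = t h, s (m ⟨(g, h), h₁⟩) = t k) ↔ (∃ h₂ : s h = t k, s g = t (m ⟨(h, k), h₂⟩))
  mul_assoc : ∀ (g h k : G) (h₁ : s g = t h) (h₂ : s h = t k) (h₃ : s (m ⟨(g, h), h₁⟩) = t k)
    (h₄ : s g = t (m ⟨(h, k), h₂⟩)),
    m ⟨(m ⟨(g, h), h₁⟩, k), h₃⟩ = m ⟨(g, m ⟨(h, k), h₂⟩), h₄⟩
  embedding_unit : Topology.IsEmbedding ε
  source_unit : ∀ x, s (ε x) = x
  target_unit : ∀ x, t (ε x) = x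
  mul_unit : ∀ (g : G) (h : s g = t (ε (s g))), m ⟨(g, ε (s g)), h⟩ = g
  unit_mul : ∀ (g : G) (h : s (ε (t g)) = t g), m ⟨(ε (t g), g), h⟩ = g
  diffeomorph_inv : ∃ d : Diffeomorph 𝓘(ℝ, EG) 𝓘(ℝ, EG) G G ∞, ⇑d = ι
  mul_inv : ∀ g, ∃ h : s g = t (ι g), m ⟨(g, ι g), h⟩ = ε (t g)
  inv_mul : ∀ g, ∃ h : s (ι g) = t g, m ⟨(ι g, g), h⟩ = ε (s g)

end Groupoid

/-! ### The restricted Grassmannian and the partial isometries over it -/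

section Restricted

variable {H : Type*} [NormedAddCommGroup H] [InnerProductSpace ℂ H] [CompleteSpace H]

/-- The orthogonal projector `P` belongs to the `p`-restricted Grassmannian of the polarization
`H = Hp ⊕ Hpᗮ`: for its image `W`, the orthogonal projection `W → Hp` is Fredholm, and the orthogonal
projection `W → Hpᗮ` is of class `L^p`. -/
structure IsRestrictedProjector (p : ℝ) (Hp : Submodule ℂ H) [CompleteSpace Hp]
    (P : H →L[ℂ] H) : Prop where
  isStarProjection : IsStarProjection P
  fredholm : (Hp.orthogonalProjectionOnto ∘L P.range.subtypeL).IsFredholm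
  schatten : IsSchatten p (Hpᗮ.orthogonalProjectionOnto ∘L P.range.subtypeL)

/-- The `p`-restricted Grassmannian; closed subspaces are identified with the orthogonal projectors
onto them. -/
@[ext]
structure RestrictedGrassmannian (p : ℝ) (Hp : Submodule ℂ H) [CompleteSpace Hp] where
  proj : H →L[ℂ] H
  isRestricted : IsRestrictedProjector p Hp proj

/-- A partial isometry of the Hilbert space `H`. -/
def IsPartialIsometry (u : H →L[ℂ] H) : Prop := IsStarProjection (star u * u)

/-- The set of partial isometries whose source `u* u` and target `u u*` belong to the
`p`-restricted Grassmannian. -/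
@[ext]
structure RestrictedPartialIsometry (p : ℝ) (Hp : Submodule ℂ H) [CompleteSpace Hp] where
  toCLM : H →L[ℂ] H
  isPartialIsometry : IsPartialIsometry toCLM
  source_mem : IsRestrictedProjector p Hp (star toCLM * toCLM)
  target_mem : IsRestrictedProjector p Hp (toCLM * star toCLM)

variable {p : ℝ} {Hp : Submodule ℂ H} [CompleteSpace Hp]

/-- The closed subspace corresponding to a point of the restricted Grassmannian. -/
def RestrictedGrassmannian.space (W : RestrictedGrassmannian p Hp) : Submodule ℂ H := W.proj.range

lemma RestrictedGrassmannian.proj_mem (W : RestrictedGrassmannian p Hp) (x : H) :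
    W.proj x ∈ W.space := ⟨x, rfl⟩

namespace RestrictedPartialIsometry

/-- `s u = u* u` -/
def source (u : RestrictedPartialIsometry p Hp) : RestrictedGrassmannian p Hp :=
  ⟨star u.toCLM * u.toCLM, u.source_mem⟩

/-- `t u = u u*` -/
def target (u : RestrictedPartialIsometry p Hp) : RestrictedGrassmannian p Hp :=
  ⟨u.toCLM * star u.toCLM, u.target_mem⟩

/-- `ε P = P` -/
def unit (P : RestrictedGrassmannian p Hp) : RestrictedPartialIsometry p Hp :=
  have h : star P.proj * P.proj = P.proj := by
    rw [P.isRestricted.isStarProjection.isSelfAdjoint.star_eq,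
      P.isRestricted.isStarProjection.isIdempotentElem.eq]
  have h' : P.proj * star P.proj = P.proj := by
    rw [P.isRestricted.isStarProjection.isSelfAdjoint.star_eq,
      P.isRestricted.isStarProjection.isIdempotentElem.eq]
  ⟨P.proj, by rw [IsPartialIsometry, h]; exact P.isRestricted.isStarProjection,
    h.symm ▸ P.isRestricted, h'.symm ▸ P.isRestricted⟩

/-- `ι u = u*` -/
def inv (u : RestrictedPartialIsometry p Hp) : RestrictedPartialIsometry p Hp :=
  ⟨star u.toCLM, by rw [IsPartialIsometry, star_star]; exact u.target_mem.isStarProjection,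
    by rw [star_star]; exact u.target_mem, by rw [star_star]; exact u.source_mem⟩

/-- `m (u, v) = u v`, defined when `u* u = v v*` -/
def mul (uv : {uv : RestrictedPartialIsometry p Hp × RestrictedPartialIsometry p Hp //
    source uv.1 = target uv.2}) : RestrictedPartialIsometry p Hp :=
  have h : star uv.1.1.toCLM * uv.1.1.toCLM = uv.1.2.toCLM * star uv.1.2.toCLM :=
    congrArg RestrictedGrassmannian.proj uv.2
  have hs : star (uv.1.1.toCLM * uv.1.2.toCLM) * (uv.1.1.toCLM * uv.1.2.toCLM) =
      star uv.1.2.toCLM * uv.1.2.toCLM := by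
    have := uv.1.2.source_mem.isStarProjection.isIdempotentElem.eq
    calc _ = star uv.1.2.toCLM * (star uv.1.1.toCLM * uv.1.1.toCLM) * uv.1.2.toCLM := by
          simp only [star_mul, mul_assoc]
      _ = star uv.1.2.toCLM * uv.1.2.toCLM * (star uv.1.2.toCLM * uv.1.2.toCLM) := by
          rw [h]; simp only [mul_assoc]
      _ = _ := this
  have ht : (uv.1.1.toCLM * uv.1.2.toCLM) * star (uv.1.1.toCLM * uv.1.2.toCLM) =
      uv.1.1.toCLM * star uv.1.1.toCLM := by
    have := uv.1.1.target_mem.isStarProjection.isIdempotentElem.eq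
    calc _ = uv.1.1.toCLM * (uv.1.2.toCLM * star uv.1.2.toCLM) * star uv.1.1.toCLM := by
          simp only [star_mul, mul_assoc]
      _ = uv.1.1.toCLM * star uv.1.1.toCLM * (uv.1.1.toCLM * star uv.1.1.toCLM) := by
          rw [← h]; simp only [mul_assoc]
      _ = _ := this
  ⟨uv.1.1.toCLM * uv.1.2.toCLM, by
    rw [IsPartialIsometry, hs]; exact uv.1.2.source_mem.isStarProjection,
    hs.symm ▸ uv.1.2.source_mem, ht.symm ▸ uv.1.1.target_mem⟩

end RestrictedPartialIsometry

/-! ### Charts -/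

/-- The Banach Lie algebra of skew-adjoint operators on `Hp` (over `ℝ`, with the operator norm). -/
def SkewAdjointOperators (Hp : Submodule ℂ H) [CompleteSpace Hp] : Type _ :=
  skewAdjoint (Hp →L[ℂ] Hp)

namespace SkewAdjointOperators

/-- The bounded operator underlying an element of the Lie algebra. -/
def toCLM (X : SkewAdjointOperators Hp) : Hp →L[ℂ] Hp := X.1

instance : NormedAddCommGroup (SkewAdjointOperators Hp) :=
  inferInstanceAs (NormedAddCommGroup (skewAdjoint (Hp →L[ℂ] Hp)))

instance : Module ℝ (SkewAdjointOperators Hp) :=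
  inferInstanceAs (Module ℝ (skewAdjoint (Hp →L[ℂ] Hp)))

instance : NormedSpace ℝ (SkewAdjointOperators Hp) where
  norm_smul_le r X := by
    refine ContinuousLinearMap.opNorm_le_bound _ (by positivity) fun x => ?_
    change ‖(r : ℂ) • X.toCLM x‖ ≤ _
    rw [norm_smul, Complex.norm_real, mul_assoc]
    exact mul_le_mul_of_nonneg_left (X.toCLM.le_opNorm x) (norm_nonneg r)

end SkewAdjointOperators

/-- The domain of the chart around `W`: the subspaces `V` with `V ⊕ Wᗮ = H`. -/
def grassmannianChartDomain (W : RestrictedGrassmannian p Hp) : Set (RestrictedGrassmannian p Hp) :=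
  {V | IsCompl V.space W.spaceᗮ}

/-- `A = φ_W(V) = P_{Wᗮ} (P_W |_V)⁻¹`, expressed as `A (P_W x) = P_{Wᗮ} x` for all `x ∈ V`; in other
words `V` is the graph of `A`. -/
def IsGrassmannianCoordinate [Fact (p = 0 ∨ 1 < p)] (W V : RestrictedGrassmannian p Hp)
    (A : SchattenClass p W.space W.spaceᗮ) : Prop :=
  ∀ x ∈ V.space, (A.toCLM ⟨W.proj x, W.proj_mem x⟩ : H) = x - W.proj x

/-- `σ` is a smooth local cross section, defined on the open set `Ω` of the restricted Grassmannian
and valued in the restricted unitary group `{u unitary | [u, P₊] ∈ L^p}`, with `V = σ(V) Hp`.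
Smoothness into this Banach Lie group, which is topologized by the norm of `u` together with the
`L^p` norm of `[u, P₊]`, is smoothness of `V ↦ σ V` and of `V ↦ [σ V, P₊]` into the respective
Banach spaces. -/
structure IsSmoothCrossSection [Fact (p = 0 ∨ 1 < p)] {E : Type*} [NormedAddCommGroup E]
    [NormedSpace ℝ E] [TopologicalSpace (RestrictedGrassmannian p Hp)]
    [ChartedSpace E (RestrictedGrassmannian p Hp)]
    (Ω : Set (RestrictedGrassmannian p Hp)) (σ : RestrictedGrassmannian p Hp → (H →L[ℂ] H)) :
    Prop where
  isOpen : IsOpen Ω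
  mem_unitary : ∀ V ∈ Ω, σ V ∈ unitary (H →L[ℂ] H)
  map_eq : ∀ V ∈ Ω, Hp.map (σ V : H →ₗ[ℂ] H) = V.space
  smooth : ContMDiffOn 𝓘(ℝ, E) 𝓘(ℝ, H →L[ℂ] H) ∞ σ Ω
  smooth_commutator : ∃ c : RestrictedGrassmannian p Hp → SchattenClass p H H,
    (∀ V ∈ Ω, (c V).toCLM = σ V * Hp.starProjection - Hp.starProjection * σ V) ∧
    ContMDiffOn 𝓘(ℝ, E) 𝓘(ℝ, SchattenClass p H H) ∞ c Ω

/-- The operator `σ(u u*)⁻¹ u σ'(u* u)` restricted to `Hp`. -/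
def transportToHp (σ σ' : RestrictedGrassmannian p Hp → (H →L[ℂ] H))
    (u : RestrictedPartialIsometry p Hp) : Hp →L[ℂ] Hp :=
  Hp.orthogonalProjectionOnto ∘L (star (σ u.target) * u.toCLM * σ' u.source) ∘L Hp.subtypeL

/-- The domain of the chart of the set of partial isometries built from two local cross sections and
from the Cayley chart of the unitary group of `Hp` centred at `g`, whose domain consists of the
unitary `v` with `g⁻¹ v + 1` invertible. -/
def groupoidChartDomain (Ω Ω' : Set (RestrictedGrassmannian p Hp))
    (σ σ' : RestrictedGrassmannian p Hp → (H →L[ℂ] H)) (g : unitary (Hp →L[ℂ] Hp)) :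
    Set (RestrictedPartialIsometry p Hp) :=
  {u | u.target ∈ Ω ∧ u.source ∈ Ω' ∧
    IsUnit (star (g : Hp →L[ℂ] Hp) * transportToHp σ σ' u + 1)}

/-- `Z` is the triple of coordinates of `u`: the coordinates of its target in the chart around `W`,
of its source in the chart around `W'`, and of the unitary operator
`v = σ(u u*)⁻¹ u σ'(u* u)|_{Hp}` in the Cayley chart `v ↦ (g⁻¹ v - 1) (g⁻¹ v + 1)⁻¹`. -/
def IsGroupoidCoordinate [Fact (p = 0 ∨ 1 < p)] (W W' : RestrictedGrassmannian p Hp)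
    (σ σ' : RestrictedGrassmannian p Hp → (H →L[ℂ] H)) (g : unitary (Hp →L[ℂ] Hp))
    (u : RestrictedPartialIsometry p Hp)
    (Z : SchattenClass p W.space W.spaceᗮ × SchattenClass p W'.space W'.spaceᗮ ×
      SkewAdjointOperators Hp) : Prop :=
  IsGrassmannianCoordinate W u.target Z.1 ∧
  IsGrassmannianCoordinate W' u.source Z.2.1 ∧
  Z.2.2.toCLM = (star (g : Hp →L[ℂ] Hp) * transportToHp σ σ' u - 1) *
    Ring.inverse (star (g : Hp →L[ℂ] Hp) * transportToHp σ σ' u + 1)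

/-- `φ` is a diffeomorphism from an open subset of the manifold `M` onto an open subset of the
normed space `E'`, that is, a smooth chart of `M` with values in `E'`. -/
def IsSmoothChart {E M E' : Type*} [NormedAddCommGroup E] [NormedSpace ℝ E] [TopologicalSpace M]
    [ChartedSpace E M] [NormedAddCommGroup E'] [NormedSpace ℝ E']
    (φ : OpenPartialHomeomorph M E') : Prop :=
  ContMDiffOn 𝓘(ℝ, E) 𝓘(ℝ, E') ∞ φ φ.source ∧ ContMDiffOn 𝓘(ℝ, E') 𝓘(ℝ, E) ∞ φ.symm φ.target

end Restricted

end

/-!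
Both manifold structures are induced from a simpler space: a projector `P_V` of the restricted
Grassmannian is determined by `P_V - P₊`, which lies in the Banach space `L^p(H)`, and a partial
isometry `u` by the triple `(u, uu*, u*u)`. A chart which is smooth in the ambient data, with an
inverse which is smooth into the ambient space, is automatically compatible with every other such
chart, so no transition map is ever computed.

For the Grassmannian, the graph of `A : W → Wᗮ` is the range of the idempotent `T = P_W + A`, whose
orthogonal projection is `T (T + T* - 1)⁻¹`; conversely `A` is recovered by inverting
`P_V P_W + (1 - P_V) (1 - P_W)`, which maps `W` to `V` and is invertible whenever `V` is a graph
over `W`. Its unitary polar part, composed with a fixed unitary mapping `H₊` onto `W`, is a smooth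
local cross section. Two cross sections transport `u` to a unitary operator on `H₊`, to which the
Cayley transform applies; since the whole construction is smooth in `(u, uu*, u*u)`, so are the
groupoid operations, and `V ↦ u σ(u*u) σ(V)*` is a local section of the source map through `u`.
-/

noncomputable section

/-! ### Bessel families and singular values -/

section Bessel

variable {𝕜 : Type*} [RCLike 𝕜] {E F : Type*} [NormedAddCommGroup E] [InnerProductSpace 𝕜 E]
  [NormedAddCommGroup F] [InnerProductSpace 𝕜 F] {ι κ : Type*} [Fintype ι] [Fintype κ]

variable (𝕜) in
/-- A finite family satisfying Bessel's inequality. Contractions map orthonormal families to such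
families, which is why the Schatten norms are estimated on them. -/
def IsBesselFamily (x : ι → E) : Prop := ∀ z, ∑ i, ‖inner 𝕜 (x i) z‖ ^ 2 ≤ ‖z‖ ^ 2

namespace IsBesselFamily

lemma of_orthonormal {x : ι → E} (hx : Orthonormal 𝕜 x) : IsBesselFamily 𝕜 x :=
  fun _ => hx.sum_inner_products_le _

lemma norm_sq_le_one {x : ι → E} (hx : IsBesselFamily 𝕜 x) (i : ι) : ‖x i‖ ^ 2 ≤ 1 := by
  have bessel : ‖inner 𝕜 (x i) (x i)‖ ^ 2 ≤ ‖x i‖ ^ 2 :=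
    (Finset.single_le_sum (fun j _ => sq_nonneg ‖inner 𝕜 (x j) (x i)‖) (Finset.mem_univ i)).trans
      (hx (x i))
  rw [inner_self_eq_norm_sq_to_K, norm_pow, RCLike.norm_ofReal, abs_norm] at bessel
  by_contra! h
  nlinarith

lemma map [CompleteSpace E] [CompleteSpace F] {x : ι → E} (hx : IsBesselFamily 𝕜 x)
    {R : E →L[𝕜] F} (hR : ‖R‖ ≤ 1) : IsBesselFamily 𝕜 fun i => R (x i) := fun z => by
  have hz : ‖ContinuousLinearMap.adjoint R z‖ ≤ ‖z‖ :=
    ContinuousLinearMap.le_of_opNorm_le_of_le _ (by rwa [LinearIsometryEquiv.norm_map]) le_rfl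
      |>.trans_eq (one_mul _)
  calc ∑ i, ‖inner 𝕜 (R (x i)) z‖ ^ 2
      = ∑ i, ‖inner 𝕜 (x i) (ContinuousLinearMap.adjoint R z)‖ ^ 2 := by
        simp only [ContinuousLinearMap.adjoint_inner_right]
    _ ≤ ‖ContinuousLinearMap.adjoint R z‖ ^ 2 := hx _
    _ ≤ ‖z‖ ^ 2 := by gcongr

end IsBesselFamily

lemma exists_orthonormalBasis_pairwise_inner_map_eq_zero [FiniteDimensional 𝕜 E] (T : E →ₗ[𝕜] F) :
    ∃ b : OrthonormalBasis (Fin (Module.finrank 𝕜 E)) 𝕜 E,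
      Pairwise fun k l => inner 𝕜 (T (b k)) (T (b l)) = 0 := by
  let T' : E →ₗ[𝕜] T.range := T.rangeRestrict
  have hsym : (LinearMap.adjoint T' ∘ₗ T').IsSymmetric :=
    T'.isPositive_adjoint_comp_self.isSymmetric
  refine ⟨hsym.eigenvectorBasis rfl, fun k l hkl => ?_⟩
  set b := hsym.eigenvectorBasis rfl
  calc inner 𝕜 (T (b k)) (T (b l)) = inner 𝕜 (T' (b k)) (T' (b l)) := rfl
    _ = inner 𝕜 (b k) ((LinearMap.adjoint T' ∘ₗ T') (b l)) :=
      (LinearMap.adjoint_inner_right T' _ _).symm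
    _ = 0 := by rw [hsym.apply_eigenvectorBasis, inner_smul_right, b.orthonormal.2 hkl, mul_zero]

lemma exists_singular_value_decomposition [FiniteDimensional 𝕜 E] (T : E →ₗ[𝕜] F) :
    ∃ (κ : Type) (_ : Fintype κ) (u : κ → E) (v : κ → F) (s : κ → ℝ), Orthonormal 𝕜 u ∧
      Orthonormal 𝕜 v ∧ (∀ k, 0 ≤ s k) ∧ (∀ k, T (u k) = (s k : 𝕜) • v k) ∧
      ∀ x, T x = ∑ k, ((s k : 𝕜) * inner 𝕜 (u k) x) • v k := by
  classical
  obtain ⟨b, hb⟩ := exists_orthonormalBasis_pairwise_inner_map_eq_zero T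
  let κ := {k // T (b k) ≠ 0}
  let s : κ → ℝ := fun k => ‖T (b k)‖
  let v : κ → F := fun k => (‖T (b k)‖⁻¹ : 𝕜) • T (b k)
  have hsv (k : κ) : T (b k) = (s k : 𝕜) • v k :=
    (smul_inv_smul₀ (RCLike.ofReal_ne_zero.2 (norm_ne_zero_iff.2 k.2)) _).symm
  refine ⟨κ, inferInstance, fun k => b k, v, s, b.orthonormal.comp _ Subtype.val_injective,
    ⟨fun k => norm_smul_inv_norm k.2, fun k l hkl => ?_⟩, fun k => norm_nonneg _, hsv, fun x => ?_⟩
  · simp only [v, inner_smul_left, inner_smul_right, hb (Subtype.coe_ne_coe.2 hkl), mul_zero]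
  · calc T x = ∑ k, inner 𝕜 (b k) x • T (b k) := by
          conv_lhs => rw [← b.sum_repr' x, map_sum]
          simp only [map_smul]
      _ = ∑ k : κ, inner 𝕜 (b k) x • T (b k) := by
          rw [← Finset.sum_filter_of_ne (p := fun k => T (b k) ≠ 0)
            fun k _ hk h => hk (by rw [h, smul_zero]),
            Finset.sum_subtype (p := fun k => T (b k) ≠ 0) _ (fun k => by simp)]
      _ = ∑ k : κ, ((s k : 𝕜) * inner 𝕜 (b k) x) • v k := by
          simp only [hsv, smul_smul, mul_comm]

lemma rpow_sum_mul_le_sum_mul_rpow {p : ℝ} (hp : 1 ≤ p) {w s : κ → ℝ} (hw : ∀ k, 0 ≤ w k)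
    (hw_sum : ∑ k, w k ≤ 1) (hs : ∀ k, 0 ≤ s k) :
    (∑ k, w k * s k) ^ p ≤ ∑ k, w k * s k ^ p := by
  have hS : 0 ≤ ∑ k, w k * s k ^ p :=
    Finset.sum_nonneg fun k _ => mul_nonneg (hw k) (Real.rpow_nonneg (hs k) p)
  rw [← Real.le_rpow_inv_iff_of_pos (Finset.sum_nonneg fun k _ => mul_nonneg (hw k) (hs k)) hS
    (zero_lt_one.trans_le hp)]
  calc ∑ k, w k * s k
      ≤ (∑ k, w k) ^ (1 - p⁻¹) * (∑ k, w k * s k ^ p) ^ p⁻¹ :=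
        Real.inner_le_weight_mul_Lp_of_nonneg Finset.univ hp w s hw hs
    _ ≤ (∑ k, w k * s k ^ p) ^ p⁻¹ :=
        mul_le_of_le_one_left (Real.rpow_nonneg hS _) <|
          Real.rpow_le_one (Finset.sum_nonneg fun k _ => hw k) hw_sum <|
            sub_nonneg.2 (inv_le_one_of_one_le₀ hp)

lemma sum_rpow_le_sum_rpow_of_le_sum_mul {p : ℝ} (hp : 1 ≤ p) {w : ι → κ → ℝ} {a : ι → ℝ}
    {s : κ → ℝ} (hw : ∀ i k, 0 ≤ w i k) (hw_row : ∀ i, ∑ k, w i k ≤ 1)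
    (hw_col : ∀ k, ∑ i, w i k ≤ 1) (ha : ∀ i, 0 ≤ a i) (hs : ∀ k, 0 ≤ s k)
    (has : ∀ i, a i ≤ ∑ k, w i k * s k) : ∑ i, a i ^ p ≤ ∑ k, s k ^ p :=
  calc ∑ i, a i ^ p ≤ ∑ i, ∑ k, w i k * s k ^ p := Finset.sum_le_sum fun i _ =>
        (Real.rpow_le_rpow (ha i) (has i) (by linarith)).trans
          (rpow_sum_mul_le_sum_mul_rpow hp (hw i) (hw_row i) hs)
    _ = ∑ k, (∑ i, w i k) * s k ^ p := by
        rw [Finset.sum_comm]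
        simp only [Finset.sum_mul]
    _ ≤ ∑ k, s k ^ p := Finset.sum_le_sum fun k _ =>
        mul_le_of_le_one_left (Real.rpow_nonneg (hs k) p) (hw_col k)

lemma IsBesselFamily.exists_orthonormal_sum_rpow_le {p : ℝ} (hp : 1 ≤ p) (T : E →ₗ[𝕜] F)
    {x : ι → E} {y : ι → F} (hx : IsBesselFamily 𝕜 x) (hy : IsBesselFamily 𝕜 y) :
    ∃ (κ : Type) (_ : Fintype κ) (u : κ → E) (v : κ → F), Orthonormal 𝕜 u ∧ Orthonormal 𝕜 v ∧
      ∑ i, ‖inner 𝕜 (y i) (T (x i))‖ ^ p ≤ ∑ k, ‖inner 𝕜 (v k) (T (u k))‖ ^ p := by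
  let X := Submodule.span 𝕜 (Set.range x)
  have : FiniteDimensional 𝕜 X := FiniteDimensional.span_of_finite 𝕜 (Set.finite_range x)
  obtain ⟨κ, _, u, v, s, hu, hv, hs, huv, hT⟩ :=
    exists_singular_value_decomposition (T ∘ₗ X.subtype)
  let x' (i : ι) : X := ⟨x i, Submodule.subset_span ⟨i, rfl⟩⟩
  refine ⟨κ, inferInstance, fun k => u k, v, hu.comp_linearIsometry X.subtypeₗᵢ, hv, ?_⟩
  have coeff_singular (k : κ) : ‖inner 𝕜 (v k) (T (u k))‖ = s k := by
    change ‖inner 𝕜 (v k) ((T ∘ₗ X.subtype) (u k))‖ = s k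
    rw [huv, inner_smul_right, inner_self_eq_norm_sq_to_K, hv.1 k]
    simp [abs_of_nonneg (hs k)]
  have coeff_le (i : ι) : ‖inner 𝕜 (y i) (T (x i))‖ ≤
      ∑ k, (‖inner 𝕜 (u k) (x' i)‖ ^ 2 + ‖inner 𝕜 (v k) (y i)‖ ^ 2) / 2 * s k := by
    change ‖inner 𝕜 (y i) ((T ∘ₗ X.subtype) (x' i))‖ ≤ _
    rw [hT, inner_sum]
    refine (norm_sum_le _ _).trans (Finset.sum_le_sum fun k _ => ?_)
    rw [inner_smul_right, norm_mul, norm_mul, RCLike.norm_of_nonneg (hs k), norm_inner_symm (y i)]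
    nlinarith [mul_nonneg (hs k) (sq_nonneg (‖inner 𝕜 (u k) (x' i)‖ - ‖inner 𝕜 (v k) (y i)‖))]
  simp only [coeff_singular]
  refine sum_rpow_le_sum_rpow_of_le_sum_mul hp (fun i k => by positivity) (fun i => ?_)
    (fun k => ?_) (fun i => norm_nonneg _) hs coeff_le
  · have row_u := (IsBesselFamily.of_orthonormal hu (x' i)).trans (hx.norm_sq_le_one i)
    have row_v := (IsBesselFamily.of_orthonormal hv (y i)).trans (hy.norm_sq_le_one i)
    rw [← Finset.sum_div, Finset.sum_add_distrib]
    linarith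
  · have col_u : ∑ i, ‖inner 𝕜 (u k) (x' i)‖ ^ 2 ≤ 1 := by
      simpa [norm_inner_symm _ (x _), x', show ‖(u k : E)‖ = 1 from hu.1 k] using hx (u k)
    have col_v : ∑ i, ‖inner 𝕜 (v k) (y i)‖ ^ 2 ≤ 1 := by
      simpa [norm_inner_symm _ (y _), hv.1 k] using hy (v k)
    rw [← Finset.sum_div, Finset.sum_add_distrib]
    linarith

end Bessel

/-! ### Approximation by operators of finite rank -/

section FiniteRank

variable {𝕜 : Type*} [RCLike 𝕜] {E F : Type*} [NormedAddCommGroup E] [InnerProductSpace 𝕜 E]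
  [NormedAddCommGroup F] [InnerProductSpace 𝕜 F]

lemma exists_finiteDimensional_range_norm_sub_le_of_isCompactOperator {T : E →L[𝕜] F}
    (hT : IsCompactOperator T) {ε : ℝ} (hε : 0 < ε) :
    ∃ K : E →L[𝕜] F, FiniteDimensional 𝕜 K.range ∧ ‖T - K‖ ≤ ε := by
  obtain ⟨C, hC, hCT⟩ := hT.image_closedBall_subset_compact 1
  obtain ⟨t, -, ht, htC⟩ := hC.finite_cover_balls hε
  let N := Submodule.span 𝕜 t
  have : FiniteDimensional 𝕜 N := FiniteDimensional.span_of_finite 𝕜 ht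
  refine ⟨N.starProjection ∘L T, ?_, ?_⟩
  · refine Submodule.finiteDimensional_of_le (S₂ := N) ?_
    rintro _ ⟨x, rfl⟩
    exact N.starProjection_apply_mem (T x)
  · refine ContinuousLinearMap.opNorm_le_of_unit_norm hε.le fun x hx => ?_
    obtain ⟨y, hy, hxy⟩ := Set.mem_iUnion₂.1 (htC (hCT ⟨x, by simp [hx], rfl⟩))
    calc ‖T x - N.starProjection (T x)‖ = ⨅ z : N, ‖T x - z‖ := Submodule.starProjection_minimal _
      _ ≤ ‖T x - y‖ :=
        ciInf_le ⟨0, by rintro _ ⟨z, rfl⟩; exact norm_nonneg _⟩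
          (⟨y, Submodule.subset_span hy⟩ : N)
      _ ≤ ε := (mem_ball_iff_norm.1 hxy).le

lemma finiteDimensional_range_sub_orthogonal_compression (T : E →L[𝕜] F) (M : Submodule 𝕜 E)
    (N : Submodule 𝕜 F) [FiniteDimensional 𝕜 M] [FiniteDimensional 𝕜 N] :
    FiniteDimensional 𝕜 (T - Nᗮ.starProjection ∘L T ∘L Mᗮ.starProjection).range := by
  refine Submodule.finiteDimensional_of_le (S₂ := N ⊔ M.map (T : E →ₗ[𝕜] F)) ?_
  rintro _ ⟨x, rfl⟩
  have decomp : (T - Nᗮ.starProjection ∘L T ∘L Mᗮ.starProjection) x =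
      N.starProjection (T (Mᗮ.starProjection x)) + T (M.starProjection x) := by
    simp only [sub_apply, ContinuousLinearMap.comp_apply, Submodule.starProjection_orthogonal_val,
      map_sub]
    abel
  rw [ContinuousLinearMap.coe_coe, decomp]
  exact Submodule.add_mem_sup (N.starProjection_apply_mem _) ⟨_, M.starProjection_apply_mem x, rfl⟩

lemma orthonormal_vecCons_of_mem_orthogonal {n : ℕ} {e : Fin n → E} (he : Orthonormal 𝕜 e) {x : E}
    (hx : ‖x‖ = 1) (hxe : x ∈ (Submodule.span 𝕜 (Set.range e))ᗮ) :
    Orthonormal 𝕜 (Matrix.vecCons x e) :=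
  orthonormal_vecCons_iff.2 ⟨hx, fun i => Submodule.inner_left_of_mem_orthogonal
    (Submodule.subset_span (Set.mem_range_self i)) hxe, he⟩

lemma exists_unit_vectors_of_lt_norm_compression (T : E →L[𝕜] F) (M : Submodule 𝕜 E)
    (N : Submodule 𝕜 F) [M.HasOrthogonalProjection] [N.HasOrthogonalProjection] {ε : ℝ}
    (hε : 0 ≤ ε) (hlt : ε < ‖N.starProjection ∘L T ∘L M.starProjection‖) :
    ∃ x ∈ M, ∃ y ∈ N, ‖x‖ = 1 ∧ ‖y‖ = 1 ∧ ε ≤ ‖inner 𝕜 y (T x)‖ := by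
  obtain ⟨z, hz⟩ : ∃ z, ε * ‖z‖ < ‖N.starProjection (T (M.starProjection z))‖ := by
    by_contra! h
    exact hlt.not_ge (ContinuousLinearMap.opNorm_le_bound _ hε h)
  set x := M.starProjection z
  set y := N.starProjection (T x)
  have hxz : ‖x‖ ≤ ‖z‖ := Submodule.norm_starProjection_apply_le _ z
  have hy : y ≠ 0 := norm_pos_iff.1 ((mul_nonneg hε (norm_nonneg z)).trans_lt hz)
  have hx : x ≠ 0 := fun h => hy (by simp only [y, h, map_zero])
  have inner_y : inner 𝕜 y (T x) = (‖y‖ : 𝕜) ^ 2 := by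
    rw [← inner_self_eq_norm_sq_to_K, ← Submodule.inner_starProjection_left_eq_right,
      Submodule.starProjection_eq_self_iff.2 (N.starProjection_apply_mem _)]
  refine ⟨(‖x‖⁻¹ : 𝕜) • x, M.smul_mem _ (M.starProjection_apply_mem z), (‖y‖⁻¹ : 𝕜) • y,
    N.smul_mem _ (N.starProjection_apply_mem _), norm_smul_inv_norm hx, norm_smul_inv_norm hy, ?_⟩
  calc ε ≤ ‖y‖ / ‖x‖ :=
        (le_div_iff₀ (norm_pos_iff.2 hx)).2 ((mul_le_mul_of_nonneg_left hxz hε).trans hz.le)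
    _ = ‖inner 𝕜 ((‖y‖⁻¹ : 𝕜) • y) (T ((‖x‖⁻¹ : 𝕜) • x))‖ := by
      simp only [map_smul, inner_smul_left, inner_smul_right, inner_y, map_inv₀, RCLike.conj_ofReal,
        norm_mul, norm_inv, RCLike.norm_ofReal, abs_norm, norm_pow]
      field_simp

/-- Take a maximal pair of orthonormal families with large matrix coefficients: as it cannot be
extended, `T` is small between the orthogonal complements of the spans. -/
lemma exists_finiteDimensional_range_norm_sub_le (T : E →L[𝕜] F) {ε : ℝ} (hε : 0 ≤ ε) {n : ℕ}
    (hn : ∀ (e : Fin n → E) (f : Fin n → F), Orthonormal 𝕜 e → Orthonormal 𝕜 f →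
      ∃ i, ‖inner 𝕜 (f i) (T (e i))‖ < ε) :
    ∃ K : E →L[𝕜] F, FiniteDimensional 𝕜 K.range ∧ ‖T - K‖ ≤ ε := by
  let HasPair (m : ℕ) : Prop := ∃ (e : Fin m → E) (f : Fin m → F), Orthonormal 𝕜 e ∧
    Orthonormal 𝕜 f ∧ ∀ i, ε ≤ ‖inner 𝕜 (f i) (T (e i))‖
  have hasPair_zero : HasPair 0 :=
    ⟨Fin.elim0, Fin.elim0, ⟨fun i => i.elim0, fun i => i.elim0⟩,
      ⟨fun i => i.elim0, fun i => i.elim0⟩, fun i => i.elim0⟩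
  obtain ⟨m, ⟨e, f, he, hf, hef⟩, hmax⟩ : ∃ m, HasPair m ∧ ¬ HasPair (m + 1) := by
    by_contra! hstep
    obtain ⟨e, f, he, hf, hef⟩ : HasPair n := Nat.rec hasPair_zero hstep n
    obtain ⟨i, hi⟩ := hn e f he hf
    exact hi.not_ge (hef i)
  let M := Submodule.span 𝕜 (Set.range e)
  let N := Submodule.span 𝕜 (Set.range f)
  have : FiniteDimensional 𝕜 M := FiniteDimensional.span_of_finite 𝕜 (Set.finite_range e)
  have : FiniteDimensional 𝕜 N := FiniteDimensional.span_of_finite 𝕜 (Set.finite_range f)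
  refine ⟨_, finiteDimensional_range_sub_orthogonal_compression T M N, ?_⟩
  rw [sub_sub_cancel]
  by_contra! hlt
  obtain ⟨x, hxM, y, hyN, hx, hy, hxy⟩ := exists_unit_vectors_of_lt_norm_compression T Mᗮ Nᗮ hε hlt
  exact hmax ⟨Matrix.vecCons x e, Matrix.vecCons y f,
    orthonormal_vecCons_of_mem_orthogonal he hx hxM,
    orthonormal_vecCons_of_mem_orthogonal hf hy hyN, Fin.cases hxy hef⟩

lemma finiteDimensional_range_adjoint [CompleteSpace E] [CompleteSpace F] (T : E →L[𝕜] F)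
    [FiniteDimensional 𝕜 T.range] : FiniteDimensional 𝕜 (ContinuousLinearMap.adjoint T).range := by
  have : CompleteSpace T.range := FiniteDimensional.complete 𝕜 _
  let r : E →L[𝕜] T.range := T.codRestrict T.range fun x => ⟨x, rfl⟩
  have factor : ContinuousLinearMap.adjoint T =
      ContinuousLinearMap.adjoint r ∘L ContinuousLinearMap.adjoint T.range.subtypeL := by
    rw [← ContinuousLinearMap.adjoint_comp]
    rfl
  rw [factor]
  exact Submodule.finiteDimensional_of_le (LinearMap.range_comp_le_range _ _)

end FiniteRank

/-! ### Operator ideal properties of the Schatten classes -/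

section SchattenIdeal

variable {p : ℝ} {D E F G : Type*} [NormedAddCommGroup D] [InnerProductSpace ℂ D]
  [NormedAddCommGroup E] [InnerProductSpace ℂ E]
  [NormedAddCommGroup F] [InnerProductSpace ℂ F] [NormedAddCommGroup G] [InnerProductSpace ℂ G]

lemma schattenENorm_of_ne (hp : p ≠ 0) (T : E →L[ℂ] F) :
    schattenENorm p T = ⨆ (n : ℕ) (e : {e : Fin n → E // Orthonormal ℂ e})
      (f : {f : Fin n → F // Orthonormal ℂ f}),
      (∑ i, ‖inner ℂ (f.1 i) (T (e.1 i))‖ₑ ^ p) ^ (1 / p) := if_neg hp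

lemma isSchatten_iff_of_eq (hp : p = 0) {T : E →L[ℂ] F} :
    IsSchatten p T ↔ IsCompactOperator T := iff_of_eq (if_pos hp)

lemma isSchatten_iff_of_ne (hp : p ≠ 0) {T : E →L[ℂ] F} :
    IsSchatten p T ↔ schattenENorm p T ≠ ⊤ := iff_of_eq (if_neg hp)

section Add

variable [Fact (p = 0 ∨ 1 < p)] {S T : E →L[ℂ] F}

lemma IsSchatten.add (hS : IsSchatten p S) (hT : IsSchatten p T) : IsSchatten p (S + T) :=
  (schattenSubmodule p E F).add_mem hS hT

lemma IsSchatten.neg (hT : IsSchatten p T) : IsSchatten p (-T) :=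
  (schattenSubmodule p E F).neg_mem hT

lemma IsSchatten.sub (hS : IsSchatten p S) (hT : IsSchatten p T) : IsSchatten p (S - T) :=
  (schattenSubmodule p E F).sub_mem hS hT

end Add

lemma sum_enorm_inner_le_schattenENorm (hp : p ≠ 0) (T : E →L[ℂ] F) {κ : Type*} [Fintype κ]
    {e : κ → E} {f : κ → F} (he : Orthonormal ℂ e) (hf : Orthonormal ℂ f) :
    (∑ k, ‖inner ℂ (f k) (T (e k))‖ₑ ^ p) ^ (1 / p) ≤ schattenENorm p T := by
  rw [schattenENorm_of_ne hp, ← (Fintype.equivFin κ).symm.sum_comp]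
  exact le_iSup_of_le (Fintype.card κ) <|
    le_iSup_of_le ⟨e ∘ (Fintype.equivFin κ).symm, he.comp _ (Equiv.injective _)⟩ <|
      le_iSup_of_le ⟨f ∘ (Fintype.equivFin κ).symm, hf.comp _ (Equiv.injective _)⟩ le_rfl

lemma sum_enorm_rpow_eq_ofReal (hp : 0 ≤ p) {ι : Type*} [Fintype ι] (z : ι → ℂ) :
    ∑ i, ‖z i‖ₑ ^ p = ENNReal.ofReal (∑ i, ‖z i‖ ^ p) := by
  rw [ENNReal.ofReal_sum_of_nonneg fun i _ => Real.rpow_nonneg (norm_nonneg _) p]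
  exact Finset.sum_congr rfl fun i _ => by
    rw [← ofReal_norm, ENNReal.ofReal_rpow_of_nonneg (norm_nonneg _) hp]

lemma IsBesselFamily.sum_enorm_inner_le_schattenENorm (hp : 1 ≤ p) (T : E →L[ℂ] F) {ι : Type*}
    [Fintype ι] {x : ι → E} {y : ι → F} (hx : IsBesselFamily ℂ x) (hy : IsBesselFamily ℂ y) :
    (∑ i, ‖inner ℂ (y i) (T (x i))‖ₑ ^ p) ^ (1 / p) ≤ schattenENorm p T := by
  have hp_pos : 0 < p := by linarith
  obtain ⟨κ, _, u, v, hu, hv, huv⟩ :=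
    hx.exists_orthonormal_sum_rpow_le hp (T : E →ₗ[ℂ] F) hy
  refine le_trans ?_ (_root_.sum_enorm_inner_le_schattenENorm hp_pos.ne' T hu hv)
  rw [sum_enorm_rpow_eq_ofReal hp_pos.le, sum_enorm_rpow_eq_ofReal hp_pos.le]
  gcongr
  exact huv

lemma schattenENorm_comp_le_of_norm_le_one [hp : Fact (p = 0 ∨ 1 < p)] [CompleteSpace D]
    [CompleteSpace E] [CompleteSpace F] [CompleteSpace G] {S : F →L[ℂ] G} (T : E →L[ℂ] F)
    {R : D →L[ℂ] E} (hS : ‖S‖ ≤ 1) (hR : ‖R‖ ≤ 1) :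
    schattenENorm p (S ∘L T ∘L R) ≤ schattenENorm p T := by
  rcases hp.out with h | h
  · simp only [schattenENorm_of_eq h]
    rw [enorm_le_iff_norm_le]
    calc ‖S ∘L T ∘L R‖ ≤ ‖S‖ * (‖T‖ * ‖R‖) :=
          (S.opNorm_comp_le _).trans (by gcongr; exact T.opNorm_comp_le R)
      _ ≤ 1 * (‖T‖ * 1) := by gcongr
      _ = ‖T‖ := by ring
  · rw [schattenENorm_of_ne (by linarith)]
    refine iSup_le fun n => iSup_le fun e => iSup_le fun f => ?_
    have hS' : ‖ContinuousLinearMap.adjoint S‖ ≤ 1 := by rwa [LinearIsometryEquiv.norm_map]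
    simpa only [ContinuousLinearMap.adjoint_inner_left, ContinuousLinearMap.comp_apply] using
      ((IsBesselFamily.of_orthonormal e.2).map hR).sum_enorm_inner_le_schattenENorm h.le T
        ((IsBesselFamily.of_orthonormal f.2).map hS')

lemma exists_norm_le_one_eq_smul (A : E →L[ℂ] F) :
    ∃ A' : E →L[ℂ] F, ‖A'‖ ≤ 1 ∧ A = (‖A‖ : ℂ) • A' := by
  rcases eq_or_ne A 0 with rfl | hA
  · exact ⟨0, by simp, by simp⟩
  · exact ⟨(‖A‖⁻¹ : ℂ) • A, (norm_smul_inv_norm hA).le,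
      (smul_inv_smul₀ (Complex.ofReal_ne_zero.2 (norm_ne_zero_iff.2 hA)) A).symm⟩

lemma schattenENorm_comp_le [Fact (p = 0 ∨ 1 < p)] [CompleteSpace D]
    [CompleteSpace E] [CompleteSpace F] [CompleteSpace G] (S : F →L[ℂ] G) (T : E →L[ℂ] F)
    (R : D →L[ℂ] E) :
    schattenENorm p (S ∘L T ∘L R) ≤ ‖S‖ₑ * schattenENorm p T * ‖R‖ₑ := by
  obtain ⟨S', hS', hS⟩ := exists_norm_le_one_eq_smul S
  obtain ⟨R', hR', hR⟩ := exists_norm_le_one_eq_smul R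
  have enorm_coe_norm (r : ℝ) (hr : 0 ≤ r) : ‖(r : ℂ)‖ₑ = ENNReal.ofReal r := by
    rw [← ofReal_norm, Complex.norm_real, Real.norm_of_nonneg hr]
  calc schattenENorm p (S ∘L T ∘L R)
      = schattenENorm p (((‖S‖ : ℂ) * (‖R‖ : ℂ)) • (S' ∘L T ∘L R')) := by
        conv_lhs => rw [hS, hR]
        simp only [ContinuousLinearMap.smul_comp, ContinuousLinearMap.comp_smul, smul_smul,
          mul_comm]
    _ = ‖S‖ₑ * schattenENorm p (S' ∘L T ∘L R') * ‖R‖ₑ := by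
        rw [schattenENorm_smul, enorm_mul, enorm_coe_norm _ (norm_nonneg S),
          enorm_coe_norm _ (norm_nonneg R), ofReal_norm, ofReal_norm, mul_right_comm]
    _ ≤ ‖S‖ₑ * schattenENorm p T * ‖R‖ₑ := by
        gcongr
        exact schattenENorm_comp_le_of_norm_le_one T hS' hR'

lemma IsSchatten.comp [Fact (p = 0 ∨ 1 < p)] [CompleteSpace D]
    [CompleteSpace E] [CompleteSpace F] [CompleteSpace G] {T : E →L[ℂ] F} (hT : IsSchatten p T)
    (S : F →L[ℂ] G) (R : D →L[ℂ] E) : IsSchatten p (S ∘L T ∘L R) := by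
  by_cases h : p = 0
  · rw [isSchatten_iff_of_eq h] at hT ⊢
    exact (hT.comp_clm R).clm_comp S
  · rw [isSchatten_iff_of_ne h] at hT ⊢
    exact ne_top_of_le_ne_top (ENNReal.mul_ne_top (ENNReal.mul_ne_top enorm_ne_top hT) enorm_ne_top)
      (schattenENorm_comp_le S T R)

omit [InnerProductSpace ℂ E] in
lemma orthonormal_const_of_norm_eq_one {𝕜 ι : Type*} [RCLike 𝕜] [InnerProductSpace 𝕜 E]
    [Subsingleton ι] {v : E} (hv : ‖v‖ = 1) : Orthonormal 𝕜 fun _ : ι => v :=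
  ⟨fun _ => hv, fun i j hij => absurd (Subsingleton.elim i j) hij⟩

lemma enorm_inner_le_schattenENorm (hp : p ≠ 0) (T : E →L[ℂ] F) {e : E} {f : F} (he : ‖e‖ = 1)
    (hf : ‖f‖ = 1) : ‖inner ℂ f (T e)‖ₑ ≤ schattenENorm p T := by
  simpa [← ENNReal.rpow_mul, hp] using
    sum_enorm_inner_le_schattenENorm hp T (orthonormal_const_of_norm_eq_one (ι := Fin 1) he)
      (orthonormal_const_of_norm_eq_one hf)

lemma enorm_le_schattenENorm (T : E →L[ℂ] F) : ‖T‖ₑ ≤ schattenENorm p T := by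
  by_cases hp : p = 0
  · rw [schattenENorm_of_eq hp]
  rcases eq_or_ne (schattenENorm p T) ⊤ with htop | htop
  · rw [htop]
    exact le_top
  rw [← ofReal_norm]
  refine ENNReal.ofReal_le_of_le_toReal ?_
  refine ContinuousLinearMap.opNorm_le_of_unit_norm ENNReal.toReal_nonneg fun x hx => ?_
  rcases eq_or_ne (T x) 0 with hTx | hTx
  · rw [hTx, norm_zero]
    exact ENNReal.toReal_nonneg
  calc ‖T x‖ = ‖inner ℂ ((‖T x‖⁻¹ : ℂ) • T x) (T x)‖ := by
        rw [inner_smul_left, inner_self_eq_norm_sq_to_K]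
        simp [sq, hTx]
    _ ≤ (schattenENorm p T).toReal := by
        rw [← toReal_enorm]
        exact ENNReal.toReal_mono htop
          (enorm_inner_le_schattenENorm hp T hx (norm_smul_inv_norm hTx))

lemma schattenENorm_adjoint_le [CompleteSpace E] [CompleteSpace F] (T : E →L[ℂ] F) :
    schattenENorm p (ContinuousLinearMap.adjoint T) ≤ schattenENorm p T := by
  by_cases hp : p = 0
  · simp only [schattenENorm_of_eq hp]
    rw [enorm_le_iff_norm_le, LinearIsometryEquiv.norm_map]
  · rw [schattenENorm_of_ne hp]
    refine iSup_le fun n => iSup_le fun e => iSup_le fun f => ?_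
    refine le_trans (le_of_eq ?_) (sum_enorm_inner_le_schattenENorm hp T f.2 e.2)
    congr 1
    refine Finset.sum_congr rfl fun i _ => ?_
    rw [ContinuousLinearMap.adjoint_inner_right, ← ofReal_norm, norm_inner_symm, ofReal_norm]

lemma schattenENorm_adjoint [CompleteSpace E] [CompleteSpace F] (T : E →L[ℂ] F) :
    schattenENorm p (ContinuousLinearMap.adjoint T) = schattenENorm p T := by
  refine (schattenENorm_adjoint_le T).antisymm ?_
  simpa only [ContinuousLinearMap.adjoint_adjoint] using
    schattenENorm_adjoint_le (p := p) (ContinuousLinearMap.adjoint T)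

lemma isSchatten_of_finiteDimensional [hp : Fact (p = 0 ∨ 1 < p)] [FiniteDimensional ℂ E]
    (T : E →L[ℂ] F) : IsSchatten p T := by
  rcases hp.out with h | h
  · rw [isSchatten_iff_of_eq h]
    have : ProperSpace E := FiniteDimensional.proper ℂ E
    exact isCompactOperator_of_locallyCompactSpace_rng T
  · have hp_pos : 0 < p := by linarith
    rw [isSchatten_iff_of_ne hp_pos.ne', schattenENorm_of_ne hp_pos.ne']
    refine ne_top_of_le_ne_top (b := (Module.finrank ℂ E * ‖T‖ₑ ^ p) ^ (1 / p))
      (ENNReal.rpow_ne_top_of_nonneg (by positivity) (ENNReal.mul_ne_top (ENNReal.natCast_ne_top _)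
        (ENNReal.rpow_ne_top_of_nonneg hp_pos.le enorm_ne_top)))
      (iSup_le fun n => iSup_le fun e => iSup_le fun f => ?_)
    have coeff_le (i : Fin n) : ‖inner ℂ (f.1 i) (T (e.1 i))‖ₑ ≤ ‖T‖ₑ := by
      rw [enorm_le_iff_norm_le]
      calc ‖inner ℂ (f.1 i) (T (e.1 i))‖ ≤ ‖f.1 i‖ * (‖T‖ * ‖e.1 i‖) :=
            (norm_inner_le_norm _ _).trans (by gcongr; exact T.le_opNorm _)
        _ = ‖T‖ := by rw [f.2.1 i, e.2.1 i, one_mul, mul_one]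
    gcongr
    calc ∑ i, ‖inner ℂ (f.1 i) (T (e.1 i))‖ₑ ^ p ≤ ∑ _i : Fin n, ‖T‖ₑ ^ p :=
          Finset.sum_le_sum fun i _ => ENNReal.rpow_le_rpow (coeff_le i) hp_pos.le
      _ = Fintype.card (Fin n) * ‖T‖ₑ ^ p := by
          rw [Finset.sum_const, Finset.card_univ, nsmul_eq_mul]
      _ ≤ Module.finrank ℂ E * ‖T‖ₑ ^ p := by
          gcongr
          exact e.2.linearIndependent.fintype_card_le_finrank

lemma isSchatten_of_finiteDimensional_range [Fact (p = 0 ∨ 1 < p)] [CompleteSpace E]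
    [CompleteSpace F] (T : E →L[ℂ] F) [FiniteDimensional ℂ T.range] : IsSchatten p T :=
  have : CompleteSpace T.range := FiniteDimensional.complete ℂ _
  (isSchatten_of_finiteDimensional T.range.subtypeL).comp
    (ContinuousLinearMap.id ℂ F) (T.codRestrict T.range fun x => ⟨x, rfl⟩)

lemma card_mul_rpow_le_schattenENorm_rpow (hp : 0 < p) (T : E →L[ℂ] F) {κ : Type*} [Fintype κ]
    {e : κ → E} {f : κ → F} (he : Orthonormal ℂ e) (hf : Orthonormal ℂ f) {ε : ℝ}
    (h : ∀ k, ε ≤ ‖inner ℂ (f k) (T (e k))‖) :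
    Fintype.card κ * ENNReal.ofReal ε ^ p ≤ schattenENorm p T ^ p :=
  calc Fintype.card κ * ENNReal.ofReal ε ^ p = ∑ _k : κ, ENNReal.ofReal ε ^ p := by simp
    _ ≤ ∑ k, ‖inner ℂ (f k) (T (e k))‖ₑ ^ p := Finset.sum_le_sum fun k _ =>
        ENNReal.rpow_le_rpow (by rw [← ofReal_norm]; exact ENNReal.ofReal_le_ofReal (h k)) hp.le
    _ ≤ schattenENorm p T ^ p := by
        rw [← ENNReal.rpow_inv_le_iff hp, ← one_div]
        exact sum_enorm_inner_le_schattenENorm hp.ne' T he hf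

lemma IsSchatten.exists_finiteDimensional_range_norm_sub_le [hp : Fact (p = 0 ∨ 1 < p)]
    {T : E →L[ℂ] F} (hT : IsSchatten p T) {ε : ℝ} (hε : 0 < ε) :
    ∃ K : E →L[ℂ] F, FiniteDimensional ℂ K.range ∧ ‖T - K‖ ≤ ε := by
  rcases hp.out with h | h
  · exact exists_finiteDimensional_range_norm_sub_le_of_isCompactOperator
      ((isSchatten_iff_of_eq h).1 hT) hε
  · have hp_pos : 0 < p := by linarith
    have hεp : ENNReal.ofReal ε ^ p ≠ 0 := by simp [hε]
    obtain ⟨n, hn⟩ := ENNReal.exists_nat_mul_gt hεp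
      (ENNReal.rpow_ne_top_of_nonneg hp_pos.le (schattenENorm_ne_top hT))
    refine _root_.exists_finiteDimensional_range_norm_sub_le T hε.le (n := n)
      fun e f he hf => ?_
    by_contra! hef
    refine hn.not_ge ?_
    simpa using card_mul_rpow_le_schattenENorm_rpow hp_pos T he hf hef

lemma IsSchatten.adjoint [Fact (p = 0 ∨ 1 < p)] [CompleteSpace E] [CompleteSpace F]
    {T : E →L[ℂ] F} (hT : IsSchatten p T) : IsSchatten p (ContinuousLinearMap.adjoint T) := by
  by_cases h : p = 0
  · have mem_closure : ContinuousLinearMap.adjoint T ∈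
        closure {S : F →L[ℂ] E | IsCompactOperator S} := by
      refine Metric.mem_closure_iff.2 fun ε hε => ?_
      obtain ⟨K, hK, hTK⟩ := hT.exists_finiteDimensional_range_norm_sub_le (half_pos hε)
      have := finiteDimensional_range_adjoint K
      refine ⟨ContinuousLinearMap.adjoint K,
        (isSchatten_iff_of_eq h).1 (isSchatten_of_finiteDimensional_range _), ?_⟩
      rw [dist_eq_norm, ← map_sub, LinearIsometryEquiv.norm_map]
      linarith
    rw [isClosed_setOfPred_isCompactOperator.closure_eq] at mem_closure
    exact (isSchatten_iff_of_eq h).2 mem_closure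
  · rw [isSchatten_iff_of_ne h] at hT ⊢
    rwa [schattenENorm_adjoint]

lemma lowerSemicontinuous_schattenENorm :
    LowerSemicontinuous (fun T : E →L[ℂ] F => schattenENorm p T) := by
  by_cases h : p = 0
  · simp only [schattenENorm_of_eq h]
    exact continuous_enorm.lowerSemicontinuous
  · simp only [schattenENorm_of_ne h]
    refine lowerSemicontinuous_iSup fun n => lowerSemicontinuous_iSup fun e =>
      lowerSemicontinuous_iSup fun f => Continuous.lowerSemicontinuous ?_
    fun_prop

end SchattenIdeal

namespace SchattenClass

variable {p : ℝ} [Fact (p = 0 ∨ 1 < p)] {D E F G : Type*}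
  [NormedAddCommGroup D] [InnerProductSpace ℂ D] [NormedAddCommGroup E] [InnerProductSpace ℂ E]
  [NormedAddCommGroup F] [InnerProductSpace ℂ F] [NormedAddCommGroup G] [InnerProductSpace ℂ G]

/-- An operator of class `L^p` as an element of `L^p(E, F)`. -/
def mk (T : E →L[ℂ] F) (hT : IsSchatten p T) : SchattenClass p E F := ⟨T, hT⟩

@[simp] lemma toCLM_mk (T : E →L[ℂ] F) (hT : IsSchatten p T) : (mk T hT).toCLM = T := rfl

lemma isSchatten (T : SchattenClass p E F) : IsSchatten p T.toCLM := T.2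

lemma toCLM_injective : Function.Injective (toCLM : SchattenClass p E F → E →L[ℂ] F) :=
  Subtype.val_injective

@[simp] lemma toCLM_add (S T : SchattenClass p E F) : (S + T).toCLM = S.toCLM + T.toCLM := rfl

@[simp] lemma toCLM_sub (S T : SchattenClass p E F) : (S - T).toCLM = S.toCLM - T.toCLM := rfl

@[simp] lemma toCLM_smul (c : ℂ) (T : SchattenClass p E F) : (c • T).toCLM = c • T.toCLM := rfl

lemma norm_def (T : SchattenClass p E F) : ‖T‖ = (schattenENorm p T.toCLM).toReal := rfl

lemma ofReal_norm (T : SchattenClass p E F) :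
    ENNReal.ofReal ‖T‖ = schattenENorm p T.toCLM :=
  ENNReal.ofReal_toReal (schattenENorm_ne_top T.isSchatten)

lemma norm_toCLM_le (T : SchattenClass p E F) : ‖T.toCLM‖ ≤ ‖T‖ := by
  rw [← ENNReal.ofReal_le_ofReal_iff (norm_nonneg _), T.ofReal_norm, _root_.ofReal_norm]
  exact enorm_le_schattenENorm T.toCLM

variable (p E F) in
/-- The inclusion of `L^p` into the bounded operators. -/
def toCLML : SchattenClass p E F →L[ℂ] (E →L[ℂ] F) :=
  LinearMap.mkContinuous ⟨⟨toCLM, toCLM_add⟩, toCLM_smul⟩ 1 fun T => by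
    rw [one_mul]; exact T.norm_toCLM_le

lemma exists_forall_schattenENorm_sub_le {u : ℕ → SchattenClass p E F} (hu : CauchySeq u)
    {T : E →L[ℂ] F} (hT : Filter.Tendsto (fun n => (u n).toCLM) Filter.atTop (nhds T)) {ε : ℝ}
    (hε : 0 < ε) : ∃ N, ∀ n ≥ N, schattenENorm p ((u n).toCLM - T) ≤ ENNReal.ofReal ε := by
  obtain ⟨N, hN⟩ := Metric.cauchySeq_iff.1 hu ε hε
  refine ⟨N, fun n hn => ?_⟩
  have isClosed_le : IsClosed {S : E →L[ℂ] F | schattenENorm p S ≤ ENNReal.ofReal ε} :=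
    lowerSemicontinuous_schattenENorm.isClosed_preimage _
  refine isClosed_le.mem_of_tendsto (tendsto_const_nhds.sub hT)
    (Filter.eventually_atTop.2 ⟨N, fun m hm => ?_⟩)
  calc schattenENorm p ((u n).toCLM - (u m).toCLM) = ENNReal.ofReal ‖u n - u m‖ :=
        (ofReal_norm (u n - u m)).symm
    _ ≤ ENNReal.ofReal ε := ENNReal.ofReal_le_ofReal (by
        rw [← dist_eq_norm]; exact (hN n hn m hm).le)

lemma isSchatten_of_tendsto {u : ℕ → SchattenClass p E F} (hu : CauchySeq u) [CompleteSpace F]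
    {T : E →L[ℂ] F} (hT : Filter.Tendsto (fun n => (u n).toCLM) Filter.atTop (nhds T)) :
    IsSchatten p T := by
  by_cases h : p = 0
  · refine (isSchatten_iff_of_eq h).2 (isClosed_setOfPred_isCompactOperator.mem_of_tendsto hT
      (Filter.Eventually.of_forall fun n => (isSchatten_iff_of_eq h).1 (u n).isSchatten))
  · obtain ⟨N, hN⟩ := exists_forall_schattenENorm_sub_le hu hT one_pos
    have isSchatten_sub : IsSchatten p ((u N).toCLM - T) :=
      (isSchatten_iff_of_ne h).2 (ne_top_of_le_ne_top ENNReal.ofReal_ne_top (hN N le_rfl))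
    simpa only [sub_sub_cancel] using (u N).isSchatten.sub isSchatten_sub

instance [CompleteSpace F] : CompleteSpace (SchattenClass p E F) := by
  refine Metric.complete_of_cauchySeq_tendsto fun u hu => ?_
  obtain ⟨T, hT⟩ := cauchySeq_tendsto_of_complete
    ((toCLML p E F).uniformContinuous.comp_cauchySeq hu)
  refine ⟨mk T (isSchatten_of_tendsto hu hT), Metric.tendsto_atTop.2 fun ε hε => ?_⟩
  obtain ⟨N, hN⟩ := exists_forall_schattenENorm_sub_le hu hT (half_pos hε)
  refine ⟨N, fun n hn => ?_⟩
  rw [dist_eq_norm]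
  refine lt_of_le_of_lt ?_ (half_lt_self hε)
  rw [← ENNReal.ofReal_le_ofReal_iff (half_pos hε).le, ofReal_norm]
  exact hN n hn

section Ideal

variable [CompleteSpace D] [CompleteSpace E] [CompleteSpace F] [CompleteSpace G]

lemma norm_comp_le (S : F →L[ℂ] G) (T : SchattenClass p E F) (R : D →L[ℂ] E) :
    ‖mk (S ∘L T.toCLM ∘L R) (T.isSchatten.comp S R)‖ ≤ ‖S‖ * ‖T‖ * ‖R‖ := by
  simpa only [norm_def, toCLM_mk, ENNReal.toReal_mul, toReal_enorm] using
    ENNReal.toReal_mono (ENNReal.mul_ne_top (ENNReal.mul_ne_top enorm_ne_top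
      (schattenENorm_ne_top T.isSchatten)) enorm_ne_top) (schattenENorm_comp_le S T.toCLM R)

variable (p D E F G)

/-- Composition of a bounded operator with an operator of class `L^p`. -/
def compL : (F →L[ℂ] G) →L[ℂ] SchattenClass p E F →L[ℂ] SchattenClass p E G :=
  LinearMap.mkContinuous₂ (LinearMap.mk₂ ℂ
    (fun S T => mk (S ∘L T.toCLM) (T.isSchatten.comp S (ContinuousLinearMap.id ℂ E)))
    (fun S S' T => toCLM_injective (ContinuousLinearMap.add_comp S S' T.toCLM))
    (fun c S T => toCLM_injective (ContinuousLinearMap.smul_comp c S T.toCLM))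
    (fun S T T' => toCLM_injective (ContinuousLinearMap.comp_add S T.toCLM T'.toCLM))
    (fun c S T => toCLM_injective (ContinuousLinearMap.comp_smul S c T.toCLM)))
    1 fun S T => by
      rw [one_mul]
      exact (norm_comp_le S T (ContinuousLinearMap.id ℂ E)).trans
        (mul_le_of_le_one_right (by positivity) ContinuousLinearMap.norm_id_le)

/-- Composition of an operator of class `L^p` with a bounded operator. -/
def compR : (D →L[ℂ] E) →L[ℂ] SchattenClass p E F →L[ℂ] SchattenClass p D F :=
  LinearMap.mkContinuous₂ (LinearMap.mk₂ ℂ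
    (fun R T => mk (T.toCLM ∘L R) (T.isSchatten.comp (ContinuousLinearMap.id ℂ F) R))
    (fun R R' T => toCLM_injective (ContinuousLinearMap.comp_add T.toCLM R R'))
    (fun c R T => toCLM_injective (ContinuousLinearMap.comp_smul T.toCLM c R))
    (fun R T T' => toCLM_injective (ContinuousLinearMap.add_comp T.toCLM T'.toCLM R))
    (fun c R T => toCLM_injective (ContinuousLinearMap.smul_comp c T.toCLM R)))
    1 fun R T => by
      rw [one_mul, mul_comm]
      refine (norm_comp_le (ContinuousLinearMap.id ℂ F) T R).trans ?_
      gcongr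
      exact mul_le_of_le_one_left (norm_nonneg T) ContinuousLinearMap.norm_id_le

/-- The adjoint, as a real-linear map. -/
def adjointL : SchattenClass p E F →L[ℝ] SchattenClass p F E :=
  LinearMap.mkContinuous
    { toFun := fun T => mk (ContinuousLinearMap.adjoint T.toCLM) T.isSchatten.adjoint
      map_add' := fun S T => toCLM_injective (by simp)
      map_smul' := fun r T => toCLM_injective (by
        change ContinuousLinearMap.adjoint ((r : ℂ) • T.toCLM) =
          (r : ℂ) • ContinuousLinearMap.adjoint T.toCLM
        rw [map_smulₛₗ, Complex.conj_ofReal]) } 1 fun T => by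
    rw [one_mul, norm_def, norm_def]
    change (schattenENorm p (ContinuousLinearMap.adjoint T.toCLM)).toReal ≤ _
    rw [schattenENorm_adjoint]

end Ideal

end SchattenClass

section Fredholm

open scoped LinearMap.FiniteRangeSetoid

variable {p : ℝ} [Fact (p = 0 ∨ 1 < p)] {E F : Type*} [NormedAddCommGroup E]
  [InnerProductSpace ℂ E] [NormedAddCommGroup F] [InnerProductSpace ℂ F] [CompleteSpace E]
  [CompleteSpace F]

lemma exists_isQuasiInverse_one_sub {K : E →L[ℂ] E} (hK : IsSchatten p K) :
    ∃ A : E →L[ℂ] E, A.IsQuasiInverse (1 - K : E →L[ℂ] E).toLinearMap := by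
  obtain ⟨S, hS, hKS⟩ := hK.exists_finiteDimensional_range_norm_sub_le one_half_pos
  let u : (E →L[ℂ] E)ˣ := Units.oneSub (K - S) (hKS.trans_lt one_half_lt_one)
  have u_isQuasiInverse : (↑u⁻¹ : E →L[ℂ] E).IsQuasiInverse (u : E →L[ℂ] E).toLinearMap :=
    (ContinuousLinearEquiv.unitsEquiv ℂ E u).toLinearEquiv.isQuasiInverse
  refine ⟨_, u_isQuasiInverse.congr (Setoid.refl _) ?_⟩
  have sub_eq_neg : (1 - K : E →L[ℂ] E).toLinearMap - (u : E →L[ℂ] E).toLinearMap =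
      -S.toLinearMap := by
    ext x
    change x - K x - (x - (K x - S x)) = -S x
    abel
  rw [LinearMap.FiniteRangeSetoid.equiv_iff_hasFiniteRange, sub_eq_neg]
  exact LinearMap.HasFiniteRange.neg (Module.Finite.iff_fg.1 hS)

lemma isFredholm_of_isSchatten {T : E →L[ℂ] F} {S : F →L[ℂ] E}
    (hST : IsSchatten p (1 - S ∘L T)) (hTS : IsSchatten p (1 - T ∘L S)) : T.IsFredholm := by
  obtain ⟨A, hA⟩ := exists_isQuasiInverse_one_sub hST
  obtain ⟨B, hB⟩ := exists_isQuasiInverse_one_sub hTS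
  rw [sub_sub_cancel] at hA hB
  exact ContinuousLinearMap.IsFredholm.of_isQuasiInverse (v := S ∘L B)
    ⟨LinearMap.IsLeftQuasiInverse.of_comp_left (u' := (T ∘L A).toLinearMap) hA.2 hB.1, hB.2⟩

end Fredholm

section HilbertDimension

open scoped LinearMap.FiniteRangeSetoid Cardinal

universe u

variable {𝕜 : Type*} [RCLike 𝕜]

lemma infinite_of_hilbertBasis {ι E : Type*} [NormedAddCommGroup E] [InnerProductSpace 𝕜 E]
    (b : HilbertBasis ι 𝕜 E) (hE : ¬ FiniteDimensional 𝕜 E) : Infinite ι := by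
  by_contra hι
  have : Finite ι := not_infinite_iff_finite.1 hι
  have := Fintype.ofFinite ι
  exact hE (Module.Basis.finiteDimensional_of_finite b.toOrthonormalBasis.toBasis)

lemma nonempty_linearIsometryEquiv_of_hilbertBasis {ι κ E F : Type*} [NormedAddCommGroup E]
    [InnerProductSpace 𝕜 E] [NormedAddCommGroup F] [InnerProductSpace 𝕜 F] [CompleteSpace F]
    (b : HilbertBasis ι 𝕜 E) (c : HilbertBasis κ 𝕜 F) (e : ι ≃ κ) : Nonempty (E ≃ₗᵢ[𝕜] F) := by
  have dense_span : ⊤ ≤ (Submodule.span 𝕜 (Set.range (c ∘ e))).topologicalClosure := by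
    rw [e.surjective.range_comp, c.dense_span]
  exact ⟨b.repr.trans (HilbertBasis.mk (c.orthonormal.comp e e.injective) dense_span).repr.symm⟩

lemma finite_setOf_mem_of_linearIndependent {K V ι : Type*} [DivisionRing K] [AddCommGroup V]
    [Module K V] {v : ι → V} (hv : LinearIndependent K v) (S : Submodule K V)
    [FiniteDimensional K S] : {i | v i ∈ S}.Finite := by
  have linearIndependent_restrict :
      LinearIndependent K fun i : {i | v i ∈ S} => (⟨v i, i.2⟩ : S) :=
    LinearIndependent.of_comp S.subtype (hv.comp _ Subtype.val_injective)
  exact linearIndependent_restrict.finite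

variable {E F : Type*} [NormedAddCommGroup E] [InnerProductSpace 𝕜 E] [NormedAddCommGroup F]
  [InnerProductSpace 𝕜 F] [CompleteSpace E] [CompleteSpace F]

lemma isLeftQuasiInverse_adjoint {T : E →L[𝕜] F} {v : F →L[𝕜] E}
    (h : v.IsLeftQuasiInverse T.toLinearMap) :
    (ContinuousLinearMap.adjoint T).IsLeftQuasiInverse
      (ContinuousLinearMap.adjoint v).toLinearMap := by
  have : FiniteDimensional 𝕜 (v ∘L T - ContinuousLinearMap.id 𝕜 E).range :=
    Module.Finite.iff_fg.2 (LinearMap.FiniteRangeSetoid.equiv_iff_hasFiniteRange.1 h)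
  have finiteDimensional_range :=
    finiteDimensional_range_adjoint (v ∘L T - ContinuousLinearMap.id 𝕜 E)
  rw [map_sub, ContinuousLinearMap.adjoint_comp, ContinuousLinearMap.adjoint_id]
    at finiteDimensional_range
  exact LinearMap.FiniteRangeSetoid.equiv_iff_hasFiniteRange.2
    (Module.Finite.iff_fg.1 finiteDimensional_range)

lemma isFredholm_adjoint {T : E →L[𝕜] F} (hT : T.IsFredholm) :
    (ContinuousLinearMap.adjoint T).IsFredholm := by
  obtain ⟨v, hvT, hTv⟩ := hT.exists_isQuasiInverse
  exact ContinuousLinearMap.IsFredholm.of_isQuasiInverse (v := ContinuousLinearMap.adjoint v)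
    ⟨isLeftQuasiInverse_adjoint hTv, isLeftQuasiInverse_adjoint hvT⟩

lemma mk_le_of_finiteDimensional_ker_adjoint {ι κ : Type u} [Infinite ι]
    (b : HilbertBasis ι 𝕜 E) (c : HilbertBasis κ 𝕜 F) (T : E →L[𝕜] F)
    [FiniteDimensional 𝕜 (ContinuousLinearMap.adjoint T).ker] : #κ ≤ #ι := by
  let support (i : ι) : Set κ := {j | inner 𝕜 (c j) (T (b i)) ≠ 0}
  have countable_support (i : ι) : (support i).Countable :=
    (c.orthonormal.inner_products_summable (T (b i))).countable_support.mono fun j hj => by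
      simpa [support] using hj
  have univ_subset : Set.univ ⊆
      (⋃ i, support i) ∪ {j | c j ∈ (ContinuousLinearMap.adjoint T).ker} := by
    intro j _
    by_contra hj
    rw [Set.mem_union, not_or, Set.mem_iUnion, not_exists] at hj
    refine hj.2 ((LinearIsometryEquiv.map_eq_zero_iff b.repr).1 (lp.ext (funext fun i => ?_)))
    rw [b.repr_apply_apply, inner_eq_zero_symm.1]
    · rfl
    · exact (ContinuousLinearMap.adjoint_inner_left T _ _).trans (not_not.1 (hj.1 i))
  have mk_iUnion_support_le : #(⋃ i, support i) ≤ #ι := calc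
    #(⋃ i, support i) ≤ #ι * ⨆ i, #(support i) := Cardinal.mk_iUnion_le support
    _ ≤ #ι * ℵ₀ := mul_le_mul_right (ciSup_le' fun i => (countable_support i).le_aleph0) _
    _ = #ι := Cardinal.mul_aleph0_eq (Cardinal.aleph0_le_mk ι)
  have mk_ker_le : #{j | c j ∈ (ContinuousLinearMap.adjoint T).ker} ≤ #ι :=
    (finite_setOf_mem_of_linearIndependent c.orthonormal.linearIndependent _).lt_aleph0.le.trans
      (Cardinal.aleph0_le_mk ι)
  calc #κ = #(Set.univ : Set κ) := Cardinal.mk_univ.symm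
    _ ≤ #(⋃ i, support i) + #{j | c j ∈ (ContinuousLinearMap.adjoint T).ker} :=
      (Cardinal.mk_le_mk_of_subset univ_subset).trans (Cardinal.mk_union_le _ _)
    _ ≤ #ι + #ι := add_le_add mk_iUnion_support_le mk_ker_le
    _ = #ι := Cardinal.add_eq_self (Cardinal.aleph0_le_mk ι)

lemma nonempty_linearIsometryEquiv_of_isFredholm {E F : Type u} [NormedAddCommGroup E]
    [InnerProductSpace 𝕜 E] [CompleteSpace E] [NormedAddCommGroup F] [InnerProductSpace 𝕜 F]
    [CompleteSpace F] {T : E →L[𝕜] F}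
    (hT : T.IsFredholm) (hF : ¬ FiniteDimensional 𝕜 F) : Nonempty (E ≃ₗᵢ[𝕜] F) := by
  have hE : ¬ FiniteDimensional 𝕜 E := fun hE => by
    have : Module.Finite 𝕜 (F ⧸ T.range) := hT.finite_coker
    have : Module.Finite 𝕜 T.range := inferInstance
    exact hF (Module.Finite.of_submodule_quotient T.range)
  obtain ⟨ι, b, -⟩ := exists_hilbertBasis 𝕜 E
  obtain ⟨κ, c, -⟩ := exists_hilbertBasis 𝕜 F
  have := infinite_of_hilbertBasis b hE
  have := infinite_of_hilbertBasis c hF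
  have := (isFredholm_adjoint hT).finite_ker
  have : FiniteDimensional 𝕜
      (ContinuousLinearMap.adjoint (ContinuousLinearMap.adjoint T)).ker := by
    rw [ContinuousLinearMap.adjoint_adjoint]
    exact hT.finite_ker
  obtain ⟨e⟩ := Cardinal.eq.1 (le_antisymm
    (mk_le_of_finiteDimensional_ker_adjoint c b (ContinuousLinearMap.adjoint T))
    (mk_le_of_finiteDimensional_ker_adjoint b c T))
  exact nonempty_linearIsometryEquiv_of_hilbertBasis b c e

end HilbertDimension

section StarProjection

variable {𝕜 H : Type*} [RCLike 𝕜] [NormedAddCommGroup H] [InnerProductSpace 𝕜 H] [CompleteSpace H]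
  {P : H →L[𝕜] H}

lemma completeSpace_range_of_isStarProjection (hP : IsStarProjection P) : CompleteSpace P.range :=
  (ContinuousLinearMap.IsIdempotentElem.isClosed_range hP.isIdempotentElem).completeSpace_coe

omit [CompleteSpace H] in
lemma apply_eq_self_of_mem_range (hP : IsIdempotentElem P) {x : H} (hx : x ∈ P.range) :
    P x = x := by
  obtain ⟨y, rfl⟩ := hx
  exact DFunLike.congr_fun hP.eq y

lemma starProjection_range_eq_self (hP : IsStarProjection P)
    [P.range.HasOrthogonalProjection] : P.range.starProjection = P :=
  (isStarProjection_iff_eq_starProjection_range.1 hP).2.symm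

lemma coe_orthogonalProjectionOnto_range (hP : IsStarProjection P)
    [P.range.HasOrthogonalProjection] (x : H) :
    (P.range.orthogonalProjectionOnto x : H) = P x :=
  DFunLike.congr_fun (starProjection_range_eq_self hP) x

lemma exists_partialIsometry {K L : Submodule 𝕜 H} [CompleteSpace K] [CompleteSpace L]
    (f : K ≃ₗᵢ[𝕜] L) : ∃ a : H →L[𝕜] H, a * star a * a = a ∧
      star a * a = K.starProjection ∧ a * star a = L.starProjection := by
  let a : H →L[𝕜] H := L.subtypeL ∘L (f : K →L[𝕜] L) ∘L K.orthogonalProjectionOnto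
  have star_a : star a = K.subtypeL ∘L (f.symm : L →L[𝕜] K) ∘L L.orthogonalProjectionOnto := by
    rw [ContinuousLinearMap.star_eq_adjoint, ContinuousLinearMap.adjoint_comp,
      ContinuousLinearMap.adjoint_comp, Submodule.adjoint_subtypeL,
      Submodule.adjoint_orthogonalProjectionOnto, LinearIsometryEquiv.adjoint_eq_symm]
    rfl
  have star_mul_self : star a * a = K.starProjection := by
    rw [star_a]
    ext x
    simp [a]
  refine ⟨a, ?_, star_mul_self, ?_⟩
  · rw [mul_assoc, star_mul_self]
    ext x
    exact congrArg (fun z : K => ((f z : L) : H))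
      (K.orthogonalProjectionOnto_mem_subspace_eq_self (K.orthogonalProjectionOnto x))
  · rw [star_a]
    ext x
    simp [a]

end StarProjection

section UnitaryOfPartialIsometries

variable {A : Type*} [Ring A] [StarRing A] {a b e P : A}

lemma star_mul_eq_zero_of_partialIsometry (ha : a * star a * a = a) (hb : b * star b * b = b)
    (haP : a * star a = P) (hbP : b * star b = 1 - P) : star a * b = 0 := by
  have P_idem : P * P = P := by rw [← haP, ← mul_assoc, ha]
  have star_a : star a * P = star a := by
    rw [← haP, ← mul_assoc]
    simpa only [star_mul, star_star, mul_assoc] using congrArg star ha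
  calc star a * b = star a * P * ((1 - P) * b) := by rw [star_a, ← hbP, hb]
    _ = star a * (P - P * P) * b := by noncomm_ring
    _ = 0 := by rw [P_idem, sub_self, mul_zero, zero_mul]

lemma add_mem_unitary_of_partialIsometry (ha : a * star a * a = a) (hb : b * star b * b = b)
    (hae : star a * a = e) (haP : a * star a = P) (hbe : star b * b = 1 - e)
    (hbP : b * star b = 1 - P) :
    a + b ∈ unitary A ∧ (a + b) * e * star (a + b) = P := by
  have star_triple {c : A} (hc : c * star c * c = c) :
      star c * star (star c) * star c = star c := by
    simpa only [star_mul, star_star, mul_assoc] using congrArg star hc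
  have star_a_mul_b : star a * b = 0 := star_mul_eq_zero_of_partialIsometry ha hb haP hbP
  have star_b_mul_a : star b * a = 0 := by simpa using congrArg star star_a_mul_b
  have a_mul_star_b : a * star b = 0 := by
    simpa using star_mul_eq_zero_of_partialIsometry (star_triple ha) (star_triple hb)
      (P := e) (by rwa [star_star]) (by rwa [star_star])
  have b_mul_star_a : b * star a = 0 := by simpa using congrArg star a_mul_star_b
  have add_mul_e : (a + b) * e = a := by
    rw [← hae, add_mul, ← mul_assoc, ha, ← mul_assoc, b_mul_star_a, zero_mul, add_zero]
  refine ⟨Unitary.mem_iff.2 ⟨?_, ?_⟩, ?_⟩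
  · rw [star_add, add_mul, mul_add, mul_add, star_a_mul_b, star_b_mul_a, hae, hbe]
    abel
  · rw [star_add, add_mul, mul_add, mul_add, a_mul_star_b, b_mul_star_a, haP, hbP]
    abel
  · rw [add_mul_e, star_add, mul_add, haP, a_mul_star_b, add_zero]

end UnitaryOfPartialIsometries

section RestrictedProjector

open scoped LinearMap.FiniteRangeSetoid

variable {p : ℝ} [Fact (p = 0 ∨ 1 < p)] {H : Type*} [NormedAddCommGroup H]
  [InnerProductSpace ℂ H] [CompleteSpace H] {Hp : Submodule ℂ H} [CompleteSpace Hp]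

namespace IsRestrictedProjector

variable {P : H →L[ℂ] H}

lemma isSchatten_one_sub_mul (hP : IsRestrictedProjector p Hp P) :
    IsSchatten p ((1 - Hp.starProjection) * P) := by
  have := completeSpace_range_of_isStarProjection hP.isStarProjection
  convert hP.schatten.comp Hpᗮ.subtypeL P.range.orthogonalProjectionOnto using 1
  ext x
  change P x - Hp.starProjection (P x) =
    Hpᗮ.starProjection (P.range.orthogonalProjectionOnto x : H)
  rw [coe_orthogonalProjectionOnto_range hP.isStarProjection, Submodule.starProjection_orthogonal']
  rfl

/- If `v` inverts the projection of the range of `P` to `Hp` up to a finite-rank error `R`, then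
`e x = P (v (e x)) - (1 - e) P (v (e x)) - R (e x)` for the projection `e` onto `Hp`, and `1 - P`
kills the first term. -/
lemma isSchatten_one_sub_mul_starProjection (hP : IsRestrictedProjector p Hp P) :
    IsSchatten p ((1 - P) * Hp.starProjection) := by
  obtain ⟨v, -, hv⟩ := hP.fredholm.exists_isQuasiInverse
  let R : Hp →L[ℂ] Hp :=
    (Hp.orthogonalProjectionOnto ∘L P.range.subtypeL) ∘L v - ContinuousLinearMap.id ℂ Hp
  have : FiniteDimensional ℂ R.range :=
    Module.Finite.iff_fg.2 (LinearMap.FiniteRangeSetoid.equiv_iff_hasFiniteRange.1 hv)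
  have isSchatten_R : IsSchatten p R := isSchatten_of_finiteDimensional_range R
  convert ((hP.isSchatten_one_sub_mul.comp (1 - P)
    (P.range.subtypeL ∘L v ∘L Hp.orthogonalProjectionOnto)).add
    (isSchatten_R.comp ((1 - P) ∘L Hp.subtypeL) Hp.orthogonalProjectionOnto)).neg using 1
  ext x
  set y : Hp := Hp.orthogonalProjectionOnto x
  have P_v : P (v y : H) = v y :=
    apply_eq_self_of_mem_range hP.isStarProjection.isIdempotentElem (v y).2
  change (y : H) - P y = -((1 - P) (P (v y) - Hp.starProjection (P (v y))) +
    (1 - P) (Hp.starProjection (v y) - y))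
  rw [P_v, ← map_add, ← map_neg, sub_add_sub_cancel, neg_sub, map_sub]
  simp [P_v]

lemma isSchatten_sub (hP : IsRestrictedProjector p Hp P) :
    IsSchatten p (P - Hp.starProjection) := by
  have star_e : star Hp.starProjection = Hp.starProjection :=
    isStarProjection_starProjection.isSelfAdjoint.star_eq
  have sub_eq : P - Hp.starProjection = (1 - Hp.starProjection) * P -
      ContinuousLinearMap.adjoint ((1 - P) * Hp.starProjection) := by
    rw [← ContinuousLinearMap.star_eq_adjoint, star_mul, star_sub, star_one, star_e,
      hP.isStarProjection.isSelfAdjoint.star_eq]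
    noncomm_ring
  rw [sub_eq]
  exact hP.isSchatten_one_sub_mul.sub hP.isSchatten_one_sub_mul_starProjection.adjoint

end IsRestrictedProjector

lemma isFredholm_of_isSchatten_sub {P : H →L[ℂ] H} (hP : IsStarProjection P)
    (h : IsSchatten p (P - Hp.starProjection)) :
    (Hp.orthogonalProjectionOnto ∘L P.range.subtypeL).IsFredholm := by
  have := completeSpace_range_of_isStarProjection hP
  have P_coe (x : P.range) : P x = x := apply_eq_self_of_mem_range hP.isIdempotentElem x.2
  have e_coe (x : Hp) : Hp.starProjection (x : H) = x := Submodule.starProjection_eq_self_iff.2 x.2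
  refine isFredholm_of_isSchatten (p := p)
    (S := P.range.orthogonalProjectionOnto ∘L Hp.subtypeL) ?_ ?_
  · convert h.comp P.range.orthogonalProjectionOnto P.range.subtypeL using 1
    ext x
    change (x : H) - (P.range.orthogonalProjectionOnto (Hp.starProjection (x : H)) : H) =
      (P.range.orthogonalProjectionOnto (P x - Hp.starProjection x) : H)
    rw [coe_orthogonalProjectionOnto_range hP, coe_orthogonalProjectionOnto_range hP, map_sub,
      P_coe, P_coe]
  · convert h.neg.comp Hp.orthogonalProjectionOnto Hp.subtypeL using 1
    ext x
    change (x : H) - Hp.starProjection (P.range.orthogonalProjectionOnto (x : H) : H) =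
      Hp.starProjection (-(P x - Hp.starProjection x))
    rw [coe_orthogonalProjectionOnto_range hP, neg_sub, map_sub, e_coe, e_coe]

lemma isRestrictedProjector_of_isSchatten_sub {P : H →L[ℂ] H} (hP : IsStarProjection P)
    (h : IsSchatten p (P - Hp.starProjection)) : IsRestrictedProjector p Hp P := by
  have := completeSpace_range_of_isStarProjection hP
  refine ⟨hP, isFredholm_of_isSchatten_sub hP h, ?_⟩
  convert h.comp Hpᗮ.orthogonalProjectionOnto P.range.subtypeL using 1
  ext x
  have P_coe : P x = x := apply_eq_self_of_mem_range hP.isIdempotentElem x.2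
  have e_mem : Hpᗮ.starProjection (Hp.starProjection (x : H)) = 0 := by
    rw [Submodule.starProjection_apply_eq_zero_iff, Submodule.orthogonal_orthogonal]
    exact Submodule.starProjection_apply_mem _ _
  change Hpᗮ.starProjection (x : H) = Hpᗮ.starProjection (P x - Hp.starProjection x)
  rw [map_sub, P_coe, e_mem, sub_zero]

namespace IsRestrictedProjector

variable {P : H →L[ℂ] H}

lemma one_sub (hP : IsRestrictedProjector p Hp P) : IsRestrictedProjector p Hpᗮ (1 - P) := by
  refine isRestrictedProjector_of_isSchatten_sub hP.isStarProjection.one_sub ?_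
  convert hP.isSchatten_sub.neg using 1
  rw [Submodule.starProjection_orthogonal']
  change (1 - P) - (1 - Hp.starProjection) = _
  abel

/- Restricted projectors differ from the projection onto `Hp` by a Fredholm operator on ranges and
on kernels, so both have the Hilbert dimension of `Hp` and of `Hpᗮ`. -/
lemma exists_unitary (hP : IsRestrictedProjector p Hp P) (hplus : ¬ FiniteDimensional ℂ Hp)
    (hminus : ¬ FiniteDimensional ℂ Hpᗮ) :
    ∃ U ∈ unitary (H →L[ℂ] H), U * Hp.starProjection * star U = P := by
  have := completeSpace_range_of_isStarProjection hP.isStarProjection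
  have := completeSpace_range_of_isStarProjection hP.one_sub.isStarProjection
  obtain ⟨f⟩ := nonempty_linearIsometryEquiv_of_isFredholm hP.fredholm hplus
  obtain ⟨g⟩ := nonempty_linearIsometryEquiv_of_isFredholm hP.one_sub.fredholm hminus
  obtain ⟨a, ha, source_a, target_a⟩ := exists_partialIsometry f.symm
  obtain ⟨b, hb, source_b, target_b⟩ := exists_partialIsometry g.symm
  rw [starProjection_range_eq_self hP.isStarProjection] at target_a
  rw [starProjection_range_eq_self hP.one_sub.isStarProjection] at target_b
  obtain ⟨unitary_add, conj_eq⟩ := add_mem_unitary_of_partialIsometry ha hb source_a target_a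
    (source_b.trans (Submodule.starProjection_orthogonal' Hp)) target_b
  exact ⟨a + b, unitary_add, conj_eq⟩

end IsRestrictedProjector

end RestrictedProjector

/-! ### Manifolds embedded by a map into another manifold -/

section AdaptedChart

variable {EN HN N M F F' : Type*} [NormedAddCommGroup EN] [NormedSpace ℝ EN] [TopologicalSpace HN]
  {I : ModelWithCorners ℝ EN HN} [TopologicalSpace N] [ChartedSpace HN N] {J : M → N}
  [TopologicalSpace M] [NormedAddCommGroup F] [NormedSpace ℝ F]
  [NormedAddCommGroup F'] [NormedSpace ℝ F']

variable (I J) in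
/-- The chart `φ` of `M` is compatible with the injection `J` of `M` into the manifold `N`: its
inverse is smooth as a map to `N`, and it extends to a smooth map on an open subset of `N`. -/
def IsAdaptedChart (φ : OpenPartialHomeomorph M F) : Prop :=
  ContMDiffOn 𝓘(ℝ, F) I ∞ (J ∘ φ.symm) φ.target ∧
    ∃ (O : Set N) (f : N → F), IsOpen O ∧ ContMDiffOn I 𝓘(ℝ, F) ∞ f O ∧
      ∀ x ∈ φ.source, J x ∈ O ∧ φ x = f (J x)

lemma exists_isAdaptedChart (hJ : Topology.IsInducing J) (e : PartialEquiv M F)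
    (htarget : IsOpen e.target) (hsymm : ContMDiffOn 𝓘(ℝ, F) I ∞ (J ∘ e.symm) e.target)
    {O : Set N} {f : N → F} (hO : IsOpen O) (hf : ContMDiffOn I 𝓘(ℝ, F) ∞ f O)
    (hsource : e.source = J ⁻¹' O) (hef : ∀ x ∈ e.source, e x = f (J x)) :
    ∃ φ : OpenPartialHomeomorph M F, φ.toPartialEquiv = e ∧ IsAdaptedChart I J φ := by
  refine ⟨⟨⟨e, ?_, ?_⟩, hsource ▸ hO.preimage hJ.continuous, htarget⟩, rfl, hsymm, O, f, hO, hf,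
    fun x hx => ⟨?_, hef x hx⟩⟩
  · refine ContinuousOn.congr (f := f ∘ J) ?_ hef
    exact hf.continuousOn.comp hJ.continuous.continuousOn fun x hx => by rwa [hsource] at hx
  · exact hJ.continuousOn_iff.2 hsymm.continuousOn
  · change x ∈ e.source at hx
    rwa [hsource] at hx

lemma IsAdaptedChart.transHomeomorph {φ : OpenPartialHomeomorph M F} (hφ : IsAdaptedChart I J φ)
    (e : F ≃L[ℝ] F') : IsAdaptedChart I J (φ.transHomeomorph e.toHomeomorph) := by
  obtain ⟨hsymm, O, f, hO, hf, hfJ⟩ := hφ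
  refine ⟨?_, O, e ∘ f, hO, ?_, fun x hx => ⟨(hfJ x hx).1, congrArg e (hfJ x hx).2⟩⟩
  · exact hsymm.comp e.symm.contDiff.contMDiff.contMDiffOn fun x hx => hx
  · exact e.contDiff.contMDiff.comp_contMDiffOn hf

lemma IsAdaptedChart.contDiffOn_trans {φ : OpenPartialHomeomorph M F}
    {ψ : OpenPartialHomeomorph M F'} (hφ : IsAdaptedChart I J φ) (hψ : IsAdaptedChart I J ψ) :
    ContDiffOn ℝ ∞ (ψ ∘ φ.symm) (φ.symm.trans ψ).source := by
  obtain ⟨hsymm, -⟩ := hφ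
  obtain ⟨-, O, f, -, hf, hfJ⟩ := hψ
  rw [← contMDiffOn_iff_contDiffOn]
  have mem_source (x) (hx : x ∈ (φ.symm.trans ψ).source) : x ∈ φ.target ∧ φ.symm x ∈ ψ.source := by
    simpa using hx
  refine ContMDiffOn.congr (f := f ∘ (J ∘ φ.symm)) ?_ fun x hx => (hfJ _ (mem_source x hx).2).2
  exact hf.comp (hsymm.mono fun x hx => (mem_source x hx).1)
    fun x hx => (hfJ _ (mem_source x hx).2).1

variable [ChartedSpace F M]

lemma isManifold_of_isAdaptedChart (h : ∀ φ ∈ atlas F M, IsAdaptedChart I J φ) :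
    IsManifold 𝓘(ℝ, F) ∞ M := by
  refine isManifold_of_contDiffOn _ _ _ fun φ ψ hφ hψ => ?_
  simpa using (h φ hφ).contDiffOn_trans (h ψ hψ)

lemma contMDiffWithinAt_of_isAdaptedChart (hJ : Topology.IsInducing J)
    (h : ∀ φ ∈ atlas F M, IsAdaptedChart I J φ) {E' H' N' : Type*} [NormedAddCommGroup E']
    [NormedSpace ℝ E'] [TopologicalSpace H'] {I' : ModelWithCorners ℝ E' H'} [TopologicalSpace N']
    [ChartedSpace H' N'] {g : N' → M} {s : Set N'} {x : N'}
    (hg : ContMDiffWithinAt I' I ∞ (J ∘ g) s x) : ContMDiffWithinAt I' 𝓘(ℝ, F) ∞ g s x := by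
  have hcont : ContinuousWithinAt g s x := hJ.continuousWithinAt_iff.2 hg.continuousWithinAt
  refine contMDiffWithinAt_iff_target.2 ⟨hcont, ?_⟩
  obtain ⟨-, O, f, hO, hf, hfJ⟩ := h _ (chart_mem_atlas F (g x))
  have hx := hfJ _ (mem_chart_source F (g x))
  have contMDiff_f_comp : ContMDiffWithinAt I' 𝓘(ℝ, F) ∞ (f ∘ (J ∘ g)) s x :=
    (hf.contMDiffAt (hO.mem_nhds hx.1)).comp_contMDiffWithinAt x hg
  refine contMDiff_f_comp.congr_of_eventuallyEq ?_ ?_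
  · filter_upwards [hcont ((chartAt F (g x)).open_source.mem_nhds (mem_chart_source F (g x)))]
      with y hy
    simpa using (hfJ _ hy).2
  · simpa using hx.2

lemma contMDiff_of_isAdaptedChart (h : ∀ φ ∈ atlas F M, IsAdaptedChart I J φ) :
    ContMDiff 𝓘(ℝ, F) I ∞ J := by
  have := isManifold_of_isAdaptedChart h
  intro x
  have hsymm := (h _ (chart_mem_atlas F x)).1
  have chart_smooth : ContMDiffOn 𝓘(ℝ, F) 𝓘(ℝ, F) ∞ (chartAt F x) (chartAt F x).source :=
    contMDiffOn_chart
  have source_mem_nhds := (chartAt F x).open_source.mem_nhds (mem_chart_source F x)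
  refine ((hsymm.comp chart_smooth fun y hy => (chartAt F x).map_source hy).contMDiffAt
    source_mem_nhds).congr_of_eventuallyEq ?_
  filter_upwards [source_mem_nhds] with y hy
  exact congrArg J ((chartAt F x).left_inv hy).symm

lemma IsAdaptedChart.isSmoothChart (hJ : Topology.IsInducing J)
    (h : ∀ φ ∈ atlas F M, IsAdaptedChart I J φ) {ψ : OpenPartialHomeomorph M F'}
    (hψ : IsAdaptedChart I J ψ) : IsSmoothChart (E := F) ψ := by
  obtain ⟨hsymm, O, f, -, hf, hfJ⟩ := hψ
  refine ⟨?_, fun x hx => contMDiffWithinAt_of_isAdaptedChart hJ h (hsymm x hx)⟩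
  refine ContMDiffOn.congr (f := f ∘ J) ?_ fun x hx => (hfJ x hx).2
  exact hf.comp (contMDiff_of_isAdaptedChart h).contMDiffOn fun x hx => (hfJ x hx).1

end AdaptedChart

/-! ### Pairs of projections in general position -/

section ObliqueProjection

variable {A : Type*}

/-- `T` is the oblique projection onto the range of the projection `P` along the kernel of the
projection `Q`, expressed by the multiplication table of `P`, `Q` and `T`. -/
structure IsObliqueProjection [Mul A] (P Q T : A) : Prop where
  left_mul : P * T = T
  mul_left : T * P = P
  mul_right : T * Q = T
  right_mul : Q * T = Q

/-- The canonical element intertwining the projections `P` and `Q`: it satisfies `T * P = Q * T`. -/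
def projectionIntertwiner [Ring A] (P Q : A) : A := Q * P + (1 - Q) * (1 - P)

lemma projectionIntertwiner_eq [Ring A] {P Q : A} (hQ : IsIdempotentElem Q) :
    projectionIntertwiner P Q = 1 - (1 - 2 * Q) * (P - Q) := by
  calc _ = 1 - P - Q + 2 * (Q * P) := by rw [projectionIntertwiner]; noncomm_ring
    _ = 1 - P + Q + 2 * (Q * P) - 2 * (Q * Q) := by rw [hQ.eq]; noncomm_ring
    _ = _ := by noncomm_ring

lemma projectionIntertwiner_mul [Ring A] {P Q : A} (hP : IsIdempotentElem P) :
    projectionIntertwiner P Q * P = Q * P := by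
  rw [projectionIntertwiner, add_mul, mul_assoc, mul_assoc, hP.eq, hP.one_sub_mul_self, mul_zero,
    add_zero]

lemma mul_projectionIntertwiner [Ring A] {P Q : A} (hQ : IsIdempotentElem Q) :
    Q * projectionIntertwiner P Q = Q * P := by
  rw [projectionIntertwiner, mul_add, ← mul_assoc, ← mul_assoc, hQ.eq, hQ.mul_one_sub_self,
    zero_mul, add_zero]

lemma isObliqueProjection_of_isUnit [Ring A] {P Q : A} (hP : IsIdempotentElem P)
    (hQ : IsIdempotentElem Q) (h : IsUnit (projectionIntertwiner P Q)) :
    IsObliqueProjection P Q (Ring.inverse (projectionIntertwiner P Q) * Q) := by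
  obtain ⟨u, hu⟩ := h
  have mul_P : (u : A) * P = Q * P := hu ▸ projectionIntertwiner_mul hP
  have Q_mul : Q * (u : A) = Q * P := hu ▸ mul_projectionIntertwiner hQ
  have inv_intertwines : (↑u⁻¹ : A) * Q = P * ↑u⁻¹ := by
    rw [Units.inv_mul_eq_iff_eq_mul, ← mul_assoc, mul_P, ← Q_mul, mul_assoc, Units.mul_inv, mul_one]
  rw [← hu, Ring.inverse_unit]
  refine ⟨?_, ?_, ?_, ?_⟩
  · rw [inv_intertwines, ← mul_assoc, hP.eq]
  · rw [mul_assoc, ← mul_P, ← mul_assoc, Units.inv_mul, one_mul]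
  · rw [mul_assoc, hQ.eq]
  · rw [inv_intertwines, ← mul_assoc, ← Q_mul, mul_assoc, Units.mul_inv, mul_one]

namespace IsObliqueProjection

variable [Ring A] {P P' Q T : A}

lemma projectionIntertwiner_mul_eq (h : IsObliqueProjection P Q T) :
    projectionIntertwiner P Q * T = Q := by
  calc projectionIntertwiner P Q * T = Q * (P * T) + (1 - Q) * (T - P * T) := by
        rw [projectionIntertwiner]; noncomm_ring
    _ = Q := by rw [h.left_mul, h.right_mul, sub_self, mul_zero, add_zero]

variable [StarRing A]

lemma flip_star (h : IsObliqueProjection P Q T) (hP : IsSelfAdjoint P) (hQ : IsSelfAdjoint Q) :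
    IsObliqueProjection Q P (star T) := by
  refine ⟨?_, ?_, ?_, ?_⟩
  · simpa [hQ.star_eq] using congrArg star h.mul_right
  · simpa [hQ.star_eq] using congrArg star h.right_mul
  · simpa [hP.star_eq] using congrArg star h.left_mul
  · simpa [hP.star_eq] using congrArg star h.mul_left

/-- The inverse of the intertwiner is `T` on the range of `Q` and `1 - star T`, the oblique
projection onto the kernel of `P` along the range of `Q`, on the kernel of `Q`. -/
lemma isUnit (h : IsObliqueProjection P Q T) (hP : IsStarProjection P) (hQ : IsStarProjection Q) :
    IsUnit (projectionIntertwiner P Q) := by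
  have hstar := h.flip_star hP.isSelfAdjoint hQ.isSelfAdjoint
  have hQQ : Q * Q = Q := hQ.isIdempotentElem.eq
  refine isUnit_iff_exists.2 ⟨T * Q + (1 - star T) * (1 - Q), ?_, ?_⟩
  · calc projectionIntertwiner P Q * (T * Q + (1 - star T) * (1 - Q))
        = Q * (P * T) * Q + (1 - Q) * (T - P * T) * Q + Q * (P - P * star T) * (1 - Q)
          + (1 - Q) * (1 - star T - P + P * star T) * (1 - Q) := by
          rw [projectionIntertwiner]; noncomm_ring
      _ = (Q * T) * Q + (1 - Q) * (1 - star T) * (1 - Q) := by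
          rw [h.left_mul, hstar.right_mul]; noncomm_ring
      _ = Q * Q + (1 - Q) * (1 - Q) - (star T - Q * star T) * (1 - Q) := by
          rw [h.right_mul]; noncomm_ring
      _ = 1 - 2 * Q + 2 * (Q * Q) := by rw [hstar.left_mul]; noncomm_ring
      _ = 1 := by rw [hQQ]; noncomm_ring
  · calc (T * Q + (1 - star T) * (1 - Q)) * projectionIntertwiner P Q
        = T * (Q * Q) * P + T * (Q - Q * Q) * (1 - P) + (1 - star T) * (Q - Q * Q) * P
          + (1 - star T) * (1 - 2 * Q + Q * Q) * (1 - P) := by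
          rw [projectionIntertwiner]; noncomm_ring
      _ = (T * Q) * P + (1 - Q - star T + star T * Q) * (1 - P) := by
          rw [hQQ]; noncomm_ring
      _ = P + (1 - star T) * (1 - P) := by
          rw [h.mul_right, h.mul_left, hstar.mul_left]; noncomm_ring
      _ = 1 - star T + star T * P := by noncomm_ring
      _ = 1 := by rw [hstar.mul_right]; noncomm_ring

lemma inverse_mul (h : IsObliqueProjection P Q T) (hP : IsStarProjection P)
    (hQ : IsStarProjection Q) : Ring.inverse (projectionIntertwiner P Q) * Q = T := by
  calc Ring.inverse (projectionIntertwiner P Q) * Q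
      = Ring.inverse (projectionIntertwiner P Q) * (projectionIntertwiner P Q * T) := by
        rw [h.projectionIntertwiner_mul_eq]
    _ = T := by rw [← mul_assoc, Ring.inverse_mul_cancel _ (h.isUnit hP hQ), one_mul]

lemma unique (h : IsObliqueProjection P Q T) (h' : IsObliqueProjection P' Q T)
    (hP : IsSelfAdjoint P) (hP' : IsSelfAdjoint P') : P = P' := by
  have mul_eq_right : P * P' = P' := by rw [← h'.mul_left, ← mul_assoc, h.left_mul]
  calc P = P' * P := by rw [← h.mul_left, ← mul_assoc, h'.left_mul]
    _ = star (P * P') := by rw [star_mul, hP.star_eq, hP'.star_eq]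
    _ = P' := by rw [mul_eq_right, hP'.star_eq]

end IsObliqueProjection

lemma isUnit_one_sub_of_skewAdjoint [CStarAlgebra A] {S : A} (hS : star S = -S) :
    IsUnit (1 - S) := by
  have selfAdjoint : IsSelfAdjoint (Complex.I • S) := by
    rw [isSelfAdjoint_iff, star_smul, hS, Complex.star_def, Complex.conj_I, smul_neg, neg_smul,
      neg_neg]
  have I_notMem_spectrum : Complex.I ∉ spectrum ℂ (Complex.I • S) := fun hI =>
    Complex.I_ne_zero (Complex.ext Complex.I_re (selfAdjoint.im_eq_zero_of_mem_spectrum hI))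
  rw [spectrum.notMem_iff, Algebra.algebraMap_eq_smul_one, ← smul_sub] at I_notMem_spectrum
  exact (isUnit_smul_iff (Units.mk0 Complex.I Complex.I_ne_zero) (1 - S)).1 I_notMem_spectrum

lemma isUnit_add_star_sub_one [CStarAlgebra A] {T : A} (hT : IsIdempotentElem T) :
    IsUnit (T + star T - 1) := by
  have sq_eq : (T + star T - 1) ^ 2 = (1 - (T - star T)) * (1 - (star T - T)) := by
    have hTs := hT.star.eq
    calc (T + star T - 1) ^ 2
        = T * T + star T * star T + T * star T + star T * T - 2 * T - 2 * star T + 1 := by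
          noncomm_ring
      _ = 1 - T * T - star T * star T + T * star T + star T * T := by
          rw [hT.eq, hTs]; noncomm_ring
      _ = _ := by noncomm_ring
  refine (isUnit_pow_iff two_ne_zero).1 (sq_eq ▸ IsUnit.mul ?_ ?_)
  all_goals exact isUnit_one_sub_of_skewAdjoint (by simp)

/-- The orthogonal projection onto the range of an idempotent `T`, by Kaplansky's formula. -/
def rangeProjection [Ring A] [StarRing A] (T : A) : A := T * Ring.inverse (T + star T - 1)

section RangeProjection

variable [CStarAlgebra A] {T Q a : A}

lemma mul_rangeProjection (hT : IsIdempotentElem T) :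
    T * rangeProjection T = rangeProjection T := by
  rw [rangeProjection, ← mul_assoc, hT.eq]

lemma star_rangeProjection (hT : IsIdempotentElem T) :
    star (rangeProjection T) = rangeProjection T := by
  have hN := isUnit_add_star_sub_one hT
  have star_N : star (T + star T - 1) = T + star T - 1 := by
    rw [star_sub, star_add, star_star, star_one, add_comm]
  have N_mul : (T + star T - 1) * T = star T * (T + star T - 1) := by
    calc (T + star T - 1) * T = T * T - T + star T * T := by noncomm_ring
      _ = star T * star T - star T + star T * T := by rw [hT.eq, hT.star.eq]; noncomm_ring
      _ = _ := by noncomm_ring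
  rw [rangeProjection, star_mul, ← Ring.inverse_star, star_N]
  set N := T + star T - 1
  calc Ring.inverse N * star T = Ring.inverse N * (star T * N) * Ring.inverse N := by
        rw [← mul_assoc, Ring.mul_inverse_cancel_right _ _ hN]
    _ = T * Ring.inverse N := by rw [← N_mul, Ring.inverse_mul_cancel_left _ _ hN]

lemma rangeProjection_mul (hT : IsIdempotentElem T) : rangeProjection T * T = T := by
  have star_T_mul : star T * T = (T + star T - 1) * T := by
    rw [sub_mul, add_mul, hT.eq, one_mul, add_sub_cancel_left]
  have star_N : star (T + star T - 1) = T + star T - 1 := by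
    rw [star_sub, star_add, star_star, star_one, add_comm]
  rw [← star_rangeProjection hT, rangeProjection, star_mul, ← Ring.inverse_star, star_N, mul_assoc,
    star_T_mul, Ring.inverse_mul_cancel_left _ _ (isUnit_add_star_sub_one hT)]

lemma isStarProjection_rangeProjection (hT : IsIdempotentElem T) :
    IsStarProjection (rangeProjection T) where
  isIdempotentElem := by
    rw [IsIdempotentElem]
    nth_rw 2 [rangeProjection]
    rw [← mul_assoc, rangeProjection_mul hT, rangeProjection]
  isSelfAdjoint := star_rangeProjection hT

lemma isIdempotentElem_add (hQ : IsIdempotentElem Q) (hQa : Q * a = 0) (haQ : a * Q = a) :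
    IsIdempotentElem (Q + a) := by
  have mul_self_eq_zero : a * a = 0 := by
    rw [← haQ, mul_assoc, ← mul_assoc Q, hQa, zero_mul, mul_zero]
  rw [IsIdempotentElem, add_mul, mul_add, mul_add, hQ.eq, hQa, haQ, mul_self_eq_zero, add_zero,
    add_zero]

lemma isObliqueProjection_rangeProjection_add (hQ : IsIdempotentElem Q) (hQa : Q * a = 0)
    (haQ : a * Q = a) : IsObliqueProjection (rangeProjection (Q + a)) Q (Q + a) where
  left_mul := rangeProjection_mul (isIdempotentElem_add hQ hQa haQ)
  mul_left := mul_rangeProjection (isIdempotentElem_add hQ hQa haQ)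
  mul_right := by rw [add_mul, hQ.eq, haQ]
  right_mul := by rw [mul_add, hQ.eq, hQa, add_zero]

lemma rangeProjection_add_sub (hQ : IsStarProjection Q) (hQa : Q * a = 0) (haQ : a * Q = a) :
    rangeProjection (Q + a) - Q =
      a - (Q + a) * ((a + star a) * Ring.inverse (Q + a + star (Q + a) - 1)) := by
  have hN := isUnit_add_star_sub_one (isIdempotentElem_add hQ.isIdempotentElem hQa haQ)
  have N_eq : Q + a + star (Q + a) - 1 = 2 * Q - 1 + (a + star a) := by
    rw [star_add, hQ.isSelfAdjoint.star_eq]; noncomm_ring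
  have mul_reflection : (Q + a) * (2 * Q - 1) = Q + a := by
    calc (Q + a) * (2 * Q - 1) = 2 * (Q * Q) - Q + 2 * (a * Q) - a := by noncomm_ring
      _ = Q + a := by rw [hQ.isIdempotentElem.eq, haQ]; noncomm_ring
  rw [rangeProjection]
  set N := Q + a + star (Q + a) - 1
  calc (Q + a) * Ring.inverse N - Q
      = (Q + a) * ((N - (a + star a)) * Ring.inverse N) - Q := by
        rw [N_eq, add_sub_cancel_right, ← mul_assoc (Q + a), mul_reflection]
    _ = a - (Q + a) * ((a + star a) * Ring.inverse N) := by
        rw [sub_mul, Ring.mul_inverse_cancel _ hN]; noncomm_ring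

end RangeProjection

end ObliqueProjection

section ProjectionOperators

variable {𝕜 H : Type*} [RCLike 𝕜] [NormedAddCommGroup H] [InnerProductSpace 𝕜 H] [CompleteSpace H]
  {P Q T : H →L[𝕜] H}

lemma mem_orthogonal_range_iff_of_isSelfAdjoint (hQ : IsSelfAdjoint Q) {x : H} :
    x ∈ Q.rangeᗮ ↔ Q x = 0 := by
  rw [ContinuousLinearMap.orthogonal_range, hQ.adjoint_eq]
  rfl

lemma IsObliqueProjection.isCompl_range_orthogonal (h : IsObliqueProjection P Q T)
    (hP : IsIdempotentElem P) (hQ : IsSelfAdjoint Q) : IsCompl P.range Q.rangeᗮ := by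
  have P_apply (x : H) : P (T x) = T x := DFunLike.congr_fun h.left_mul x
  have apply_P (x : H) : T (P x) = P x := DFunLike.congr_fun h.mul_left x
  have apply_Q (x : H) : T (Q x) = T x := DFunLike.congr_fun h.mul_right x
  have Q_apply (x : H) : Q (T x) = Q x := DFunLike.congr_fun h.right_mul x
  refine ⟨Submodule.disjoint_def.2 fun x hx hx' => ?_, Submodule.codisjoint_iff_exists_add_eq.2
    fun x => ⟨T x, x - T x, ⟨T x, P_apply x⟩, ?_, add_sub_cancel _ _⟩⟩
  · rw [mem_orthogonal_range_iff_of_isSelfAdjoint hQ] at hx'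
    rw [← apply_eq_self_of_mem_range hP hx, ← apply_P, apply_eq_self_of_mem_range hP hx, ← apply_Q,
      hx', map_zero]
  · rw [mem_orthogonal_range_iff_of_isSelfAdjoint hQ, map_sub, Q_apply, sub_self]

lemma isObliqueProjection_projectionL (hP : IsIdempotentElem P) (hQ : IsStarProjection Q)
    (h : Submodule.IsTopCompl P.range Q.rangeᗮ) :
    IsObliqueProjection P Q (P.range.projectionL Q.rangeᗮ h) := by
  have mem_orthogonal {x : H} := mem_orthogonal_range_iff_of_isSelfAdjoint (x := x) hQ.isSelfAdjoint
  refine ⟨?_, ?_, ?_, ?_⟩ <;> ext x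
  · exact apply_eq_self_of_mem_range hP (Submodule.projectionL_apply_mem h x)
  · exact Submodule.projectionL_apply_left h ⟨P x, x, rfl⟩
  · have sub_mem : x - Q x ∈ Q.rangeᗮ := by
      rw [mem_orthogonal, map_sub, sub_eq_zero]
      exact (apply_eq_self_of_mem_range hQ.isIdempotentElem ⟨x, rfl⟩).symm
    have map_sub_eq_zero := Submodule.projectionL_apply_right h ⟨_, sub_mem⟩
    rw [map_sub, sub_eq_zero] at map_sub_eq_zero
    exact map_sub_eq_zero.symm
  · have sub_mem : x - P.range.projectionL Q.rangeᗮ h x ∈ Q.rangeᗮ := by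
      have := Submodule.projectionL_eq_self_sub_projectionL h x
      exact this ▸ Submodule.projectionL_apply_mem h.symm x
    rw [mem_orthogonal, map_sub, sub_eq_zero] at sub_mem
    exact sub_mem.symm

lemma isCompl_range_orthogonal_iff_isUnit (hP : IsStarProjection P) (hQ : IsStarProjection Q) :
    IsCompl P.range Q.rangeᗮ ↔ IsUnit (projectionIntertwiner P Q) := by
  refine ⟨fun h => ?_, fun h => ?_⟩
  · have isClosed_range : IsClosed (P.range : Set H) :=
      ContinuousLinearMap.IsIdempotentElem.isClosed_range hP.isIdempotentElem
    exact (isObliqueProjection_projectionL hP.isIdempotentElem hQ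
      (Submodule.IsCompl.isTopCompl_of_isClosed h isClosed_range
        (Submodule.isClosed_orthogonal _))).isUnit hP hQ
  · exact (isObliqueProjection_of_isUnit hP.isIdempotentElem hQ.isIdempotentElem
      h).isCompl_range_orthogonal hP.isIdempotentElem hQ.isSelfAdjoint

end ProjectionOperators

/-! ### The manifold structure of the restricted Grassmannian -/

section SmoothAlgebra

variable {A E H' M X : Type*} [NormedAddCommGroup E] [NormedSpace ℝ E] [TopologicalSpace H']
  {I : ModelWithCorners ℝ E H'} [TopologicalSpace M] [ChartedSpace H' M] {s : Set M}
  [NormedAddCommGroup X] [NormedSpace ℝ X] {x : X} {n : WithTop ℕ∞}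

section Star

variable [NormedAddCommGroup A] [NormedSpace ℝ A] [StarAddMonoid A] [StarModule ℝ A]
  [ContinuousStar A]

lemma contDiffAt_star {f : X → A} (hf : ContDiffAt ℝ n f x) :
    ContDiffAt ℝ n (fun y => star (f y)) x :=
  (starL' ℝ : A ≃L[ℝ] A).contDiff.contDiffAt.comp x hf

lemma contMDiffOn_star {f : M → A} (hf : ContMDiffOn I 𝓘(ℝ, A) n f s) :
    ContMDiffOn I 𝓘(ℝ, A) n (fun x => star (f x)) s :=
  (starL' ℝ : A ≃L[ℝ] A).contDiff.contMDiff.comp_contMDiffOn hf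

end Star

variable [NormedRing A] [NormedAlgebra ℝ A]

lemma contMDiffOn_mul {f g : M → A} (hf : ContMDiffOn I 𝓘(ℝ, A) n f s)
    (hg : ContMDiffOn I 𝓘(ℝ, A) n g s) : ContMDiffOn I 𝓘(ℝ, A) n (fun x => f x * g x) s :=
  ContMDiff.comp_contMDiffOn (g := fun x : A × A => x.1 * x.2)
    (contDiff_fst.mul contDiff_snd).contMDiff (hf.prodMk_space hg)

variable [HasSummableGeomSeries A]

lemma contDiffAt_ringInverse_comp {f : X → A} (hf : ContDiffAt ℝ n f x) (h : IsUnit (f x)) :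
    ContDiffAt ℝ n (fun y => Ring.inverse (f y)) x := by
  obtain ⟨u, hu⟩ := h
  exact ContDiffAt.comp x (hu ▸ contDiffAt_ringInverse ℝ u) hf

lemma contMDiffOn_ringInverse {f : M → A} (hf : ContMDiffOn I 𝓘(ℝ, A) n f s)
    (h : ∀ x ∈ s, IsUnit (f x)) : ContMDiffOn I 𝓘(ℝ, A) n (fun x => Ring.inverse (f x)) s :=
  fun x hx =>
    (contDiffAt_ringInverse_comp contDiffAt_id (h x hx)).comp_contMDiffWithinAt (hf x hx)

end SmoothAlgebra

section SchattenSmooth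

variable {p : ℝ} [Fact (p = 0 ∨ 1 < p)] {D E F G X : Type*}
  [NormedAddCommGroup D] [InnerProductSpace ℂ D] [NormedAddCommGroup E] [InnerProductSpace ℂ E]
  [NormedAddCommGroup F] [InnerProductSpace ℂ F] [NormedAddCommGroup G] [InnerProductSpace ℂ G]
  [NormedAddCommGroup X] [NormedSpace ℝ X] {n : WithTop ℕ∞} {x : X}

lemma contDiffAt_schattenToCLM {T : X → SchattenClass p E F}
    (hT : ContDiffAt ℝ n T x) : ContDiffAt ℝ n (fun y => (T y).toCLM) x :=
  ((SchattenClass.toCLML p E F).contDiff.restrict_scalars ℝ).contDiffAt.comp x hT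

variable [CompleteSpace D] [CompleteSpace E] [CompleteSpace F] [CompleteSpace G]

lemma contDiffAt_schattenCompL {f : X → F →L[ℂ] G} {T : X → SchattenClass p E F}
    (hf : ContDiffAt ℝ n f x) (hT : ContDiffAt ℝ n T x) :
    ContDiffAt ℝ n (fun y => SchattenClass.compL p E F G (f y) (T y)) x :=
  ((SchattenClass.compL p E F G).isBoundedBilinearMap.contDiff.restrict_scalars
    ℝ).contDiffAt.comp x (hf.prodMk hT)

lemma contDiffAt_schattenCompR {f : X → D →L[ℂ] E} {T : X → SchattenClass p E F}
    (hf : ContDiffAt ℝ n f x) (hT : ContDiffAt ℝ n T x) :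
    ContDiffAt ℝ n (fun y => SchattenClass.compR p D E F (f y) (T y)) x :=
  ((SchattenClass.compR p D E F).isBoundedBilinearMap.contDiff.restrict_scalars
    ℝ).contDiffAt.comp x (hf.prodMk hT)

lemma contDiffAt_schattenAdjoint {T : X → SchattenClass p E F}
    (hT : ContDiffAt ℝ n T x) : ContDiffAt ℝ n (fun y => SchattenClass.adjointL p E F (T y)) x :=
  (SchattenClass.adjointL p E F).contDiff.contDiffAt.comp x hT

/-- Conjugation by unitary operators identifies the Schatten classes of isometric spaces. -/
def SchattenClass.congr (f : D ≃ₗᵢ[ℂ] E) (g : F ≃ₗᵢ[ℂ] G) :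
    SchattenClass p D F ≃L[ℝ] SchattenClass p E G :=
  let forward : SchattenClass p D F →L[ℂ] SchattenClass p E G :=
    (SchattenClass.compL p E F G (g : F →L[ℂ] G)).comp
      (SchattenClass.compR p E D F (f.symm : E →L[ℂ] D))
  let backward : SchattenClass p E G →L[ℂ] SchattenClass p D F :=
    (SchattenClass.compL p D G F (g.symm : G →L[ℂ] F)).comp
      (SchattenClass.compR p D E G (f : D →L[ℂ] E))
  have left_inv : Function.LeftInverse backward forward := fun T =>
    SchattenClass.toCLM_injective <| by
      ext x
      change g.symm (g (T.toCLM (f.symm (f x)))) = T.toCLM x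
      simp
  have right_inv : Function.RightInverse backward forward := fun T =>
    SchattenClass.toCLM_injective <| by
      ext x
      change g (g.symm (T.toCLM (f (f.symm x)))) = T.toCLM x
      simp
  ContinuousLinearEquiv.equivOfInverse (forward.restrictScalars ℝ) (backward.restrictScalars ℝ)
    left_inv right_inv

end SchattenSmooth

namespace RestrictedGrassmannian

variable {p : ℝ} {H : Type*} [NormedAddCommGroup H]
  [InnerProductSpace ℂ H] [CompleteSpace H] {Hp : Submodule ℂ H} [CompleteSpace Hp]

lemma isStarProjection (W : RestrictedGrassmannian p Hp) : IsStarProjection W.proj :=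
  W.isRestricted.isStarProjection

instance (W : RestrictedGrassmannian p Hp) : CompleteSpace W.space :=
  completeSpace_range_of_isStarProjection W.isStarProjection

lemma starProjection_space (W : RestrictedGrassmannian p Hp) : W.space.starProjection = W.proj :=
  have : CompleteSpace W.proj.range := completeSpace_range_of_isStarProjection W.isStarProjection
  starProjection_range_eq_self W.isStarProjection

lemma starProjection_orthogonal_space (W : RestrictedGrassmannian p Hp) :
    W.spaceᗮ.starProjection = 1 - W.proj := by
  rw [Submodule.starProjection_orthogonal', W.starProjection_space]

lemma proj_eq_self (W : RestrictedGrassmannian p Hp) {x : H} (hx : x ∈ W.space) : W.proj x = x :=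
  apply_eq_self_of_mem_range W.isStarProjection.isIdempotentElem hx

lemma mem_orthogonal_iff (W : RestrictedGrassmannian p Hp) {x : H} :
    x ∈ W.spaceᗮ ↔ W.proj x = 0 :=
  mem_orthogonal_range_iff_of_isSelfAdjoint W.isStarProjection.isSelfAdjoint

lemma orthogonal_space (W : RestrictedGrassmannian p Hp) : W.spaceᗮ = (1 - W.proj).range := by
  ext x
  rw [mem_orthogonal_iff]
  refine ⟨fun hx => ⟨x, by simp [hx]⟩, ?_⟩
  rintro ⟨y, rfl⟩
  exact DFunLike.congr_fun W.isStarProjection.isIdempotentElem.mul_one_sub_self y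

lemma self_mem_grassmannianChartDomain (W : RestrictedGrassmannian p Hp) :
    W ∈ grassmannianChartDomain W :=
  Submodule.isCompl_orthogonal W.space

lemma mem_grassmannianChartDomain_iff (W V : RestrictedGrassmannian p Hp) :
    V ∈ grassmannianChartDomain W ↔ IsUnit (projectionIntertwiner V.proj W.proj) :=
  isCompl_range_orthogonal_iff_isUnit V.isStarProjection W.isStarProjection

lemma isObliqueProjection_of_mem_grassmannianChartDomain {V W : RestrictedGrassmannian p Hp}
    (hV : V ∈ grassmannianChartDomain W) : IsObliqueProjection V.proj W.proj
      (Ring.inverse (projectionIntertwiner V.proj W.proj) * W.proj) :=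
  isObliqueProjection_of_isUnit V.isStarProjection.isIdempotentElem
    W.isStarProjection.isIdempotentElem ((W.mem_grassmannianChartDomain_iff V).1 hV)

variable [Fact (p = 0 ∨ 1 < p)]

/-- The difference `P_V - P₊`, as an operator of class `L^p`. -/
def diff (V : RestrictedGrassmannian p Hp) : SchattenClass p H H :=
  SchattenClass.mk (V.proj - Hp.starProjection) V.isRestricted.isSchatten_sub

lemma toCLM_diff (V : RestrictedGrassmannian p Hp) :
    V.diff.toCLM = V.proj - Hp.starProjection := rfl

lemma toCLM_diff_sub_diff (V W : RestrictedGrassmannian p Hp) :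
    (V.diff - W.diff).toCLM = V.proj - W.proj := by
  rw [SchattenClass.toCLM_sub, toCLM_diff, toCLM_diff]
  abel

lemma diff_injective : Function.Injective (diff : RestrictedGrassmannian p Hp → _) := by
  intro V W h
  have toCLM_eq := congrArg SchattenClass.toCLM h
  rw [toCLM_diff, toCLM_diff] at toCLM_eq
  exact RestrictedGrassmannian.ext (sub_left_injective toCLM_eq)

instance : TopologicalSpace (RestrictedGrassmannian p Hp) :=
  TopologicalSpace.induced diff inferInstance

lemma isInducing_diff : Topology.IsInducing (diff : RestrictedGrassmannian p Hp → _) := ⟨rfl⟩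

instance : T2Space (RestrictedGrassmannian p Hp) :=
  T2Space.of_injective_continuous diff_injective isInducing_diff.continuous

/-- The extension of the operator intertwining `P_V` and `P_W` to a function of `P_V - P₊`. -/
def intertwiner (W : RestrictedGrassmannian p Hp) (K : SchattenClass p H H) : H →L[ℂ] H :=
  1 - (1 - 2 * W.proj) * (K - W.diff).toCLM

lemma intertwiner_diff (W V : RestrictedGrassmannian p Hp) :
    W.intertwiner V.diff = projectionIntertwiner V.proj W.proj := by
  rw [projectionIntertwiner_eq W.isStarProjection.isIdempotentElem, intertwiner,
    toCLM_diff_sub_diff]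

/-- The extension of the chart around `W` to a function of `P_V - P₊`: if `X` is the intertwiner,
then `X⁻¹ - 1 = X⁻¹ (1 - 2 P_W) (P_V - P_W)` compresses to `φ_W(V)`. -/
def graphCoordinate (W : RestrictedGrassmannian p Hp) (K : SchattenClass p H H) :
    SchattenClass p W.space W.spaceᗮ :=
  SchattenClass.compR p W.space H W.spaceᗮ W.space.subtypeL (SchattenClass.compL p H H W.spaceᗮ
    (W.spaceᗮ.orthogonalProjectionOnto ∘L (Ring.inverse (W.intertwiner K) * (1 - 2 * W.proj)))
    (K - W.diff))

/-- An operator `W → Wᗮ` as an operator on `H`. -/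
def extend (W : RestrictedGrassmannian p Hp) (A : SchattenClass p W.space W.spaceᗮ) :
    SchattenClass p H H :=
  SchattenClass.compR p H W.space H W.space.orthogonalProjectionOnto
    (SchattenClass.compL p W.space W.spaceᗮ H W.spaceᗮ.subtypeL A)

lemma toCLM_extend_apply (W : RestrictedGrassmannian p Hp) (A : SchattenClass p W.space W.spaceᗮ)
    (x : H) : (W.extend A).toCLM x = A.toCLM ⟨W.proj x, W.proj_mem x⟩ := by
  have h : W.space.orthogonalProjectionOnto x = ⟨W.proj x, W.proj_mem x⟩ :=
    Subtype.ext (congrArg (fun T : H →L[ℂ] H => T x) W.starProjection_space)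
  rw [← h]
  rfl

lemma extend_injective (W : RestrictedGrassmannian p Hp) : Function.Injective W.extend := by
  refine fun A B h =>
    SchattenClass.toCLM_injective (ContinuousLinearMap.ext fun w => Subtype.ext ?_)
  have extend_coe (C : SchattenClass p W.space W.spaceᗮ) :
      (W.extend C).toCLM w = C.toCLM w := by
    rw [toCLM_extend_apply]
    exact congrArg (fun v : W.space => (C.toCLM v : H)) (Subtype.ext (W.proj_eq_self w.2))
  rw [← extend_coe, ← extend_coe, h]

lemma proj_mul_extend (W : RestrictedGrassmannian p Hp) (A : SchattenClass p W.space W.spaceᗮ) :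
    W.proj * (W.extend A).toCLM = 0 := by
  ext x
  change W.proj ((W.extend A).toCLM x) = 0
  rw [toCLM_extend_apply]
  exact W.mem_orthogonal_iff.1 (Subtype.property _)

lemma extend_mul_proj (W : RestrictedGrassmannian p Hp) (A : SchattenClass p W.space W.spaceᗮ) :
    (W.extend A).toCLM * W.proj = (W.extend A).toCLM := by
  ext x
  change (W.extend A).toCLM (W.proj x) = _
  rw [toCLM_extend_apply, toCLM_extend_apply]
  simp only [W.proj_eq_self (W.proj_mem x)]

lemma isIdempotentElem_proj_add_extend (W : RestrictedGrassmannian p Hp)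
    (A : SchattenClass p W.space W.spaceᗮ) : IsIdempotentElem (W.proj + (W.extend A).toCLM) :=
  isIdempotentElem_add W.isStarProjection.isIdempotentElem (W.proj_mul_extend A)
    (W.extend_mul_proj A)

/-- `P_V - P_W` for the graph `V` of `A : W → Wᗮ`, which is the range of the idempotent `P_W + A`;
its coordinates are those of `rangeProjection_add_sub`. -/
def graphDiff (W : RestrictedGrassmannian p Hp) (A : SchattenClass p W.space W.spaceᗮ) :
    SchattenClass p H H :=
  let T := W.proj + (W.extend A).toCLM
  W.extend A - SchattenClass.compL p H H H T (SchattenClass.compR p H H H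
    (Ring.inverse (T + star T - 1)) (W.extend A + SchattenClass.adjointL p H H (W.extend A)))

lemma toCLM_graphDiff (W : RestrictedGrassmannian p Hp) (A : SchattenClass p W.space W.spaceᗮ) :
    (W.graphDiff A).toCLM = rangeProjection (W.proj + (W.extend A).toCLM) - W.proj := by
  rw [rangeProjection_add_sub W.isStarProjection (W.proj_mul_extend A) (W.extend_mul_proj A)]
  rfl

/-- The graph of `A : W → Wᗮ`. -/
def ofGraph (W : RestrictedGrassmannian p Hp) (A : SchattenClass p W.space W.spaceᗮ) :
    RestrictedGrassmannian p Hp where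
  proj := rangeProjection (W.proj + (W.extend A).toCLM)
  isRestricted := by
    refine isRestrictedProjector_of_isSchatten_sub
      (isStarProjection_rangeProjection (W.isIdempotentElem_proj_add_extend A)) ?_
    have h := (W.graphDiff A + W.diff).isSchatten
    rwa [SchattenClass.toCLM_add, toCLM_graphDiff, toCLM_diff, sub_add_sub_cancel] at h

lemma diff_ofGraph (W : RestrictedGrassmannian p Hp) (A : SchattenClass p W.space W.spaceᗮ) :
    (W.ofGraph A).diff = W.graphDiff A + W.diff := by
  refine SchattenClass.toCLM_injective ?_
  rw [SchattenClass.toCLM_add, toCLM_graphDiff, toCLM_diff, toCLM_diff, sub_add_sub_cancel]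
  rfl

lemma isObliqueProjection_ofGraph (W : RestrictedGrassmannian p Hp)
    (A : SchattenClass p W.space W.spaceᗮ) :
    IsObliqueProjection (W.ofGraph A).proj W.proj (W.proj + (W.extend A).toCLM) :=
  isObliqueProjection_rangeProjection_add W.isStarProjection.isIdempotentElem (W.proj_mul_extend A)
    (W.extend_mul_proj A)

lemma proj_add_extend_graphCoordinate {V W : RestrictedGrassmannian p Hp}
    (hV : V ∈ grassmannianChartDomain W) :
    W.proj + (W.extend (W.graphCoordinate V.diff)).toCLM =
      Ring.inverse (projectionIntertwiner V.proj W.proj) * W.proj := by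
  set X := projectionIntertwiner V.proj W.proj with hX
  have one_sub_X : (1 - 2 * W.proj) * (V.diff - W.diff).toCLM = 1 - X := by
    rw [hX, ← intertwiner_diff, intertwiner, sub_sub_cancel]
  have inverse_mul_one_sub : Ring.inverse X * (1 - X) = Ring.inverse X - 1 := by
    rw [mul_sub, mul_one, Ring.inverse_mul_cancel _ ((W.mem_grassmannianChartDomain_iff V).1 hV)]
  have QQ : W.proj * W.proj = W.proj := W.isStarProjection.isIdempotentElem.eq
  have Q_inverse_Q : W.proj * (Ring.inverse X * W.proj) = W.proj :=
    (isObliqueProjection_of_mem_grassmannianChartDomain hV).right_mul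
  calc W.proj + (W.extend (W.graphCoordinate V.diff)).toCLM
      = W.proj + W.spaceᗮ.starProjection * (Ring.inverse (W.intertwiner V.diff) *
          ((1 - 2 * W.proj) * (V.diff - W.diff).toCLM)) * W.space.starProjection := rfl
    _ = W.proj + (1 - W.proj) * (Ring.inverse X - 1) * W.proj := by
        rw [starProjection_orthogonal_space, starProjection_space, intertwiner_diff, one_sub_X,
          inverse_mul_one_sub]
    _ = Ring.inverse X * W.proj + W.proj * W.proj - W.proj * (Ring.inverse X * W.proj) := by
        noncomm_ring
    _ = Ring.inverse X * W.proj := by rw [QQ, Q_inverse_Q, add_sub_cancel_right]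

lemma isObliqueProjection_graphCoordinate {V W : RestrictedGrassmannian p Hp}
    (hV : V ∈ grassmannianChartDomain W) : IsObliqueProjection V.proj W.proj
      (W.proj + (W.extend (W.graphCoordinate V.diff)).toCLM) := by
  rw [proj_add_extend_graphCoordinate hV]
  exact isObliqueProjection_of_mem_grassmannianChartDomain hV

lemma ofGraph_graphCoordinate {V W : RestrictedGrassmannian p Hp}
    (hV : V ∈ grassmannianChartDomain W) : W.ofGraph (W.graphCoordinate V.diff) = V :=
  RestrictedGrassmannian.ext ((W.isObliqueProjection_ofGraph _).unique
    (isObliqueProjection_graphCoordinate hV) (W.ofGraph _).isStarProjection.isSelfAdjoint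
    V.isStarProjection.isSelfAdjoint)

lemma ofGraph_mem_grassmannianChartDomain (W : RestrictedGrassmannian p Hp)
    (A : SchattenClass p W.space W.spaceᗮ) : W.ofGraph A ∈ grassmannianChartDomain W :=
  (W.mem_grassmannianChartDomain_iff _).2
    ((W.isObliqueProjection_ofGraph A).isUnit (W.ofGraph A).isStarProjection W.isStarProjection)

lemma graphCoordinate_ofGraph (W : RestrictedGrassmannian p Hp)
    (A : SchattenClass p W.space W.spaceᗮ) : W.graphCoordinate (W.ofGraph A).diff = A := by
  refine W.extend_injective (SchattenClass.toCLM_injective (add_left_cancel (a := W.proj) ?_))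
  rw [proj_add_extend_graphCoordinate (W.ofGraph_mem_grassmannianChartDomain A),
    (W.isObliqueProjection_ofGraph A).inverse_mul (W.ofGraph A).isStarProjection W.isStarProjection]

lemma isGrassmannianCoordinate_graphCoordinate {V W : RestrictedGrassmannian p Hp}
    (hV : V ∈ grassmannianChartDomain W) :
    IsGrassmannianCoordinate W V (W.graphCoordinate V.diff) := by
  intro x hx
  have sum_eq : W.proj (V.proj x) + (W.extend (W.graphCoordinate V.diff)).toCLM (V.proj x) =
      V.proj x := DFunLike.congr_fun (isObliqueProjection_graphCoordinate hV).mul_left x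
  rw [V.proj_eq_self hx, toCLM_extend_apply] at sum_eq
  exact eq_sub_of_add_eq' sum_eq

lemma contDiff_intertwiner (W : RestrictedGrassmannian p Hp) {n : WithTop ℕ∞} :
    ContDiff ℝ n W.intertwiner :=
  contDiff_iff_contDiffAt.2 fun _ => contDiffAt_const.sub (contDiffAt_const.mul
    (contDiffAt_schattenToCLM (contDiffAt_id.sub contDiffAt_const)))

lemma contDiffAt_graphCoordinate (W : RestrictedGrassmannian p Hp) {n : WithTop ℕ∞}
    {K : SchattenClass p H H} (hK : IsUnit (W.intertwiner K)) :
    ContDiffAt ℝ n W.graphCoordinate K := by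
  have factor : ContDiffAt ℝ n (fun K => Ring.inverse (W.intertwiner K) * (1 - 2 * W.proj)) K :=
    (contDiffAt_ringInverse_comp W.contDiff_intertwiner.contDiffAt hK).mul contDiffAt_const
  exact contDiffAt_schattenCompR contDiffAt_const (contDiffAt_schattenCompL
    (((ContinuousLinearMap.compL ℂ H H W.spaceᗮ
      W.spaceᗮ.orthogonalProjectionOnto).contDiff.restrict_scalars ℝ).contDiffAt.comp K factor)
    (contDiffAt_id.sub contDiffAt_const))

lemma contDiff_graphDiff (W : RestrictedGrassmannian p Hp) {n : WithTop ℕ∞} :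
    ContDiff ℝ n W.graphDiff := by
  refine contDiff_iff_contDiffAt.2 fun A => ?_
  have extend : ContDiffAt ℝ n W.extend A := contDiffAt_schattenCompR contDiffAt_const
    (contDiffAt_schattenCompL contDiffAt_const contDiffAt_id)
  have idempotent : ContDiffAt ℝ n (fun A => W.proj + (W.extend A).toCLM) A :=
    contDiffAt_const.add (contDiffAt_schattenToCLM extend)
  have inverse := contDiffAt_ringInverse_comp
    ((idempotent.add (contDiffAt_star idempotent)).sub contDiffAt_const)
    (isUnit_add_star_sub_one (W.isIdempotentElem_proj_add_extend A))
  exact extend.sub (contDiffAt_schattenCompL idempotent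
    (contDiffAt_schattenCompR inverse (extend.add (contDiffAt_schattenAdjoint extend))))

/-- The chart around `W` as a bijection. -/
def graphPartialEquiv (W : RestrictedGrassmannian p Hp) :
    PartialEquiv (RestrictedGrassmannian p Hp) (SchattenClass p W.space W.spaceᗮ) where
  toFun V := W.graphCoordinate V.diff
  invFun := W.ofGraph
  source := grassmannianChartDomain W
  target := Set.univ
  map_source' _ _ := Set.mem_univ _
  map_target' A _ := W.ofGraph_mem_grassmannianChartDomain A
  left_inv' _ hV := ofGraph_graphCoordinate hV
  right_inv' A _ := W.graphCoordinate_ofGraph A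

lemma exists_graphChart (W : RestrictedGrassmannian p Hp) :
    ∃ φ : OpenPartialHomeomorph (RestrictedGrassmannian p Hp) (SchattenClass p W.space W.spaceᗮ),
      φ.toPartialEquiv = W.graphPartialEquiv ∧
      IsAdaptedChart 𝓘(ℝ, SchattenClass p H H) diff φ := by
  refine exists_isAdaptedChart isInducing_diff W.graphPartialEquiv isOpen_univ ?_
    (O := {K | IsUnit (W.intertwiner K)}) (f := W.graphCoordinate)
    (Units.isOpen.preimage (W.contDiff_intertwiner (n := 0)).continuous) ?_ ?_ fun _ _ => rfl
  · have diff_comp_symm : diff ∘ W.graphPartialEquiv.symm = fun A => W.graphDiff A + W.diff :=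
      funext W.diff_ofGraph
    rw [contMDiffOn_iff_contDiffOn, diff_comp_symm]
    exact (W.contDiff_graphDiff.add contDiff_const).contDiffOn
  · rw [contMDiffOn_iff_contDiffOn]
    exact fun K hK => (W.contDiffAt_graphCoordinate hK).contDiffWithinAt
  · ext V
    rw [Set.mem_preimage, Set.mem_ofPred_eq, intertwiner_diff]
    exact W.mem_grassmannianChartDomain_iff V

/-- The chart around `W`. -/
def graphChart (W : RestrictedGrassmannian p Hp) :
    OpenPartialHomeomorph (RestrictedGrassmannian p Hp) (SchattenClass p W.space W.spaceᗮ) :=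
  W.exists_graphChart.choose

lemma isAdaptedChart_graphChart (W : RestrictedGrassmannian p Hp) :
    IsAdaptedChart 𝓘(ℝ, SchattenClass p H H) diff W.graphChart :=
  W.exists_graphChart.choose_spec.2

lemma graphChart_source (W : RestrictedGrassmannian p Hp) :
    W.graphChart.source = grassmannianChartDomain W :=
  congrArg PartialEquiv.source W.exists_graphChart.choose_spec.1

lemma graphChart_target (W : RestrictedGrassmannian p Hp) : W.graphChart.target = Set.univ :=
  congrArg PartialEquiv.target W.exists_graphChart.choose_spec.1

lemma graphChart_apply (W V : RestrictedGrassmannian p Hp) :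
    W.graphChart V = W.graphCoordinate V.diff :=
  congrArg (fun e : PartialEquiv _ _ => e V) W.exists_graphChart.choose_spec.1

lemma isGrassmannianCoordinate_graphChart {V W : RestrictedGrassmannian p Hp}
    (hV : V ∈ grassmannianChartDomain W) : IsGrassmannianCoordinate W V (W.graphChart V) :=
  graphChart_apply W V ▸ isGrassmannianCoordinate_graphCoordinate hV

lemma graphChart_symm_graphChart {V W : RestrictedGrassmannian p Hp}
    (hV : V ∈ grassmannianChartDomain W) : W.graphChart.symm (W.graphChart V) = V :=
  W.graphChart.left_inv (W.graphChart_source.symm ▸ hV)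

lemma graphChart_graphChart_symm {W : RestrictedGrassmannian p Hp}
    (A : SchattenClass p W.space W.spaceᗮ) : W.graphChart (W.graphChart.symm A) = A :=
  W.graphChart.right_inv (W.graphChart_target.symm ▸ Set.mem_univ A)

variable [Fact (¬ FiniteDimensional ℂ Hp)] [Fact (¬ FiniteDimensional ℂ Hpᗮ)]

lemma nonempty_schattenClass_equiv (W : RestrictedGrassmannian p Hp) :
    Nonempty (SchattenClass p W.space W.spaceᗮ ≃L[ℝ] SchattenClass p Hp Hpᗮ) := by
  obtain ⟨f⟩ : Nonempty (W.space ≃ₗᵢ[ℂ] Hp) := by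
    have := completeSpace_range_of_isStarProjection W.isStarProjection
    exact nonempty_linearIsometryEquiv_of_isFredholm W.isRestricted.fredholm Fact.out
  obtain ⟨g⟩ : Nonempty (W.spaceᗮ ≃ₗᵢ[ℂ] Hpᗮ) := by
    rw [orthogonal_space]
    have := completeSpace_range_of_isStarProjection W.isStarProjection.one_sub
    exact nonempty_linearIsometryEquiv_of_isFredholm W.isRestricted.one_sub.fredholm Fact.out
  exact ⟨SchattenClass.congr f g⟩

/-- An identification of the model spaces of the charts. -/
def schattenClassEquiv (W : RestrictedGrassmannian p Hp) :
    SchattenClass p W.space W.spaceᗮ ≃L[ℝ] SchattenClass p Hp Hpᗮ :=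
  W.nonempty_schattenClass_equiv.some

instance : ChartedSpace (SchattenClass p Hp Hpᗮ) (RestrictedGrassmannian p Hp) where
  atlas := Set.range fun W : RestrictedGrassmannian p Hp =>
    W.graphChart.transHomeomorph W.schattenClassEquiv.toHomeomorph
  chartAt W := W.graphChart.transHomeomorph W.schattenClassEquiv.toHomeomorph
  mem_chart_source W := by
    change W ∈ W.graphChart.source
    rw [graphChart_source]
    exact W.self_mem_grassmannianChartDomain
  chart_mem_atlas W := ⟨W, rfl⟩

lemma isAdaptedChart_of_mem_atlas :
    ∀ φ ∈ atlas (SchattenClass p Hp Hpᗮ) (RestrictedGrassmannian p Hp),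
      IsAdaptedChart 𝓘(ℝ, SchattenClass p H H) diff φ := by
  rintro _ ⟨W, rfl⟩
  exact W.isAdaptedChart_graphChart.transHomeomorph W.schattenClassEquiv

instance : IsManifold 𝓘(ℝ, SchattenClass p Hp Hpᗮ) ∞ (RestrictedGrassmannian p Hp) :=
  isManifold_of_isAdaptedChart isAdaptedChart_of_mem_atlas

lemma contMDiff_diff : ContMDiff 𝓘(ℝ, SchattenClass p Hp Hpᗮ) 𝓘(ℝ, SchattenClass p H H) ∞
    (diff : RestrictedGrassmannian p Hp → SchattenClass p H H) :=
  contMDiff_of_isAdaptedChart isAdaptedChart_of_mem_atlas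

lemma isSmoothChart_graphChart (W : RestrictedGrassmannian p Hp) :
    IsSmoothChart (E := SchattenClass p Hp Hpᗮ) W.graphChart :=
  W.isAdaptedChart_graphChart.isSmoothChart isInducing_diff isAdaptedChart_of_mem_atlas

lemma contMDiffOn_graphChart (W : RestrictedGrassmannian p Hp) :
    ContMDiffOn 𝓘(ℝ, SchattenClass p Hp Hpᗮ) 𝓘(ℝ, SchattenClass p W.space W.spaceᗮ) ∞
      W.graphChart (grassmannianChartDomain W) :=
  W.graphChart_source ▸ W.isSmoothChart_graphChart.1

lemma contMDiff_graphChart_symm (W : RestrictedGrassmannian p Hp) :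
    ContMDiff 𝓘(ℝ, SchattenClass p W.space W.spaceᗮ) 𝓘(ℝ, SchattenClass p Hp Hpᗮ) ∞
      W.graphChart.symm :=
  contMDiffOn_univ.1 (W.graphChart_target ▸ W.isSmoothChart_graphChart.2)

lemma contMDiff_proj : ContMDiff 𝓘(ℝ, SchattenClass p Hp Hpᗮ) 𝓘(ℝ, H →L[ℂ] H) ∞
    (proj : RestrictedGrassmannian p Hp → H →L[ℂ] H) := by
  have proj_eq : (proj : RestrictedGrassmannian p Hp → H →L[ℂ] H) =
      (fun K : SchattenClass p H H => K.toCLM + Hp.starProjection) ∘ diff :=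
    funext fun V => (sub_add_cancel V.proj Hp.starProjection).symm
  have smooth : ContDiff ℝ ∞ fun K : SchattenClass p H H => K.toCLM + Hp.starProjection :=
    contDiff_iff_contDiffAt.2 fun K =>
      (contDiffAt_schattenToCLM contDiffAt_id).add contDiffAt_const
  rw [proj_eq]
  exact smooth.contMDiff.comp contMDiff_diff

end RestrictedGrassmannian

/-! ### Smooth local cross sections -/

section SquareRoot

open Filter Topology

lemma exists_smooth_sqrt (A : Type*) [NormedRing A] [NormedAlgebra ℝ A] [CompleteSpace A] :
    ∃ r : A → A, r 1 = 1 ∧ (∀ᶠ b in 𝓝 1, ContDiffAt ℝ ∞ r b) ∧ (∀ᶠ b in 𝓝 1, r b * r b = b) ∧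
      ∀ᶠ x in 𝓝 1, r (x * x) = x := by
  have contDiff_sq : ContDiffAt ℝ ω (fun x : A => x * x) 1 := contDiffAt_id.mul contDiffAt_id
  let double : A ≃L[ℝ] A := ContinuousLinearEquiv.smulLeft (Units.mk0 (2 : ℝ) two_ne_zero)
  have hasFDerivAt_sq : HasFDerivAt (fun x : A => x * x) (double : A →L[ℝ] A) 1 := by
    refine ((hasFDerivAt_id (𝕜 := ℝ) (1 : A)).mul'
      (hasFDerivAt_id (𝕜 := ℝ) (1 : A))).congr_fderiv ?_
    ext y
    change (1 : A) * y + y * 1 = (2 : ℝ) • y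
    rw [one_mul, mul_one, two_smul]
  have omega_ne_zero : (ω : WithTop ℕ∞) ≠ 0 := by simp
  have hasStrictFDerivAt_sq := contDiff_sq.hasStrictFDerivAt' hasFDerivAt_sq omega_ne_zero
  refine ⟨contDiff_sq.localInverse hasFDerivAt_sq omega_ne_zero, ?_, ?_, ?_,
    hasStrictFDerivAt_sq.eventually_left_inverse⟩
  · simpa only [mul_one] using contDiff_sq.localInverse_apply_image hasFDerivAt_sq omega_ne_zero
  · have smooth := contDiff_sq.to_localInverse hasFDerivAt_sq omega_ne_zero
    rw [mul_one] at smooth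
    filter_upwards [smooth.eventually (by simp)] with b hb
    exact hb.of_le le_top
  · have right_inverse := hasStrictFDerivAt_sq.eventually_right_inverse
    rw [mul_one] at right_inverse
    exact right_inverse

/- Near `1` the square root is unique, so it is preserved by the involution and by conjugation by a
unitary. -/
lemma exists_smooth_sqrt_star {A : Type*} [CStarAlgebra A] {u : A} (hu : u ∈ unitary A) :
    ∃ (r : A → A) (N : Set A), IsOpen N ∧ 1 ∈ N ∧ ∀ b ∈ N,
      ContDiffAt ℝ ∞ r b ∧ IsUnit (r b) ∧ r b * r b = b ∧
        (IsSelfAdjoint b → IsSelfAdjoint (r b)) ∧ (Commute u b → Commute u (r b)) := by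
  obtain ⟨r, r_one, smooth, sq, unique⟩ := exists_smooth_sqrt A
  have tendsto_r : Tendsto r (𝓝 1) (𝓝 1) := by
    simpa only [r_one] using smooth.self_of_nhds.continuousAt.tendsto
  have tendsto_star : Tendsto (fun b => star (r b)) (𝓝 1) (𝓝 1) := by
    simpa only [star_one] using tendsto_r.star
  have tendsto_conj : Tendsto (fun b => u * r b * star u) (𝓝 1) (𝓝 1) := by
    simpa only [mul_one, Unitary.mul_star_self_of_mem hu] using
      (tendsto_r.const_mul u).mul_const (star u)
  have isUnit_nhds : ∀ᶠ x : A in 𝓝 1, IsUnit x := Units.isOpen.mem_nhds isUnit_one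
  obtain ⟨N, hN, isOpen_N, one_mem⟩ := eventually_nhds_iff.1
    (smooth.and ((tendsto_r.eventually isUnit_nhds).and (sq.and
      ((tendsto_star.eventually unique).and (tendsto_conj.eventually unique)))))
  refine ⟨r, N, isOpen_N, one_mem, fun b hb => ?_⟩
  obtain ⟨smooth_b, isUnit_b, sq_b, star_unique, conj_unique⟩ := hN b hb
  refine ⟨smooth_b, isUnit_b, sq_b, fun selfAdjoint => ?_, fun commute => ?_⟩
  · rw [← star_mul, sq_b, selfAdjoint.star_eq] at star_unique
    exact star_unique.symm
  · have conj_mul_conj : u * r b * star u * (u * r b * star u) = b := by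
      calc u * r b * star u * (u * r b * star u)
          = u * r b * (star u * u) * r b * star u := by simp only [mul_assoc]
        _ = u * (r b * r b) * star u := by
          rw [Unitary.star_mul_self_of_mem hu, mul_one, mul_assoc u]
        _ = b := by rw [sq_b, commute.eq, mul_assoc, Unitary.mul_star_self_of_mem hu, mul_one]
    rw [conj_mul_conj] at conj_unique
    calc u * r b = u * r b * star u * u := by
          rw [mul_assoc _ _ u, Unitary.star_mul_self_of_mem hu, mul_one]
      _ = r b * u := by rw [← conj_unique]

lemma commute_two_mul_sub_one_iff {A : Type*} [Ring A] [Algebra ℝ A] {Q b : A} :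
    Commute (2 * Q - 1) b ↔ Commute Q b := by
  have commute_two_mul_iff : Commute (2 * Q) b ↔ Commute Q b := by
    rw [two_mul, ← two_smul ℝ]
    exact Commute.smul_left_iff₀ two_ne_zero
  rw [← commute_two_mul_iff]
  refine ⟨fun h => ?_, fun h => h.sub_left (Commute.one_left b)⟩
  simpa only [sub_add_cancel] using h.add_left (Commute.one_left b)

end SquareRoot

section PolarDecomposition

lemma mul_ringInverse_mem_unitary {A : Type*} [Ring A] [StarRing A] {x r : A} (hx : IsUnit x)
    (hr : IsUnit r) (star_r : IsSelfAdjoint r) (sq : r * r = star x * x) :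
    x * Ring.inverse r ∈ unitary A := by
  refine (hx.mul hr.ringInverse).mem_unitary_of_star_mul_self ?_
  calc star (x * Ring.inverse r) * (x * Ring.inverse r)
      = Ring.inverse r * (star x * x) * Ring.inverse r := by
        rw [star_mul, ← Ring.inverse_star, star_r.star_eq]; simp only [mul_assoc]
    _ = (Ring.inverse r * r) * (r * Ring.inverse r) := by rw [← sq]; simp only [mul_assoc]
    _ = 1 := by rw [Ring.inverse_mul_cancel _ hr, Ring.mul_inverse_cancel _ hr, mul_one]

lemma commute_ringInverse_right {A : Type*} [MonoidWithZero A] {a r : A} (h : Commute a r)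
    (hr : IsUnit r) : Commute a (Ring.inverse r) := by
  obtain ⟨u, rfl⟩ := hr
  rw [Ring.inverse_unit]
  exact h.units_inv_right

lemma mul_ringInverse_mul_intertwines {A : Type*} [MonoidWithZero A] {P Q E x r u : A}
    (hx : x * Q = P * x) (hu : u * E = Q * u) (hr : Commute Q r) (isUnit_r : IsUnit r) :
    x * Ring.inverse r * u * E = P * (x * Ring.inverse r * u) :=
  calc x * Ring.inverse r * u * E
      = x * (Ring.inverse r * Q) * u := by simp only [mul_assoc, hu]
    _ = x * Q * Ring.inverse r * u := by
      rw [← (commute_ringInverse_right hr isUnit_r).eq, mul_assoc x Q]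
    _ = P * (x * Ring.inverse r * u) := by rw [hx]; simp only [mul_assoc]

variable {A : Type*} [Ring A] {P Q : A}

lemma projectionIntertwiner_self (hP : IsIdempotentElem P) : projectionIntertwiner P P = 1 := by
  rw [projectionIntertwiner_eq hP, sub_self, mul_zero, sub_zero]

lemma projectionIntertwiner_intertwines (hP : IsIdempotentElem P) (hQ : IsIdempotentElem Q) :
    projectionIntertwiner P Q * P = Q * projectionIntertwiner P Q :=
  (projectionIntertwiner_mul hP).trans (mul_projectionIntertwiner hQ).symm

lemma commute_projectionIntertwiner_mul (hP : IsIdempotentElem P) (hQ : IsIdempotentElem Q) :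
    Commute Q (projectionIntertwiner P Q * projectionIntertwiner Q P) :=
  calc Q * (projectionIntertwiner P Q * projectionIntertwiner Q P)
      = projectionIntertwiner P Q * (P * projectionIntertwiner Q P) := by
        rw [← mul_assoc, ← projectionIntertwiner_intertwines hP hQ, mul_assoc]
    _ = projectionIntertwiner P Q * projectionIntertwiner Q P * Q := by
        rw [← projectionIntertwiner_intertwines hQ hP, mul_assoc]

variable [StarRing A]

lemma star_projectionIntertwiner (hP : IsSelfAdjoint P) (hQ : IsSelfAdjoint Q) :
    star (projectionIntertwiner P Q) = projectionIntertwiner Q P := by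
  simp only [projectionIntertwiner, star_add, star_mul, star_sub, star_one, hP.star_eq, hQ.star_eq]

end PolarDecomposition

section CrossSection

variable {p : ℝ} {H : Type*} [NormedAddCommGroup H] [InnerProductSpace ℂ H] [CompleteSpace H]
  {Hp : Submodule ℂ H} [CompleteSpace Hp]

lemma map_eq_range_iff_of_mem_unitary {U P : H →L[ℂ] H} (hU : U ∈ unitary (H →L[ℂ] H))
    (hP : IsStarProjection P) :
    Hp.map (U : H →ₗ[ℂ] H) = P.range ↔ U * Hp.starProjection * star U = P := by
  have star_mul_self : star U * U = 1 := Unitary.star_mul_self_of_mem hU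
  have e_proj : IsStarProjection Hp.starProjection := isStarProjection_starProjection
  have isStarProjection_conj : IsStarProjection (U * Hp.starProjection * star U) := by
    refine ⟨?_, ?_⟩
    · calc U * Hp.starProjection * star U * (U * Hp.starProjection * star U)
          = U * Hp.starProjection * (star U * U) * Hp.starProjection * star U := by
            simp only [mul_assoc]
        _ = U * (Hp.starProjection * Hp.starProjection) * star U := by
            rw [star_mul_self, mul_one, mul_assoc U]
        _ = U * Hp.starProjection * star U := by rw [e_proj.isIdempotentElem.eq]
    · rw [IsSelfAdjoint, star_mul, star_mul, star_star, e_proj.isSelfAdjoint.star_eq, mul_assoc]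
  have range_conj : (U * Hp.starProjection * star U).range = Hp.map (U : H →ₗ[ℂ] H) := by
    ext x
    constructor
    · rintro ⟨y, rfl⟩
      exact ⟨Hp.starProjection (star U y), Submodule.starProjection_apply_mem _ _, rfl⟩
    · rintro ⟨y, hy, rfl⟩
      have star_U_U : star U (U y) = y := DFunLike.congr_fun star_mul_self y
      refine ⟨U y, ?_⟩
      change U (Hp.starProjection (star U (U y))) = U y
      rw [star_U_U, Submodule.starProjection_eq_self_iff.2 hy]
  rw [ContinuousLinearMap.IsStarProjection.ext_iff isStarProjection_conj hP, range_conj]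

variable [Fact (p = 0 ∨ 1 < p)]

lemma IsSmoothCrossSection.mul_starProjection_mul_star {E : Type*} [NormedAddCommGroup E]
    [NormedSpace ℝ E] [TopologicalSpace (RestrictedGrassmannian p Hp)]
    [ChartedSpace E (RestrictedGrassmannian p Hp)] {Ω : Set (RestrictedGrassmannian p Hp)}
    {σ : RestrictedGrassmannian p Hp → (H →L[ℂ] H)} (h : IsSmoothCrossSection (E := E) Ω σ)
    {V : RestrictedGrassmannian p Hp} (hV : V ∈ Ω) :
    σ V * Hp.starProjection * star (σ V) = V.proj :=
  (map_eq_range_iff_of_mem_unitary (h.mem_unitary V hV) V.isStarProjection).1 (h.map_eq V hV)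

namespace RestrictedGrassmannian

variable [Fact (¬ FiniteDimensional ℂ Hp)] [Fact (¬ FiniteDimensional ℂ Hpᗮ)]

lemma isSmoothCrossSection_of_mul_starProjection {Ω : Set (RestrictedGrassmannian p Hp)}
    {σ : RestrictedGrassmannian p Hp → (H →L[ℂ] H)} (isOpen : IsOpen Ω)
    (mem_unitary : ∀ V ∈ Ω, σ V ∈ unitary (H →L[ℂ] H))
    (mul_starProjection : ∀ V ∈ Ω, σ V * Hp.starProjection = V.proj * σ V)
    (smooth : ContMDiffOn 𝓘(ℝ, SchattenClass p Hp Hpᗮ) 𝓘(ℝ, H →L[ℂ] H) ∞ σ Ω) :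
    IsSmoothCrossSection (E := SchattenClass p Hp Hpᗮ) Ω σ where
  isOpen := isOpen
  mem_unitary := mem_unitary
  smooth := smooth
  map_eq V hV := by
    refine (map_eq_range_iff_of_mem_unitary (mem_unitary V hV) V.isStarProjection).2 ?_
    rw [mul_starProjection V hV, mul_assoc, Unitary.mul_star_self_of_mem (mem_unitary V hV),
      mul_one]
  smooth_commutator := by
    refine ⟨fun V => SchattenClass.compR p H H H (σ V) V.diff, fun V hV => ?_, ?_⟩
    · change (V.proj - Hp.starProjection) * σ V = _
      rw [mul_starProjection V hV, sub_mul]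
    · exact ContMDiff.comp_contMDiffOn
        (g := fun x : (H →L[ℂ] H) × SchattenClass p H H => SchattenClass.compR p H H H x.1 x.2)
        (contDiff_iff_contDiffAt.2 fun _ =>
          contDiffAt_schattenCompR contDiffAt_fst contDiffAt_snd).contMDiff
        (smooth.prodMk_space contMDiff_diff.contMDiffOn)

lemma contMDiff_projectionIntertwiner_left (Q : H →L[ℂ] H) :
    ContMDiff 𝓘(ℝ, SchattenClass p Hp Hpᗮ) 𝓘(ℝ, H →L[ℂ] H) ∞
      fun V : RestrictedGrassmannian p Hp => projectionIntertwiner V.proj Q := by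
  have smooth : ContDiff ℝ ∞ fun P : H →L[ℂ] H => projectionIntertwiner P Q :=
    (contDiff_const.mul contDiff_id).add (contDiff_const.mul (contDiff_const.sub contDiff_id))
  exact smooth.contMDiff.comp contMDiff_proj

lemma contMDiff_projectionIntertwiner_right (Q : H →L[ℂ] H) :
    ContMDiff 𝓘(ℝ, SchattenClass p Hp Hpᗮ) 𝓘(ℝ, H →L[ℂ] H) ∞
      fun V : RestrictedGrassmannian p Hp => projectionIntertwiner Q V.proj := by
  have smooth : ContDiff ℝ ∞ fun P : H →L[ℂ] H => projectionIntertwiner Q P :=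
    (contDiff_id.mul contDiff_const).add ((contDiff_const.sub contDiff_id).mul contDiff_const)
  exact smooth.contMDiff.comp contMDiff_proj

/- The section is `V ↦ X (X* X)^(-1/2) U`, where the intertwiner `X` maps `W` onto `V`, its unitary
polar part still does because `X* X` commutes with `P_W`, and the unitary `U` maps `H₊` onto `W`. -/
lemma exists_isSmoothCrossSection (W : RestrictedGrassmannian p Hp) :
    ∃ Ω σ, W ∈ Ω ∧ Ω ⊆ grassmannianChartDomain W ∧
      IsSmoothCrossSection (E := SchattenClass p Hp Hpᗮ) Ω σ := by
  obtain ⟨U, hU, U_conj⟩ := W.isRestricted.exists_unitary Fact.out Fact.out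
  obtain ⟨r, N, isOpen_N, one_mem_N, hr⟩ :=
    exists_smooth_sqrt_star W.isStarProjection.two_mul_sub_one_mem_unitary
  let X (V : RestrictedGrassmannian p Hp) := projectionIntertwiner W.proj V.proj
  let X' (V : RestrictedGrassmannian p Hp) := projectionIntertwiner V.proj W.proj
  have star_X (V) : star (X V) = X' V :=
    star_projectionIntertwiner W.isStarProjection.isSelfAdjoint V.isStarProjection.isSelfAdjoint
  have isIdempotentElem (V : RestrictedGrassmannian p Hp) := V.isStarProjection.isIdempotentElem
  have smooth_X := contMDiff_projectionIntertwiner_right (p := p) (Hp := Hp) W.proj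
  have smooth_X'_mul_X := contMDiffOn_univ.1 (contMDiffOn_mul
    (contMDiff_projectionIntertwiner_left W.proj).contMDiffOn smooth_X.contMDiffOn)
  let Ω := grassmannianChartDomain W ∩ {V | X' V * X V ∈ N}
  have isOpen_Ω : IsOpen Ω := by
    refine IsOpen.inter ?_ (isOpen_N.preimage smooth_X'_mul_X.continuous)
    exact W.graphChart_source ▸ W.graphChart.open_source
  have W_mem : W ∈ Ω := by
    refine ⟨W.self_mem_grassmannianChartDomain, ?_⟩
    change projectionIntertwiner W.proj W.proj * projectionIntertwiner W.proj W.proj ∈ N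
    rwa [projectionIntertwiner_self (isIdempotentElem W), mul_one]
  refine ⟨Ω, fun V => X V * Ring.inverse (r (X' V * X V)) * U, W_mem, Set.inter_subset_left,
    isSmoothCrossSection_of_mul_starProjection isOpen_Ω (fun V hV => ?_) (fun V hV => ?_) ?_⟩
  · obtain ⟨-, isUnit_r, sq, selfAdjoint, -⟩ := hr _ hV.2
    have isUnit_X : IsUnit (X V) := by
      rw [← isUnit_star, star_X]
      exact (W.mem_grassmannianChartDomain_iff V).1 hV.1
    rw [← star_X] at isUnit_r sq selfAdjoint ⊢
    exact mul_mem (mul_ringInverse_mem_unitary isUnit_X isUnit_r (selfAdjoint (.star_mul_self _))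
      sq) hU
  · obtain ⟨-, isUnit_r, -, -, commute⟩ := hr _ hV.2
    have commute_r := commute_two_mul_sub_one_iff.1 (commute (commute_two_mul_sub_one_iff.2
      (commute_projectionIntertwiner_mul (isIdempotentElem V) (isIdempotentElem W))))
    refine mul_ringInverse_mul_intertwines
      (projectionIntertwiner_intertwines (isIdempotentElem W) (isIdempotentElem V)) ?_
      commute_r isUnit_r
    rw [← U_conj, mul_assoc, Unitary.star_mul_self_of_mem hU, mul_one]
  · refine contMDiffOn_mul (contMDiffOn_mul smooth_X.contMDiffOn (contMDiffOn_ringInverse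
      (fun V hV => ?_) fun V hV => (hr _ hV.2).2.1)) contMDiffOn_const
    exact (hr _ hV.2).1.contMDiffAt.comp_contMDiffWithinAt V (smooth_X'_mul_X.contMDiffOn V hV)

end RestrictedGrassmannian

end CrossSection

/-! ### Skew-adjoint operators and the Cayley transform -/

section SkewAdjoint

lemma isClosed_skewAdjoint {A : Type*} [AddCommGroup A] [StarAddMonoid A] [TopologicalSpace A]
    [ContinuousNeg A] [ContinuousStar A] [T2Space A] : IsClosed (skewAdjoint A : Set A) := by
  have coe_eq : (skewAdjoint A : Set A) = {x | star x = -x} := Set.ext fun _ => skewAdjoint.mem_iff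
  exact coe_eq ▸ isClosed_eq continuous_star continuous_neg

namespace SkewAdjointOperators

variable {H : Type*} [NormedAddCommGroup H] [InnerProductSpace ℂ H] {Hp : Submodule ℂ H}
  [CompleteSpace Hp]

lemma star_toCLM (X : SkewAdjointOperators Hp) : star X.toCLM = -X.toCLM :=
  skewAdjoint.mem_iff.1 X.2

/- The general instance is not found for operators on a subspace. -/
instance : ContinuousStar (Hp →L[ℂ] Hp) :=
  (CStarRing.to_normedStarGroup (E := Hp →L[ℂ] Hp)).to_continuousStar

instance : CompleteSpace (SkewAdjointOperators Hp) :=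
  (isClosed_skewAdjoint (A := Hp →L[ℂ] Hp)).completeSpace_coe

variable (Hp)

/-- The inclusion of the skew-adjoint operators. -/
def toCLML : SkewAdjointOperators Hp →L[ℝ] (Hp →L[ℂ] Hp) :=
  LinearMap.mkContinuous
    { toFun := toCLM
      map_add' := fun _ _ => rfl
      map_smul' := fun _ _ => rfl } 1 fun X => (one_mul ‖X‖).ge

/-- The projection `x ↦ (x - x*) / 2` onto the skew-adjoint operators. -/
def skewPart : (Hp →L[ℂ] Hp) →L[ℝ] SkewAdjointOperators Hp :=
  skewAdjointPartL ℝ (Hp →L[ℂ] Hp)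

lemma contDiff_toCLM {n : WithTop ℕ∞} : ContDiff ℝ n (toCLM : SkewAdjointOperators Hp → _) :=
  ContinuousLinearMap.contDiff (𝕜 := ℝ) (E := SkewAdjointOperators Hp) (F := Hp →L[ℂ] Hp)
    (toCLML Hp)

lemma contDiff_skewPart {n : WithTop ℕ∞} : ContDiff ℝ n (skewPart Hp) :=
  ContinuousLinearMap.contDiff (E := Hp →L[ℂ] Hp) _

variable {Hp}

lemma skewPart_toCLM (X : SkewAdjointOperators Hp) : skewPart Hp X.toCLM = X := by
  have comp_eq_id := skewAdjointPart_comp_subtype_skewAdjoint (A := Hp →L[ℂ] Hp) ℝ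
  exact LinearMap.congr_fun comp_eq_id X

lemma toCLM_skewPart {x : Hp →L[ℂ] Hp} (hx : star x = -x) : (skewPart Hp x).toCLM = x :=
  congrArg toCLM (skewPart_toCLM ⟨x, skewAdjoint.mem_iff.2 hx⟩)

end SkewAdjointOperators

end SkewAdjoint

lemma isUnit_two_of_algebra (𝕜 : Type*) {A : Type*} [Field 𝕜] [CharZero 𝕜] [Ring A]
    [Algebra 𝕜 A] : IsUnit (2 : A) := by
  have isUnit_map : IsUnit (algebraMap 𝕜 A 2) := two_ne_zero.isUnit.map (algebraMap 𝕜 A)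
  rwa [map_ofNat] at isUnit_map

section Cayley

variable {A : Type*} [Ring A]

/-- The Cayley transform `(v - 1) (v + 1)⁻¹`. -/
def cayley (v : A) : A := (v - 1) * Ring.inverse (v + 1)

/-- The inverse Cayley transform `(1 + X) (1 - X)⁻¹`. -/
def cayleyInv (X : A) : A := (1 + X) * Ring.inverse (1 - X)

lemma cayleyInv_cayley {v : A} (isUnit_two : IsUnit (2 : A)) (hv : IsUnit (v + 1)) :
    cayleyInv (cayley v) = v := by
  have one_sub_cayley : 1 - cayley v = 2 * Ring.inverse (v + 1) := by
    calc 1 - cayley v = (v + 1 - (v - 1)) * Ring.inverse (v + 1) := by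
          rw [sub_mul, Ring.mul_inverse_cancel _ hv, cayley]
      _ = 2 * Ring.inverse (v + 1) := by noncomm_ring
  have one_add_cayley : 1 + cayley v = v * (2 * Ring.inverse (v + 1)) := by
    calc 1 + cayley v = (v + 1 + (v - 1)) * Ring.inverse (v + 1) := by
          rw [add_mul, Ring.mul_inverse_cancel _ hv, cayley]
      _ = v * (2 * Ring.inverse (v + 1)) := by noncomm_ring
  rw [cayleyInv, one_add_cayley, one_sub_cayley, mul_assoc,
    Ring.mul_inverse_cancel _ (isUnit_two.mul hv.ringInverse), mul_one]

lemma cayleyInv_add_one {X : A} (hX : IsUnit (1 - X)) :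
    cayleyInv X + 1 = 2 * Ring.inverse (1 - X) := by
  calc cayleyInv X + 1 = (1 + X + (1 - X)) * Ring.inverse (1 - X) := by
        rw [add_mul, Ring.mul_inverse_cancel _ hX, cayleyInv]
    _ = 2 * Ring.inverse (1 - X) := by noncomm_ring

lemma isUnit_cayleyInv_add_one {X : A} (isUnit_two : IsUnit (2 : A)) (hX : IsUnit (1 - X)) :
    IsUnit (cayleyInv X + 1) :=
  cayleyInv_add_one hX ▸ isUnit_two.mul hX.ringInverse

lemma cayley_cayleyInv {X : A} (isUnit_two : IsUnit (2 : A)) (hX : IsUnit (1 - X)) :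
    cayley (cayleyInv X) = X := by
  have cayleyInv_sub_one : cayleyInv X - 1 = X * (2 * Ring.inverse (1 - X)) := by
    calc cayleyInv X - 1 = (1 + X - (1 - X)) * Ring.inverse (1 - X) := by
          rw [sub_mul, Ring.mul_inverse_cancel _ hX, cayleyInv]
      _ = X * (2 * Ring.inverse (1 - X)) := by noncomm_ring
  rw [cayley, cayleyInv_sub_one, cayleyInv_add_one hX, mul_assoc,
    Ring.mul_inverse_cancel _ (isUnit_two.mul hX.ringInverse), mul_one]

variable [StarRing A]

lemma star_cayley {v : A} (hv : v ∈ unitary A) (isUnit_add : IsUnit (v + 1)) :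
    star (cayley v) = -cayley v := by
  have star_sub_mul : star (v - 1) * (v + 1) = -(star (v + 1) * (v - 1)) := by
    calc star (v - 1) * (v + 1) = star v * v + star v - v - 1 := by
          rw [star_sub, star_one]; noncomm_ring
      _ = -(star v * v - star v + v - 1) := by
          rw [Unitary.star_mul_self_of_mem hv]; noncomm_ring
      _ = -(star (v + 1) * (v - 1)) := by rw [star_add, star_one]; noncomm_ring
  calc star (cayley v)
      = Ring.inverse (star (v + 1)) * (star (v - 1) * (v + 1)) * Ring.inverse (v + 1) := by
        rw [cayley, star_mul, Ring.inverse_star, ← mul_assoc,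
          Ring.mul_inverse_cancel_right _ _ isUnit_add]
    _ = -cayley v := by
        rw [star_sub_mul, mul_neg, neg_mul, Ring.inverse_mul_cancel_left _ _ isUnit_add.star,
          cayley]

lemma cayleyInv_mem_unitary {X : A} (hX : star X = -X) (isUnit_sub : IsUnit (1 - X)) :
    cayleyInv X ∈ unitary A := by
  have star_one_sub : star (1 - X) = 1 + X := by rw [star_sub, star_one, hX, sub_neg_eq_add]
  have star_one_add : star (1 + X) = 1 - X := by rw [← star_one_sub, star_star]
  have isUnit_add : IsUnit (1 + X) := star_one_sub ▸ isUnit_sub.star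
  refine (isUnit_add.mul isUnit_sub.ringInverse).mem_unitary_of_star_mul_self ?_
  calc star ((1 + X) * Ring.inverse (1 - X)) * ((1 + X) * Ring.inverse (1 - X))
      = Ring.inverse (1 + X) * ((1 - X) * (1 + X)) * Ring.inverse (1 - X) := by
        rw [star_mul, ← Ring.inverse_star, star_one_sub, star_one_add]; simp only [mul_assoc]
    _ = Ring.inverse (1 + X) * ((1 + X) * (1 - X)) * Ring.inverse (1 - X) := by
        congr 2; noncomm_ring
    _ = 1 := by
        rw [Ring.inverse_mul_cancel_left _ _ isUnit_add, Ring.mul_inverse_cancel _ isUnit_sub]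

end Cayley

/-! ### Charts of the set of partial isometries -/

section Corner

variable {𝕜 H : Type*} [RCLike 𝕜] [NormedAddCommGroup H] [InnerProductSpace 𝕜 H]
  (K : Submodule 𝕜 H) [K.HasOrthogonalProjection]

/-- The compression of an operator to the subspace `K`. -/
def compress (b : H →L[𝕜] H) : K →L[𝕜] K := K.orthogonalProjectionOnto ∘L b ∘L K.subtypeL

/-- The extension by zero of an operator on the subspace `K`. -/
def dilate (c : K →L[𝕜] K) : H →L[𝕜] H := K.subtypeL ∘L c ∘L K.orthogonalProjectionOnto

lemma contDiff_compress {n : WithTop ℕ∞} : ContDiff 𝕜 n (compress K) :=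
  contDiff_const.clm_comp (contDiff_id.clm_comp contDiff_const)

lemma contDiff_dilate {n : WithTop ℕ∞} : ContDiff 𝕜 n (dilate K) :=
  contDiff_const.clm_comp (contDiff_id.clm_comp contDiff_const)

variable {K}

lemma compress_dilate (c : K →L[𝕜] K) : compress K (dilate K c) = c := by
  ext x
  simp only [compress, dilate, ContinuousLinearMap.comp_apply, Submodule.subtypeL_apply,
    Submodule.orthogonalProjectionOnto_mem_subspace_eq_self]

lemma dilate_compress (b : H →L[𝕜] H) :
    dilate K (compress K b) = K.starProjection * b * K.starProjection := rfl

lemma dilate_one : dilate K 1 = K.starProjection := rfl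

lemma dilate_mul (c d : K →L[𝕜] K) : dilate K (c * d) = dilate K c * dilate K d := by
  ext x
  change ((c (d (K.orthogonalProjectionOnto x)) : K) : H) =
    c (K.orthogonalProjectionOnto (d (K.orthogonalProjectionOnto x) : H))
  rw [Submodule.orthogonalProjectionOnto_mem_subspace_eq_self]

lemma dilate_injective : Function.Injective (dilate K) :=
  Function.LeftInverse.injective compress_dilate

variable [CompleteSpace H] {a b x : H →L[𝕜] H} {c : K →L[𝕜] K}

lemma compress_conj_dilate (ha : a ∈ unitary (H →L[𝕜] H)) (hb : b ∈ unitary (H →L[𝕜] H)) :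
    compress K (star a * (a * dilate K c * star b) * b) = c := by
  calc compress K (star a * (a * dilate K c * star b) * b)
      = compress K ((star a * a) * dilate K c * (star b * b)) := by simp only [mul_assoc]
    _ = c := by
        rw [Unitary.star_mul_self_of_mem ha, Unitary.star_mul_self_of_mem hb, one_mul, mul_one,
          compress_dilate]

lemma conj_star_mul_self (ha : a ∈ unitary (H →L[𝕜] H)) (hb : b ∈ unitary (H →L[𝕜] H))
    (hx : star x * x = b * K.starProjection * star b) :
    star (star a * x * b) * (star a * x * b) = K.starProjection := by
  calc star (star a * x * b) * (star a * x * b) = star b * (star x * (a * star a) * x) * b := by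
        simp only [star_mul, star_star, mul_assoc]
    _ = (star b * b) * K.starProjection * (star b * b) := by
        rw [Unitary.mul_star_self_of_mem ha, mul_one, hx]; simp only [mul_assoc]
    _ = K.starProjection := by rw [Unitary.star_mul_self_of_mem hb, one_mul, mul_one]

variable [CompleteSpace K]

lemma star_dilate : star (dilate K c) = dilate K (star c) := by
  simp only [dilate, ContinuousLinearMap.star_eq_adjoint, ContinuousLinearMap.adjoint_comp,
    Submodule.adjoint_subtypeL, Submodule.adjoint_orthogonalProjectionOnto]
  rfl

/- With `e` the projection onto `K`, the hypotheses say that `b` is unitary in the corner algebra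
`e B(H) e`. -/
lemma compress_mem_unitary (star_mul_self : star b * b = K.starProjection)
    (mul_star_self : b * star b = K.starProjection) (mul_star_mul : b * star b * b = b) :
    compress K b ∈ unitary (K →L[𝕜] K) ∧ dilate K (compress K b) = b := by
  have dilate_compress_self : dilate K (compress K b) = b := by
    rw [dilate_compress, ← mul_star_self, mul_star_mul, mul_star_self, ← star_mul_self, ← mul_assoc,
      mul_star_mul]
  refine ⟨Unitary.mem_iff.2 ⟨dilate_injective ?_, dilate_injective ?_⟩, dilate_compress_self⟩
  · rw [dilate_mul, ← star_dilate, dilate_compress_self, star_mul_self, dilate_one]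
  · rw [dilate_mul, ← star_dilate, dilate_compress_self, mul_star_self, dilate_one]

lemma conj_dilate_mul_star (hb : b ∈ unitary (H →L[𝕜] H)) (hc : c ∈ unitary (K →L[𝕜] K)) :
    a * dilate K c * star b * star (a * dilate K c * star b) = a * K.starProjection * star a := by
  calc a * dilate K c * star b * star (a * dilate K c * star b)
      = a * (dilate K c * (star b * b) * star (dilate K c)) * star a := by
        simp only [star_mul, star_star, mul_assoc]
    _ = a * K.starProjection * star a := by
        rw [Unitary.star_mul_self_of_mem hb, mul_one, star_dilate, ← dilate_mul,
          Unitary.mul_star_self_of_mem hc, dilate_one]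

lemma star_conj_dilate_mul (ha : a ∈ unitary (H →L[𝕜] H)) (hc : c ∈ unitary (K →L[𝕜] K)) :
    star (a * dilate K c * star b) * (a * dilate K c * star b) = b * K.starProjection * star b := by
  have star_eq : star (a * dilate K c * star b) = b * dilate K (star c) * star a := by
    rw [star_mul, star_mul, star_star, star_dilate, mul_assoc]
  have self_eq : a * dilate K c * star b = star (b * dilate K (star c) * star a) := by
    rw [← star_eq, star_star]
  rw [star_eq, self_eq]
  exact conj_dilate_mul_star ha (Unitary.star_mem hc)

/- An operator whose initial and final spaces are `b K` and `a K` is, up to `a` and `b`, a unitary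
operator on `K`. -/
lemma compress_conj_mem_unitary (ha : a ∈ unitary (H →L[𝕜] H)) (hb : b ∈ unitary (H →L[𝕜] H))
    (mul_star_self : x * star x = a * K.starProjection * star a)
    (star_mul_self : star x * x = b * K.starProjection * star b)
    (mul_star_mul : x * star x * x = x) :
    compress K (star a * x * b) ∈ unitary (K →L[𝕜] K) ∧
      a * dilate K (compress K (star a * x * b)) * star b = x := by
  have star_conj : star (star a * x * b) = star b * star x * a := by
    simp only [star_mul, star_star, mul_assoc]
  have conj_mul_star : star a * x * b * star (star a * x * b) = K.starProjection := by
    rw [star_conj, ← conj_star_mul_self hb ha (x := star x) (by rwa [star_star]), ← star_conj,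
      star_star]
  have conj_mul_star_mul : star a * x * b * star (star a * x * b) * (star a * x * b) =
      star a * x * b := by
    calc star a * x * b * star (star a * x * b) * (star a * x * b)
        = star a * (x * (b * star b) * star x * (a * star a) * x) * b := by
          rw [star_conj]; simp only [mul_assoc]
      _ = star a * x * b := by
          rw [Unitary.mul_star_self_of_mem ha, Unitary.mul_star_self_of_mem hb, mul_one, mul_one,
            mul_star_mul]
  obtain ⟨mem_unitary, dilate_eq⟩ := compress_mem_unitary
    (conj_star_mul_self ha hb star_mul_self) conj_mul_star conj_mul_star_mul
  refine ⟨mem_unitary, ?_⟩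
  calc a * dilate K (compress K (star a * x * b)) * star b = (a * star a) * x * (b * star b) := by
        rw [dilate_eq]; simp only [mul_assoc]
    _ = x := by
        rw [Unitary.mul_star_self_of_mem ha, Unitary.mul_star_self_of_mem hb, one_mul, mul_one]

end Corner

lemma IsPartialIsometry.mul_star_mul {H : Type*} [NormedAddCommGroup H] [InnerProductSpace ℂ H]
    [CompleteSpace H] {u : H →L[ℂ] H} (hu : IsPartialIsometry u) : u * star u * u = u := by
  have idempotent : star u * u * (star u * u) = star u * u := hu.isIdempotentElem
  refine sub_eq_zero.1 ((CStarRing.star_mul_self_eq_zero_iff _).1 ?_)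
  calc star (u * star u * u - u) * (u * star u * u - u)
      = star u * u * (star u * u) * (star u * u) - star u * u * (star u * u)
        - star u * u * (star u * u) + star u * u := by
        simp only [star_sub, star_mul, star_star]; noncomm_ring
    _ = 0 := by rw [idempotent, idempotent]; noncomm_ring

namespace RestrictedPartialIsometry

open RestrictedGrassmannian

/-- The space in which the partial isometries are observed: an operator with two points of the
restricted Grassmannian, standing for its target and its source. -/
abbrev Ambient (p : ℝ) {H : Type*} [NormedAddCommGroup H] [InnerProductSpace ℂ H]
    [CompleteSpace H] (Hp : Submodule ℂ H) [CompleteSpace Hp] : Type _ :=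
  (H →L[ℂ] H) × RestrictedGrassmannian p Hp × RestrictedGrassmannian p Hp

variable {p : ℝ} {H : Type*} [NormedAddCommGroup H]
  [InnerProductSpace ℂ H] [CompleteSpace H] {Hp : Submodule ℂ H} [CompleteSpace Hp]

/-- The map to the ambient space which induces the topology and the smooth structure. -/
def toAmbient (u : RestrictedPartialIsometry p Hp) : Ambient p Hp := (u.toCLM, u.target, u.source)

lemma toAmbient_injective :
    Function.Injective (toAmbient : RestrictedPartialIsometry p Hp → Ambient p Hp) :=
  fun _ _ h => RestrictedPartialIsometry.ext (congrArg Prod.fst h)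

lemma exists_toAmbient_eq {x : H →L[ℂ] H} {V V' : RestrictedGrassmannian p Hp}
    (mul_star_self : x * star x = V.proj) (star_mul_self : star x * x = V'.proj) :
    ∃ u : RestrictedPartialIsometry p Hp, u.toAmbient = (x, V, V') := by
  refine ⟨⟨x, ?_, star_mul_self ▸ V'.isRestricted, mul_star_self ▸ V.isRestricted⟩, ?_⟩
  · rw [IsPartialIsometry, star_mul_self]
    exact V'.isStarProjection
  · exact Prod.ext rfl (Prod.ext (RestrictedGrassmannian.ext mul_star_self)
      (RestrictedGrassmannian.ext star_mul_self))

section Coordinates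

variable [Fact (p = 0 ∨ 1 < p)]

instance : TopologicalSpace (RestrictedPartialIsometry p Hp) :=
  TopologicalSpace.induced toAmbient inferInstance

lemma isInducing_toAmbient :
    Topology.IsInducing (toAmbient : RestrictedPartialIsometry p Hp → Ambient p Hp) :=
  ⟨rfl⟩

instance : T2Space (RestrictedPartialIsometry p Hp) :=
  T2Space.of_injective_continuous toAmbient_injective isInducing_toAmbient.continuous

section Transport

variable {E : Type*} [NormedAddCommGroup E] [NormedSpace ℝ E]
  [ChartedSpace E (RestrictedGrassmannian p Hp)] {Ω Ω' : Set (RestrictedGrassmannian p Hp)}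
  {σ σ' : RestrictedGrassmannian p Hp → (H →L[ℂ] H)}

lemma transportToHp_mem_unitary (hσ : IsSmoothCrossSection (E := E) Ω σ)
    (hσ' : IsSmoothCrossSection (E := E) Ω' σ') {u : RestrictedPartialIsometry p Hp}
    (ht : u.target ∈ Ω) (hs : u.source ∈ Ω') :
    transportToHp σ σ' u ∈ unitary (Hp →L[ℂ] Hp) ∧
      σ u.target * dilate Hp (transportToHp σ σ' u) * star (σ' u.source) = u.toCLM :=
  compress_conj_mem_unitary (hσ.mem_unitary _ ht) (hσ'.mem_unitary _ hs)
    (hσ.mul_starProjection_mul_star ht).symm (hσ'.mul_starProjection_mul_star hs).symm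
    u.isPartialIsometry.mul_star_mul

lemma exists_transportToHp_eq (hσ : IsSmoothCrossSection (E := E) Ω σ)
    (hσ' : IsSmoothCrossSection (E := E) Ω' σ') {V V' : RestrictedGrassmannian p Hp}
    (hV : V ∈ Ω) (hV' : V' ∈ Ω') {c : Hp →L[ℂ] Hp} (hc : c ∈ unitary (Hp →L[ℂ] Hp)) :
    ∃ u : RestrictedPartialIsometry p Hp, u.target = V ∧ u.source = V' ∧
      transportToHp σ σ' u = c := by
  have σ_unitary := hσ.mem_unitary V hV
  have σ'_unitary := hσ'.mem_unitary V' hV'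
  obtain ⟨u, hu⟩ := exists_toAmbient_eq (x := σ V * dilate Hp c * star (σ' V')) (V := V) (V' := V')
    ((conj_dilate_mul_star σ'_unitary hc).trans (hσ.mul_starProjection_mul_star hV))
    ((star_conj_dilate_mul σ_unitary hc).trans (hσ'.mul_starProjection_mul_star hV'))
  have target_eq : u.target = V := congrArg (fun x => x.2.1) hu
  have source_eq : u.source = V' := congrArg (fun x => x.2.2) hu
  have toCLM_eq : u.toCLM = σ V * dilate Hp c * star (σ' V') := congrArg Prod.fst hu
  refine ⟨u, target_eq, source_eq, ?_⟩
  change compress Hp (star (σ u.target) * u.toCLM * σ' u.source) = c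
  rw [target_eq, source_eq, toCLM_eq, compress_conj_dilate σ_unitary σ'_unitary]

end Transport

variable (W W' : RestrictedGrassmannian p Hp) (Ω Ω' : Set (RestrictedGrassmannian p Hp))
  (σ σ' : RestrictedGrassmannian p Hp → (H →L[ℂ] H)) (g : unitary (Hp →L[ℂ] Hp))

/-- The model space of the chart around the partial isometries from `W'` to `W`. -/
abbrev CoordinateSpace : Type _ :=
  SchattenClass p W.space W.spaceᗮ × SchattenClass p W'.space W'.spaceᗮ × SkewAdjointOperators Hp

/-- The argument of the Cayley transform in the chart, on the ambient space. -/
def cayleyArgument (x : Ambient p Hp) : Hp →L[ℂ] Hp :=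
  star (g : Hp →L[ℂ] Hp) * compress Hp (star (σ x.2.1) * x.1 * σ' x.2.2)

/-- The open subset of the ambient space which cuts out the domain of the chart. -/
def ambientChartDomain : Set (Ambient p Hp) :=
  {x | x.2.1 ∈ Ω ∧ x.2.2 ∈ Ω' ∧ IsUnit (cayleyArgument σ σ' g x + 1)}

/-- The image of the chart. -/
def coordinateRange : Set (CoordinateSpace W W') :=
  {Z | W.graphChart.symm Z.1 ∈ Ω ∧ W'.graphChart.symm Z.2.1 ∈ Ω'}

/-- The coordinates, on the ambient space. Taking the skew-adjoint part changes nothing at a partial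
isometry, where the Cayley transform is skew-adjoint already. -/
def coordinates (x : Ambient p Hp) : CoordinateSpace W W' :=
  (W.graphChart x.2.1, W'.graphChart x.2.2,
    SkewAdjointOperators.skewPart Hp (cayley (cayleyArgument σ σ' g x)))

/-- The point of the ambient space with given coordinates. -/
def ofCoordinates (Z : CoordinateSpace W W') : Ambient p Hp :=
  (σ (W.graphChart.symm Z.1) * dilate Hp (g * cayleyInv Z.2.2.toCLM) *
    star (σ' (W'.graphChart.symm Z.2.1)), W.graphChart.symm Z.1, W'.graphChart.symm Z.2.1)

end Coordinates

section GroupoidChart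

variable [Fact (p = 0 ∨ 1 < p)] [Fact (¬ FiniteDimensional ℂ Hp)]
  [Fact (¬ FiniteDimensional ℂ Hpᗮ)] {W W' : RestrictedGrassmannian p Hp}
  {Ω Ω' : Set (RestrictedGrassmannian p Hp)}
  {σ σ' : RestrictedGrassmannian p Hp → (H →L[ℂ] H)} (g : unitary (Hp →L[ℂ] Hp))

variable (p Hp) in
/-- The model with corners of the ambient space. -/
abbrev ambientModel := 𝓘(ℝ, H →L[ℂ] H).prod
  (𝓘(ℝ, SchattenClass p Hp Hpᗮ).prod 𝓘(ℝ, SchattenClass p Hp Hpᗮ))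

lemma contMDiffOn_cayleyArgument
    (hσ : IsSmoothCrossSection (E := SchattenClass p Hp Hpᗮ) Ω σ)
    (hσ' : IsSmoothCrossSection (E := SchattenClass p Hp Hpᗮ) Ω' σ') :
    ContMDiffOn (ambientModel p Hp) 𝓘(ℝ, Hp →L[ℂ] Hp) ∞ (cayleyArgument σ σ' g)
      {x | x.2.1 ∈ Ω ∧ x.2.2 ∈ Ω'} := by
  have smooth_target : ContMDiffOn (ambientModel p Hp) 𝓘(ℝ, H →L[ℂ] H) ∞
      (fun x : Ambient p Hp => σ x.2.1) {x | x.2.1 ∈ Ω ∧ x.2.2 ∈ Ω'} :=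
    hσ.smooth.comp (contMDiff_fst.comp contMDiff_snd).contMDiffOn fun _ hx => hx.1
  have smooth_source : ContMDiffOn (ambientModel p Hp) 𝓘(ℝ, H →L[ℂ] H) ∞
      (fun x : Ambient p Hp => σ' x.2.2) {x | x.2.1 ∈ Ω ∧ x.2.2 ∈ Ω'} :=
    hσ'.smooth.comp (contMDiff_snd.comp contMDiff_snd).contMDiffOn fun _ hx => hx.2
  exact contMDiffOn_mul (A := Hp →L[ℂ] Hp) contMDiffOn_const
    (((contDiff_compress Hp).restrict_scalars ℝ).contMDiff.comp_contMDiffOn (contMDiffOn_mul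
      (contMDiffOn_mul (contMDiffOn_star smooth_target) contMDiffOn_fst) smooth_source))

lemma isOpen_ambientChartDomain
    (hσ : IsSmoothCrossSection (E := SchattenClass p Hp Hpᗮ) Ω σ)
    (hσ' : IsSmoothCrossSection (E := SchattenClass p Hp Hpᗮ) Ω' σ') :
    IsOpen (ambientChartDomain Ω Ω' σ σ' g) := by
  have isOpen_isUnit : IsOpen {c : Hp →L[ℂ] Hp | IsUnit (c + 1)} :=
    (Units.isOpen (R := Hp →L[ℂ] Hp)).preimage (f := fun c : Hp →L[ℂ] Hp => c + 1)
      (continuous_id.add continuous_const)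
  have isOpen_inter := (contMDiffOn_cayleyArgument g hσ hσ').continuousOn.isOpen_inter_preimage
    ((hσ.isOpen.preimage (continuous_fst.comp continuous_snd)).inter
      (hσ'.isOpen.preimage (continuous_snd.comp continuous_snd))) isOpen_isUnit
  convert isOpen_inter using 1
  exact Set.ext fun _ => and_assoc.symm

lemma contMDiffOn_coordinates (hΩ : Ω ⊆ grassmannianChartDomain W)
    (hΩ' : Ω' ⊆ grassmannianChartDomain W')
    (hσ : IsSmoothCrossSection (E := SchattenClass p Hp Hpᗮ) Ω σ)
    (hσ' : IsSmoothCrossSection (E := SchattenClass p Hp Hpᗮ) Ω' σ') :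
    ContMDiffOn (ambientModel p Hp) 𝓘(ℝ, CoordinateSpace W W') ∞ (coordinates W W' σ σ' g)
      (ambientChartDomain Ω Ω' σ σ' g) := by
  have smooth_argument := (contMDiffOn_cayleyArgument g hσ hσ').mono
    fun x (hx : x ∈ ambientChartDomain Ω Ω' σ σ' g) => ⟨hx.1, hx.2.1⟩
  refine ContMDiffOn.prodMk_space ?_ (ContMDiffOn.prodMk_space ?_ ?_)
  · exact W.contMDiffOn_graphChart.comp (contMDiff_fst.comp contMDiff_snd).contMDiffOn
      fun _ hx => hΩ hx.1
  · exact W'.contMDiffOn_graphChart.comp (contMDiff_snd.comp contMDiff_snd).contMDiffOn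
      fun _ hx => hΩ' hx.2.1
  · refine (SkewAdjointOperators.contDiff_skewPart Hp).contMDiff.comp_contMDiffOn ?_
    exact contMDiffOn_mul (A := Hp →L[ℂ] Hp) (smooth_argument.sub contMDiffOn_const)
      (contMDiffOn_ringInverse (A := Hp →L[ℂ] Hp) (smooth_argument.add contMDiffOn_const)
        fun _ hx => hx.2.2)

lemma contMDiffOn_ofCoordinates (hσ : IsSmoothCrossSection (E := SchattenClass p Hp Hpᗮ) Ω σ)
    (hσ' : IsSmoothCrossSection (E := SchattenClass p Hp Hpᗮ) Ω' σ') :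
    ContMDiffOn 𝓘(ℝ, CoordinateSpace W W') (ambientModel p Hp) ∞ (ofCoordinates W W' σ σ' g)
      (coordinateRange W W' Ω Ω') := by
  have smooth_target : ContMDiff 𝓘(ℝ, CoordinateSpace W W') 𝓘(ℝ, SchattenClass p Hp Hpᗮ) ∞
      (fun Z : CoordinateSpace W W' => W.graphChart.symm Z.1) :=
    W.contMDiff_graphChart_symm.comp contDiff_fst.contMDiff
  have smooth_source : ContMDiff 𝓘(ℝ, CoordinateSpace W W') 𝓘(ℝ, SchattenClass p Hp Hpᗮ) ∞
      (fun Z : CoordinateSpace W W' => W'.graphChart.symm Z.2.1) :=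
    W'.contMDiff_graphChart_symm.comp (contDiff_fst.comp contDiff_snd).contMDiff
  have smooth_skew : ContMDiffOn 𝓘(ℝ, CoordinateSpace W W') 𝓘(ℝ, Hp →L[ℂ] Hp) ∞
      (fun Z : CoordinateSpace W W' => Z.2.2.toCLM) (coordinateRange W W' Ω Ω') :=
    ((SkewAdjointOperators.contDiff_toCLM Hp).comp
      (contDiff_snd.comp contDiff_snd)).contMDiff.contMDiffOn
  have smooth_cayleyInv : ContMDiffOn 𝓘(ℝ, CoordinateSpace W W') 𝓘(ℝ, Hp →L[ℂ] Hp) ∞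
      (fun Z : CoordinateSpace W W' => cayleyInv Z.2.2.toCLM) (coordinateRange W W' Ω Ω') :=
    contMDiffOn_mul (A := Hp →L[ℂ] Hp) (contMDiffOn_const.add smooth_skew)
      (contMDiffOn_ringInverse (A := Hp →L[ℂ] Hp) (contMDiffOn_const.sub smooth_skew) fun Z _ =>
        isUnit_one_sub_of_skewAdjoint (A := Hp →L[ℂ] Hp) Z.2.2.star_toCLM)
  refine ContMDiffOn.prodMk ?_ (smooth_target.contMDiffOn.prodMk smooth_source.contMDiffOn)
  refine contMDiffOn_mul (contMDiffOn_mul ?_ ?_) (contMDiffOn_star ?_)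
  · exact hσ.smooth.comp smooth_target.contMDiffOn fun _ hZ => hZ.1
  · exact ((contDiff_dilate Hp).restrict_scalars ℝ).contMDiff.comp_contMDiffOn
      (contMDiffOn_mul (A := Hp →L[ℂ] Hp) contMDiffOn_const smooth_cayleyInv)
  · exact hσ'.smooth.comp smooth_source.contMDiffOn fun _ hZ => hZ.2

lemma isOpen_coordinateRange (hΩ : IsOpen Ω) (hΩ' : IsOpen Ω') :
    IsOpen (coordinateRange W W' Ω Ω') :=
  (hΩ.preimage (W.contMDiff_graphChart_symm.continuous.comp continuous_fst)).inter
    (hΩ'.preimage (W'.contMDiff_graphChart_symm.continuous.comp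
      (continuous_fst.comp continuous_snd)))

lemma toCLM_coordinates_toAmbient
    (hσ : IsSmoothCrossSection (E := SchattenClass p Hp Hpᗮ) Ω σ)
    (hσ' : IsSmoothCrossSection (E := SchattenClass p Hp Hpᗮ) Ω' σ')
    {u : RestrictedPartialIsometry p Hp} (hu : u ∈ groupoidChartDomain Ω Ω' σ σ' g) :
    (coordinates W W' σ σ' g u.toAmbient).2.2.toCLM =
      cayley (star (g : Hp →L[ℂ] Hp) * transportToHp σ σ' u) := by
  obtain ⟨ht, hs, isUnit_add_one⟩ := hu
  have mem_unitary : star (g : Hp →L[ℂ] Hp) * transportToHp σ σ' u ∈ unitary (Hp →L[ℂ] Hp) :=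
    mul_mem (Unitary.star_mem g.2) (transportToHp_mem_unitary hσ hσ' ht hs).1
  exact SkewAdjointOperators.toCLM_skewPart
    (star_cayley (A := Hp →L[ℂ] Hp) mem_unitary isUnit_add_one)

lemma ofCoordinates_coordinates (hΩ : Ω ⊆ grassmannianChartDomain W)
    (hΩ' : Ω' ⊆ grassmannianChartDomain W')
    (hσ : IsSmoothCrossSection (E := SchattenClass p Hp Hpᗮ) Ω σ)
    (hσ' : IsSmoothCrossSection (E := SchattenClass p Hp Hpᗮ) Ω' σ')
    {u : RestrictedPartialIsometry p Hp} (hu : u ∈ groupoidChartDomain Ω Ω' σ σ' g) :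
    ofCoordinates W W' σ σ' g (coordinates W W' σ σ' g u.toAmbient) = u.toAmbient := by
  have target_eq : W.graphChart.symm (coordinates W W' σ σ' g u.toAmbient).1 = u.target :=
    graphChart_symm_graphChart (hΩ hu.1)
  have source_eq : W'.graphChart.symm (coordinates W W' σ σ' g u.toAmbient).2.1 = u.source :=
    graphChart_symm_graphChart (hΩ' hu.2.1)
  rw [ofCoordinates, target_eq, source_eq, toCLM_coordinates_toAmbient g hσ hσ' hu,
    cayleyInv_cayley (isUnit_two_of_algebra ℂ) hu.2.2, ← mul_assoc,
    Unitary.mul_star_self_of_mem g.2, one_mul,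
    (transportToHp_mem_unitary hσ hσ' hu.1 hu.2.1).2, toAmbient]

lemma exists_coordinates_eq
    (hσ : IsSmoothCrossSection (E := SchattenClass p Hp Hpᗮ) Ω σ)
    (hσ' : IsSmoothCrossSection (E := SchattenClass p Hp Hpᗮ) Ω' σ')
    {Z : CoordinateSpace W W'} (hZ : Z ∈ coordinateRange W W' Ω Ω') :
    ∃ u ∈ groupoidChartDomain Ω Ω' σ σ' g, coordinates W W' σ σ' g u.toAmbient = Z := by
  have isUnit_one_sub : IsUnit (1 - Z.2.2.toCLM) :=
    isUnit_one_sub_of_skewAdjoint (A := Hp →L[ℂ] Hp) Z.2.2.star_toCLM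
  obtain ⟨u, target_eq, source_eq, transport_eq⟩ := exists_transportToHp_eq hσ hσ' hZ.1 hZ.2
    (mul_mem g.2 (cayleyInv_mem_unitary (A := Hp →L[ℂ] Hp) Z.2.2.star_toCLM isUnit_one_sub))
  have argument_eq : star (g : Hp →L[ℂ] Hp) * transportToHp σ σ' u = cayleyInv Z.2.2.toCLM := by
    rw [transport_eq, ← mul_assoc, Unitary.star_mul_self_of_mem g.2, one_mul]
  have isUnit_two : IsUnit (2 : Hp →L[ℂ] Hp) := isUnit_two_of_algebra ℂ
  refine ⟨u, ⟨target_eq ▸ hZ.1, source_eq ▸ hZ.2, ?_⟩, ?_⟩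
  · rw [argument_eq]
    exact isUnit_cayleyInv_add_one isUnit_two isUnit_one_sub
  · change (W.graphChart u.target, W'.graphChart u.source, SkewAdjointOperators.skewPart Hp
      (cayley (star (g : Hp →L[ℂ] Hp) * transportToHp σ σ' u))) = Z
    rw [target_eq, source_eq, argument_eq, graphChart_graphChart_symm, graphChart_graphChart_symm,
      cayley_cayleyInv isUnit_two isUnit_one_sub, SkewAdjointOperators.skewPart_toCLM]

lemma bijOn_coordinates (hΩ : Ω ⊆ grassmannianChartDomain W)
    (hΩ' : Ω' ⊆ grassmannianChartDomain W')
    (hσ : IsSmoothCrossSection (E := SchattenClass p Hp Hpᗮ) Ω σ)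
    (hσ' : IsSmoothCrossSection (E := SchattenClass p Hp Hpᗮ) Ω' σ') :
    Set.BijOn (coordinates W W' σ σ' g ∘ toAmbient) (groupoidChartDomain Ω Ω' σ σ' g)
      (coordinateRange W W' Ω Ω') := by
  refine ⟨fun u hu => ?_, fun u hu v hv coordinates_eq => toAmbient_injective ?_,
    fun Z hZ => exists_coordinates_eq g hσ hσ' hZ⟩
  · exact ⟨(graphChart_symm_graphChart (hΩ hu.1)).symm ▸ hu.1,
      (graphChart_symm_graphChart (hΩ' hu.2.1)).symm ▸ hu.2.1⟩
  · rw [← ofCoordinates_coordinates g hΩ hΩ' hσ hσ' hu,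
      ← ofCoordinates_coordinates g hΩ hΩ' hσ hσ' hv]
    exact congrArg _ coordinates_eq

lemma isGroupoidCoordinate_coordinates (hΩ : Ω ⊆ grassmannianChartDomain W)
    (hΩ' : Ω' ⊆ grassmannianChartDomain W')
    (hσ : IsSmoothCrossSection (E := SchattenClass p Hp Hpᗮ) Ω σ)
    (hσ' : IsSmoothCrossSection (E := SchattenClass p Hp Hpᗮ) Ω' σ')
    {u : RestrictedPartialIsometry p Hp} (hu : u ∈ groupoidChartDomain Ω Ω' σ σ' g) :
    IsGroupoidCoordinate W W' σ σ' g u (coordinates W W' σ σ' g u.toAmbient) :=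
  ⟨isGrassmannianCoordinate_graphChart (hΩ hu.1),
    isGrassmannianCoordinate_graphChart (hΩ' hu.2.1), toCLM_coordinates_toAmbient g hσ hσ' hu⟩

lemma exists_groupoidChart (hΩ : Ω ⊆ grassmannianChartDomain W)
    (hΩ' : Ω' ⊆ grassmannianChartDomain W')
    (hσ : IsSmoothCrossSection (E := SchattenClass p Hp Hpᗮ) Ω σ)
    (hσ' : IsSmoothCrossSection (E := SchattenClass p Hp Hpᗮ) Ω' σ') :
    ∃ Φ : OpenPartialHomeomorph (RestrictedPartialIsometry p Hp) (CoordinateSpace W W'),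
      Φ.source = groupoidChartDomain Ω Ω' σ σ' g ∧
      (∀ u ∈ Φ.source, IsGroupoidCoordinate W W' σ σ' g u (Φ u)) ∧
      IsAdaptedChart (ambientModel p Hp) toAmbient Φ := by
  have : Nonempty (RestrictedPartialIsometry p Hp) := ⟨unit W⟩
  let e := Set.BijOn.toPartialEquiv _ _ _ (bijOn_coordinates g hΩ hΩ' hσ hσ')
  have smooth_symm : ContMDiffOn 𝓘(ℝ, CoordinateSpace W W') (ambientModel p Hp) ∞
      (toAmbient ∘ e.symm) e.target := by
    refine (contMDiffOn_ofCoordinates g hσ hσ').congr fun Z hZ => ?_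
    have coordinates_eq : coordinates W W' σ σ' g (e.symm Z).toAmbient = Z := e.right_inv hZ
    calc (e.symm Z).toAmbient
        = ofCoordinates W W' σ σ' g (coordinates W W' σ σ' g (e.symm Z).toAmbient) :=
          (ofCoordinates_coordinates g hΩ hΩ' hσ hσ' (e.map_target hZ)).symm
      _ = ofCoordinates W W' σ σ' g Z := by rw [coordinates_eq]
  obtain ⟨Φ, toPartialEquiv_eq, isAdaptedChart⟩ := exists_isAdaptedChart isInducing_toAmbient e
    (isOpen_coordinateRange hσ.isOpen hσ'.isOpen) smooth_symm (isOpen_ambientChartDomain g hσ hσ')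
    (contMDiffOn_coordinates g hΩ hΩ' hσ hσ') rfl fun _ _ => rfl
  have source_eq : Φ.source = groupoidChartDomain Ω Ω' σ σ' g :=
    congrArg PartialEquiv.source toPartialEquiv_eq
  have apply_eq (u) : Φ u = coordinates W W' σ σ' g u.toAmbient :=
    congrArg (fun e' : PartialEquiv _ _ => e' u) toPartialEquiv_eq
  refine ⟨Φ, source_eq, fun u hu => ?_, isAdaptedChart⟩
  rw [apply_eq]
  exact isGroupoidCoordinate_coordinates g hΩ hΩ' hσ hσ' (source_eq ▸ hu)

end GroupoidChart

end RestrictedPartialIsometry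

/-! ### The groupoid of partial isometries -/

section Submersion

open Topology

lemma isBanachSubmersion_of_localSections {EG EM G M : Type*} [NormedAddCommGroup EG]
    [NormedSpace ℝ EG] [NormedAddCommGroup EM] [NormedSpace ℝ EM] [TopologicalSpace G]
    [ChartedSpace EG G] [TopologicalSpace M] [ChartedSpace EM M] {f : G → M}
    (hf : ContMDiff 𝓘(ℝ, EG) 𝓘(ℝ, EM) ∞ f)
    (h : ∀ x, ∃ τ : M → G, τ (f x) = x ∧ ContMDiffAt 𝓘(ℝ, EM) 𝓘(ℝ, EG) ∞ τ (f x) ∧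
      ∀ᶠ y in 𝓝 (f x), f (τ y) = y) : IsBanachSubmersion (EG := EG) (EM := EM) f := by
  have exists_rightInverse (x : G) : ∃ A : EM →L[ℝ] EG, Function.RightInverse A
      (mfderiv 𝓘(ℝ, EG) 𝓘(ℝ, EM) f x : EG →L[ℝ] EM) := by
    obtain ⟨τ, apply_eq, smooth, isSection⟩ := h x
    refine ⟨mfderiv 𝓘(ℝ, EM) 𝓘(ℝ, EG) τ (f x), fun v => ?_⟩
    have chain_rule : mfderiv 𝓘(ℝ, EM) 𝓘(ℝ, EM) (f ∘ τ) (f x) =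
        (mfderiv 𝓘(ℝ, EG) 𝓘(ℝ, EM) f (τ (f x))).comp (mfderiv 𝓘(ℝ, EM) 𝓘(ℝ, EG) τ (f x)) :=
      mfderiv_comp (f x) (hf.mdifferentiableAt (by simp)) (smooth.mdifferentiableAt (by simp))
    have mfderiv_eq_id : mfderiv 𝓘(ℝ, EM) 𝓘(ℝ, EM) (f ∘ τ) (f x) =
        mfderiv 𝓘(ℝ, EM) 𝓘(ℝ, EM) id (f x) := Filter.EventuallyEq.mfderiv_eq isSection
    rw [mfderiv_eq_id, mfderiv_id, apply_eq] at chain_rule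
    exact (congrArg (fun T : EM →L[ℝ] EM => T v) chain_rule).symm
  refine ⟨hf, fun x => ?_, fun x => ?_⟩
  · obtain ⟨A, hA⟩ := exists_rightInverse x
    exact hA.surjective
  · obtain ⟨A, hA⟩ := exists_rightInverse x
    exact ContinuousLinearMap.closedComplemented_ker_of_rightInverse
      (mfderiv 𝓘(ℝ, EG) 𝓘(ℝ, EM) f x : EG →L[ℝ] EM) A hA

end Submersion

namespace RestrictedPartialIsometry

open RestrictedGrassmannian Topology

section GroupoidLaws

variable {p : ℝ} {H : Type*} [NormedAddCommGroup H]
  [InnerProductSpace ℂ H] [CompleteSpace H] {Hp : Submodule ℂ H} [CompleteSpace Hp]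

lemma source_inv (u : RestrictedPartialIsometry p Hp) : u.inv.source = u.target :=
  RestrictedGrassmannian.ext (congrArg (· * star u.toCLM) (star_star u.toCLM))

lemma target_inv (u : RestrictedPartialIsometry p Hp) : u.inv.target = u.source :=
  RestrictedGrassmannian.ext (congrArg (star u.toCLM * ·) (star_star u.toCLM))

lemma inv_inv (u : RestrictedPartialIsometry p Hp) : u.inv.inv = u :=
  RestrictedPartialIsometry.ext (star_star u.toCLM)

lemma source_unit (V : RestrictedGrassmannian p Hp) : (unit V).source = V :=
  RestrictedGrassmannian.ext (by
    change star V.proj * V.proj = V.proj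
    rw [V.isStarProjection.isSelfAdjoint.star_eq, V.isStarProjection.isIdempotentElem.eq])

lemma target_unit (V : RestrictedGrassmannian p Hp) : (unit V).target = V :=
  RestrictedGrassmannian.ext (by
    change V.proj * star V.proj = V.proj
    rw [V.isStarProjection.isSelfAdjoint.star_eq, V.isStarProjection.isIdempotentElem.eq])

lemma target_mul (gh : {gh : RestrictedPartialIsometry p Hp × RestrictedPartialIsometry p Hp //
    source gh.1 = target gh.2}) : (mul gh).target = gh.1.1.target := by
  obtain ⟨⟨g, h⟩, composable⟩ := gh
  have source_eq : star g.toCLM * g.toCLM = h.toCLM * star h.toCLM :=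
    congrArg RestrictedGrassmannian.proj composable
  refine RestrictedGrassmannian.ext ?_
  change g.toCLM * h.toCLM * star (g.toCLM * h.toCLM) = g.toCLM * star g.toCLM
  calc g.toCLM * h.toCLM * star (g.toCLM * h.toCLM)
      = g.toCLM * (h.toCLM * star h.toCLM) * star g.toCLM := by simp only [star_mul, mul_assoc]
    _ = g.toCLM * star g.toCLM * g.toCLM * star g.toCLM := by
        rw [← source_eq]; simp only [mul_assoc]
    _ = g.toCLM * star g.toCLM := by rw [g.isPartialIsometry.mul_star_mul]

lemma source_mul (gh : {gh : RestrictedPartialIsometry p Hp × RestrictedPartialIsometry p Hp //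
    source gh.1 = target gh.2}) : (mul gh).source = gh.1.2.source := by
  obtain ⟨⟨g, h⟩, composable⟩ := gh
  have source_eq : star g.toCLM * g.toCLM = h.toCLM * star h.toCLM :=
    congrArg RestrictedGrassmannian.proj composable
  refine RestrictedGrassmannian.ext ?_
  change star (g.toCLM * h.toCLM) * (g.toCLM * h.toCLM) = star h.toCLM * h.toCLM
  calc star (g.toCLM * h.toCLM) * (g.toCLM * h.toCLM)
      = star h.toCLM * (star g.toCLM * g.toCLM) * h.toCLM := by simp only [star_mul, mul_assoc]
    _ = star h.toCLM * (h.toCLM * star h.toCLM * h.toCLM) := by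
        rw [source_eq]; simp only [mul_assoc]
    _ = star h.toCLM * h.toCLM := by rw [h.isPartialIsometry.mul_star_mul]

lemma toAmbient_inv (u : RestrictedPartialIsometry p Hp) :
    u.inv.toAmbient = (star u.toCLM, u.source, u.target) :=
  Prod.ext rfl (Prod.ext u.target_inv u.source_inv)

lemma toAmbient_unit (V : RestrictedGrassmannian p Hp) : (unit V).toAmbient = (V.proj, V, V) :=
  Prod.ext rfl (Prod.ext (target_unit V) (source_unit V))

lemma toAmbient_mul (gh : {gh : RestrictedPartialIsometry p Hp × RestrictedPartialIsometry p Hp //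
    source gh.1 = target gh.2}) :
    (mul gh).toAmbient = (gh.1.1.toCLM * gh.1.2.toCLM, gh.1.1.target, gh.1.2.source) :=
  Prod.ext rfl (Prod.ext (target_mul gh) (source_mul gh))

lemma exists_toAmbient_eq_mul_star (u : RestrictedPartialIsometry p Hp)
    {V : RestrictedGrassmannian p Hp} {a b : H →L[ℂ] H} (ha : a ∈ unitary (H →L[ℂ] H))
    (hb : b ∈ unitary (H →L[ℂ] H)) (source_eq : a * Hp.starProjection * star a = u.source.proj)
    (proj_eq : b * Hp.starProjection * star b = V.proj) :
    ∃ w : RestrictedPartialIsometry p Hp, w.toAmbient = (u.toCLM * a * star b, u.target, V) := by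
  refine exists_toAmbient_eq ?_ ?_
  · calc u.toCLM * a * star b * star (u.toCLM * a * star b)
        = u.toCLM * (a * (star b * b) * star a) * star u.toCLM := by
          simp only [star_mul, star_star, mul_assoc]
      _ = u.toCLM * star u.toCLM := by
          rw [Unitary.star_mul_self_of_mem hb, mul_one, Unitary.mul_star_self_of_mem ha, mul_one]
  · calc star (u.toCLM * a * star b) * (u.toCLM * a * star b)
        = b * (star a * (star u.toCLM * u.toCLM) * a) * star b := by
          simp only [star_mul, star_star, mul_assoc]
      _ = b * (star a * (a * Hp.starProjection * star a) * a) * star b := by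
          rw [source_eq]; rfl
      _ = b * (star a * a * Hp.starProjection * (star a * a)) * star b := by
          simp only [mul_assoc]
      _ = V.proj := by rw [Unitary.star_mul_self_of_mem ha, one_mul, mul_one, proj_eq]

end GroupoidLaws

variable {p : ℝ} [Fact (p = 0 ∨ 1 < p)] {H : Type*} [NormedAddCommGroup H]
  [InnerProductSpace ℂ H] [CompleteSpace H] {Hp : Submodule ℂ H} [CompleteSpace Hp]
  [Fact (¬ FiniteDimensional ℂ Hp)] [Fact (¬ FiniteDimensional ℂ Hpᗮ)]

variable (p Hp) in
/-- The Banach space on which the set of partial isometries is modelled. -/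
abbrev ModelSpace : Type _ :=
  SchattenClass p Hp Hpᗮ × SchattenClass p Hp Hpᗮ × SkewAdjointOperators Hp

lemma exists_isAdaptedChart_mem_source (u : RestrictedPartialIsometry p Hp) :
    ∃ φ : OpenPartialHomeomorph (RestrictedPartialIsometry p Hp) (ModelSpace p Hp),
      u ∈ φ.source ∧ IsAdaptedChart (ambientModel p Hp) toAmbient φ := by
  obtain ⟨Ω, σ, target_mem, hΩ, hσ⟩ := u.target.exists_isSmoothCrossSection
  obtain ⟨Ω', σ', source_mem, hΩ', hσ'⟩ := u.source.exists_isSmoothCrossSection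
  have mem_unitary := (transportToHp_mem_unitary hσ hσ' target_mem source_mem).1
  obtain ⟨Φ, source_eq, -, isAdaptedChart⟩ := exists_groupoidChart ⟨_, mem_unitary⟩ hΩ hΩ' hσ hσ'
  refine ⟨Φ.transHomeomorph (u.target.schattenClassEquiv.prodCongr
    (u.source.schattenClassEquiv.prodCongr (ContinuousLinearEquiv.refl ℝ _))).toHomeomorph,
    ?_, isAdaptedChart.transHomeomorph _⟩
  change u ∈ Φ.source
  rw [source_eq]
  refine ⟨target_mem, source_mem, ?_⟩
  change IsUnit (star (transportToHp σ σ' u) * transportToHp σ σ' u + 1)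
  rw [Unitary.star_mul_self_of_mem mem_unitary, one_add_one_eq_two]
  exact isUnit_two_of_algebra ℂ

instance : ChartedSpace (ModelSpace p Hp) (RestrictedPartialIsometry p Hp) where
  atlas := Set.range fun u : RestrictedPartialIsometry p Hp =>
    u.exists_isAdaptedChart_mem_source.choose
  chartAt u := u.exists_isAdaptedChart_mem_source.choose
  mem_chart_source u := u.exists_isAdaptedChart_mem_source.choose_spec.1
  chart_mem_atlas u := ⟨u, rfl⟩

lemma isAdaptedChart_of_mem_atlas :
    ∀ φ ∈ atlas (ModelSpace p Hp) (RestrictedPartialIsometry p Hp),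
      IsAdaptedChart (ambientModel p Hp) toAmbient φ := by
  rintro _ ⟨u, rfl⟩
  exact u.exists_isAdaptedChart_mem_source.choose_spec.2

instance : IsManifold 𝓘(ℝ, ModelSpace p Hp) ∞ (RestrictedPartialIsometry p Hp) :=
  isManifold_of_isAdaptedChart isAdaptedChart_of_mem_atlas

lemma contMDiff_toAmbient : ContMDiff 𝓘(ℝ, ModelSpace p Hp) (ambientModel p Hp) ∞
    (toAmbient : RestrictedPartialIsometry p Hp → _) :=
  contMDiff_of_isAdaptedChart isAdaptedChart_of_mem_atlas

lemma contMDiffWithinAt_of_toAmbient {E' H' N' : Type*} [NormedAddCommGroup E']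
    [NormedSpace ℝ E'] [TopologicalSpace H'] {I' : ModelWithCorners ℝ E' H'} [TopologicalSpace N']
    [ChartedSpace H' N'] {g : N' → RestrictedPartialIsometry p Hp} {s : Set N'} {x : N'}
    (hg : ContMDiffWithinAt I' (ambientModel p Hp) ∞ (fun y => (g y).toAmbient) s x) :
    ContMDiffWithinAt I' 𝓘(ℝ, ModelSpace p Hp) ∞ g s x :=
  contMDiffWithinAt_of_isAdaptedChart isInducing_toAmbient isAdaptedChart_of_mem_atlas hg

lemma contMDiff_toCLM : ContMDiff 𝓘(ℝ, ModelSpace p Hp) 𝓘(ℝ, H →L[ℂ] H) ∞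
    (toCLM : RestrictedPartialIsometry p Hp → _) :=
  contMDiff_fst.comp contMDiff_toAmbient

lemma contMDiff_target : ContMDiff 𝓘(ℝ, ModelSpace p Hp) 𝓘(ℝ, SchattenClass p Hp Hpᗮ) ∞
    (target : RestrictedPartialIsometry p Hp → _) :=
  (contMDiff_fst.comp contMDiff_snd).comp contMDiff_toAmbient

lemma contMDiff_source : ContMDiff 𝓘(ℝ, ModelSpace p Hp) 𝓘(ℝ, SchattenClass p Hp Hpᗮ) ∞
    (source : RestrictedPartialIsometry p Hp → _) :=
  (contMDiff_snd.comp contMDiff_snd).comp contMDiff_toAmbient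

lemma contMDiff_inv : ContMDiff 𝓘(ℝ, ModelSpace p Hp) 𝓘(ℝ, ModelSpace p Hp) ∞
    (inv : RestrictedPartialIsometry p Hp → _) := by
  refine fun u => contMDiffWithinAt_of_toAmbient ?_
  simp only [toAmbient_inv]
  exact (contMDiffOn_star contMDiff_toCLM.contMDiffOn u (Set.mem_univ u)).prodMk
    ((contMDiff_source u).prodMk (contMDiff_target u))

lemma continuous_unit : Continuous (unit : RestrictedGrassmannian p Hp → _) := by
  refine isInducing_toAmbient.continuous_iff.2 ?_
  rw [show toAmbient ∘ unit = _ from funext toAmbient_unit]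
  exact contMDiff_proj.continuous.prodMk (continuous_id.prodMk continuous_id)

lemma exists_source_localSection (u : RestrictedPartialIsometry p Hp) :
    ∃ τ : RestrictedGrassmannian p Hp → RestrictedPartialIsometry p Hp, τ u.source = u ∧
      ContMDiffAt 𝓘(ℝ, SchattenClass p Hp Hpᗮ) 𝓘(ℝ, ModelSpace p Hp) ∞ τ u.source ∧
      ∀ᶠ V in 𝓝 u.source, (τ V).source = V := by
  obtain ⟨Ω, σ, source_mem, -, hσ⟩ := u.source.exists_isSmoothCrossSection
  have exists_lift (V) : ∃ w : RestrictedPartialIsometry p Hp, V ∈ Ω →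
      w.toAmbient = (u.toCLM * σ u.source * star (σ V), u.target, V) := by
    by_cases hV : V ∈ Ω
    · obtain ⟨w, hw⟩ := u.exists_toAmbient_eq_mul_star (hσ.mem_unitary _ source_mem)
        (hσ.mem_unitary _ hV) (hσ.mul_starProjection_mul_star source_mem)
        (hσ.mul_starProjection_mul_star hV)
      exact ⟨w, fun _ => hw⟩
    · exact ⟨u, fun h => absurd h hV⟩
  choose τ toAmbient_τ using exists_lift
  have hΩ : Ω ∈ 𝓝 u.source := hσ.isOpen.mem_nhds source_mem
  refine ⟨τ, toAmbient_injective ?_, ?_, ?_⟩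
  · rw [toAmbient_τ _ source_mem, mul_assoc,
      Unitary.mul_star_self_of_mem (hσ.mem_unitary _ source_mem), mul_one, toAmbient]
  · refine (contMDiffWithinAt_of_toAmbient (ContMDiffWithinAt.congr ?_ toAmbient_τ
      (toAmbient_τ _ source_mem))).contMDiffAt hΩ
    exact (contMDiffOn_mul contMDiffOn_const (contMDiffOn_star hσ.smooth) _ source_mem).prodMk
      (contMDiffWithinAt_const.prodMk contMDiffWithinAt_id)
  · filter_upwards [hΩ] with V hV
    exact congrArg (fun x => x.2.2) (toAmbient_τ V hV)

lemma isBanachSubmersion_source : IsBanachSubmersion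
    (EG := ModelSpace p Hp) (EM := SchattenClass p Hp Hpᗮ)
    (source : RestrictedPartialIsometry p Hp → RestrictedGrassmannian p Hp) :=
  isBanachSubmersion_of_localSections contMDiff_source exists_source_localSection

lemma isBanachSubmersion_target : IsBanachSubmersion
    (EG := ModelSpace p Hp) (EM := SchattenClass p Hp Hpᗮ)
    (target : RestrictedPartialIsometry p Hp → RestrictedGrassmannian p Hp) := by
  refine isBanachSubmersion_of_localSections contMDiff_target fun u => ?_
  obtain ⟨τ, apply_eq, smooth, isSection⟩ := u.inv.exists_source_localSection
  rw [source_inv] at apply_eq smooth isSection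
  refine ⟨inv ∘ τ, ?_, contMDiff_inv.contMDiffAt.comp _ smooth, ?_⟩
  · rw [Function.comp_apply, apply_eq, inv_inv]
  · filter_upwards [isSection] with V hV
    rw [Function.comp_apply, target_inv, hV]

open Classical in
lemma contMDiffOn_groupoidMul : ContMDiffOn
    (𝓘(ℝ, ModelSpace p Hp).prod 𝓘(ℝ, ModelSpace p Hp)) 𝓘(ℝ, ModelSpace p Hp) ∞
    (fun gh : RestrictedPartialIsometry p Hp × RestrictedPartialIsometry p Hp =>
      if h : source gh.1 = target gh.2 then mul ⟨gh, h⟩ else gh.1)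
    {gh | source gh.1 = target gh.2} := by
  have toAmbient_dite (gh : RestrictedPartialIsometry p Hp × RestrictedPartialIsometry p Hp)
      (h : source gh.1 = target gh.2) :
      (if h : source gh.1 = target gh.2 then mul ⟨gh, h⟩ else gh.1).toAmbient =
        (gh.1.toCLM * gh.2.toCLM, gh.1.target, gh.2.source) := by
    rw [dif_pos h, toAmbient_mul]
  intro gh hgh
  refine contMDiffWithinAt_of_toAmbient
    (ContMDiffWithinAt.congr ?_ toAmbient_dite (toAmbient_dite gh hgh))
  exact (contMDiffOn_mul (contMDiff_toCLM.comp contMDiff_fst).contMDiffOn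
    (contMDiff_toCLM.comp contMDiff_snd).contMDiffOn gh hgh).prodMk
    (((contMDiff_target.comp contMDiff_fst) gh).contMDiffWithinAt.prodMk
      ((contMDiff_source.comp contMDiff_snd) gh).contMDiffWithinAt)

theorem isBanachLieGroupoid : IsBanachLieGroupoid
    (EG := ModelSpace p Hp) (EM := SchattenClass p Hp Hpᗮ)
    (RestrictedPartialIsometry p Hp) (RestrictedGrassmannian p Hp) source target mul unit inv where
  complete_total := inferInstance
  complete_base := inferInstance
  hausdorff_total := inferInstance
  hausdorff_base := inferInstance
  manifold_total := inferInstance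
  manifold_base := inferInstance
  source_surjective V := ⟨unit V, source_unit V⟩
  source_submersion := isBanachSubmersion_source
  target_surjective V := ⟨unit V, target_unit V⟩
  target_submersion := isBanachSubmersion_target
  smooth_mul := contMDiffOn_groupoidMul
  source_mul := source_mul
  target_mul := target_mul
  assoc_defined g h k := by
    constructor
    · rintro ⟨gh_composable, mul_composable⟩
      rw [source_mul] at mul_composable
      exact ⟨mul_composable, by rw [target_mul]; exact gh_composable⟩
    · rintro ⟨hk_composable, mul_composable⟩
      rw [target_mul] at mul_composable
      exact ⟨mul_composable, by rw [source_mul]; exact hk_composable⟩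
  mul_assoc g h k _ _ _ _ := RestrictedPartialIsometry.ext (mul_assoc g.toCLM h.toCLM k.toCLM)
  embedding_unit := Function.LeftInverse.isEmbedding source_unit contMDiff_source.continuous
    continuous_unit
  source_unit := source_unit
  target_unit := target_unit
  mul_unit g _ := RestrictedPartialIsometry.ext
    ((mul_assoc _ _ _).symm.trans g.isPartialIsometry.mul_star_mul)
  unit_mul g _ := RestrictedPartialIsometry.ext g.isPartialIsometry.mul_star_mul
  diffeomorph_inv := ⟨⟨⟨inv, inv, inv_inv, inv_inv⟩, contMDiff_inv, contMDiff_inv⟩, rfl⟩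
  mul_inv g := ⟨(target_inv g).symm, rfl⟩
  inv_mul g := ⟨source_inv g, rfl⟩

end RestrictedPartialIsometry

end

theorem mainTheorem4 {H : Type*} [NormedAddCommGroup H] [InnerProductSpace ℂ H] [CompleteSpace H]
    (Hp : Submodule ℂ H) [CompleteSpace Hp]
    (hplus : ¬ FiniteDimensional ℂ Hp) (hminus : ¬ FiniteDimensional ℂ Hpᗮ)
    (p : ℝ) [Fact (p = 0 ∨ 1 < p)] :
    ∃ (_ : TopologicalSpace (RestrictedGrassmannian p Hp))
      (_ : ChartedSpace (SchattenClass p Hp Hpᗮ) (RestrictedGrassmannian p Hp))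
      (_ : TopologicalSpace (RestrictedPartialIsometry p Hp))
      (_ : ChartedSpace
        (SchattenClass p Hp Hpᗮ × SchattenClass p Hp Hpᗮ × SkewAdjointOperators Hp)
        (RestrictedPartialIsometry p Hp)),
      -- the graph charts are smooth charts of the restricted Grassmannian
      (∀ W : RestrictedGrassmannian p Hp, CompleteSpace (SchattenClass p W.space W.spaceᗮ) ∧
        ∃ φ : OpenPartialHomeomorph (RestrictedGrassmannian p Hp)
            (SchattenClass p W.space W.spaceᗮ),
          φ.source = grassmannianChartDomain W ∧ φ.target = Set.univ ∧
          (∀ V ∈ φ.source, IsGrassmannianCoordinate W V (φ V)) ∧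
          IsSmoothChart (E := SchattenClass p Hp Hpᗮ) φ) ∧
      -- the domains of the smooth local cross sections cover the restricted Grassmannian
      (∀ W : RestrictedGrassmannian p Hp, ∃ Ω σ, W ∈ Ω ∧
        IsSmoothCrossSection (E := SchattenClass p Hp Hpᗮ) Ω σ) ∧
      -- the charts built from local cross sections are smooth charts of the total space
      (∀ (W W' : RestrictedGrassmannian p Hp) (Ω Ω' : Set (RestrictedGrassmannian p Hp))
        (σ σ' : RestrictedGrassmannian p Hp → (H →L[ℂ] H)) (g : unitary (Hp →L[ℂ] Hp)),
        Ω ⊆ grassmannianChartDomain W → Ω' ⊆ grassmannianChartDomain W' →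
        IsSmoothCrossSection (E := SchattenClass p Hp Hpᗮ) Ω σ →
        IsSmoothCrossSection (E := SchattenClass p Hp Hpᗮ) Ω' σ' →
        ∃ Φ : OpenPartialHomeomorph (RestrictedPartialIsometry p Hp)
            (SchattenClass p W.space W.spaceᗮ × SchattenClass p W'.space W'.spaceᗮ ×
              SkewAdjointOperators Hp),
          Φ.source = groupoidChartDomain Ω Ω' σ σ' g ∧
          (∀ u ∈ Φ.source, IsGroupoidCoordinate W W' σ σ' g u (Φ u)) ∧
          IsSmoothChart
            (E := SchattenClass p Hp Hpᗮ × SchattenClass p Hp Hpᗮ × SkewAdjointOperators Hp) Φ) ∧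
      -- the groupoid
      IsBanachLieGroupoid
        (EG := SchattenClass p Hp Hpᗮ × SchattenClass p Hp Hpᗮ × SkewAdjointOperators Hp)
        (EM := SchattenClass p Hp Hpᗮ)
        (RestrictedPartialIsometry p Hp) (RestrictedGrassmannian p Hp)
        RestrictedPartialIsometry.source RestrictedPartialIsometry.target
        RestrictedPartialIsometry.mul RestrictedPartialIsometry.unit
        RestrictedPartialIsometry.inv := by
  have := Fact.mk hplus
  have := Fact.mk hminus
  refine ⟨inferInstance, inferInstance, inferInstance, inferInstance, fun W => ⟨inferInstance,
    W.graphChart, W.graphChart_source, W.graphChart_target, fun V hV => ?_,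
    W.isSmoothChart_graphChart⟩, fun W => ?_, fun W W' Ω Ω' σ σ' g hΩ hΩ' hσ hσ' => ?_,
    RestrictedPartialIsometry.isBanachLieGroupoid⟩
  · exact RestrictedGrassmannian.isGrassmannianCoordinate_graphChart (W.graphChart_source ▸ hV)
  · obtain ⟨Ω, σ, W_mem, -, hσ⟩ := W.exists_isSmoothCrossSection
    exact ⟨Ω, σ, W_mem, hσ⟩
  · obtain ⟨Φ, source_eq, isCoordinate, isAdaptedChart⟩ :=
      RestrictedPartialIsometry.exists_groupoidChart g hΩ hΩ' hσ hσ'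
    exact ⟨Φ, source_eq, isCoordinate, isAdaptedChart.isSmoothChart
      RestrictedPartialIsometry.isInducing_toAmbient
      RestrictedPartialIsometry.isAdaptedChart_of_mem_atlas⟩
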